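/- **Setting.** Concept names, role names, individual constants and variables are finite words over a binary alphabet (kept apart by kind). A *basic role* is $P$ or $P^-$ with $P$ a role name; a *basic concept* is a concept name $A$ or $\exists P$ or $\exists P^-$. A $\textit{DL-Lite}_{\mathcal R}$ *TBox* $\mathcal T$ is a finite set of inclusions $B_1\sqsubseteq B_2$, $B_1\sqsubseteq\neg B_2$, $R_1\sqsubseteq R_2$, $R_1\sqsubseteq\neg R_2$ between basic concepts $B_i$ and between basic roles $R_i$, with the usual first-order semantics; its signature is the set of concept and role names that occur in it. A *policy* $\mathcal P$ over $\mathcal T$ is a finite set of denials $\forall\vec x\,(\phi(\vec x)\to\bot)$, where $\phi$ is a finite non-empty conjunction of atoms over the signature of $\mathcal T$ whose terms are constants or variables in $\vec x$. An *ABox for* $\mathcal T$ is a finite set $\mathcal A$ of ground atoms $A(a)$, $P(a,b)$ over the signature of $\mathcal T$ such that $\mathcal T\cup\mathcal A$ is consistent; its size $|\mathcal A|$ is the number of symbols in it. Let $\mathrm{cl}^{\mathcal T}_{\mathbf{GA}}(\mathcal A)$ be the set of ground atoms over the signature of $\mathcal T\cup\mathcal A$ that are entailed by $\mathcal T\cup\mathcal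 A$. A *confidentiality-preserving (CP) censor in* $\mathbf{GA}$ (the language of ground atoms) for $\mathcal T$ and $\mathcal P$ is a function $\mathsf{cens}$ that maps each ABox $\mathcal A$ for $\mathcal T$ to a set $\mathsf{cens}(\mathcal A)\subseteq \mathrm{cl}^{\mathcal T}_{\mathbf{GA}}(\mathcal A)$ such that $\mathcal T\cup\mathcal P\cup\mathsf{cens}(\mathcal A)$ is a consistent first-order theory. It is *optimal* if there is no CP censor $\mathsf{cens}'$ in $\mathbf{GA}$ for $\mathcal T$ and $\mathcal P$ with $\mathsf{cens}(\mathcal A)\subseteq\mathsf{cens}'(\mathcal A)$ for all $\mathcal A$ and $\mathsf{cens}(\mathcal A)\subsetneq\mathsf{cens}'(\mathcal A)$ for some $\mathcal A$. The algorithm $\mathsf{OptGACensor}(\mathcal T,\mathcal P,\mathcal A)$ is the following: set $\mathcal A_{\mathcal T}:=\mathrm{cl}^{\mathcal T}_{\mathbf{GA}}(\mathcal A)$ and $\mathit{Th}:=\emptyset$; while $\mathcal A_{\mathcal T}\neq\emptyset$, remove from $\mathcal A_{\mathcal T}$ its lexicographically first element $\alpha$, and if $\mathcal T\cup\mathit{Th}\cup\{\alpha\}\cup\mathcal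 P$ is consistent, put $\mathit{Th}:=\mathit{Th}\cup\{\alpha\}$; finally return $\mathit{Th}$. Programs are those of a WHILE language on binary trees (operations $\mathsf{nil}$, $\mathsf{cons}$, $\mathsf{hd}$, $\mathsf{tl}$, conditionals and loops that test for $\mathsf{nil}$, each of unit cost), and finite sets are given as repetition-free lists. **Theorem.** There are programs that compute $(\mathcal T,\mathcal A)\mapsto\mathrm{cl}^{\mathcal T}_{\mathbf{GA}}(\mathcal A)$ (as a lexicographically sorted list) and decide the consistency of $\mathcal T\cup\mathcal P\cup\mathcal S$ for finite sets $\mathcal S$ of ground atoms, such that the algorithm $\mathsf{OptGACensor}$ that calls these programs has the following property. For every $\textit{DL-Lite}_{\mathcal R}$ TBox $\mathcal T$ and every policy $\mathcal P$ over $\mathcal T$ with $\mathcal T\cup\mathcal P$ consistent, there are an optimal CP censor $\mathsf{cens}$ in $\mathbf{GA}$ for $\mathcal T$ and $\mathcal P$ and a polynomial $p$ such that, for each ABox $\mathcal A$ for $\mathcal T$, $\mathsf{OptGACensor}(\mathcal T,\mathcal P,\mathcal A)$ (i) returns $\mathsf{cens}(\mathcal A)$ and (ii) runs in at most $p(|\mathcal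 A|)$ steps. -/

import Mathlib

namespace CQE

/-! ### DL-Lite_R: names, TBoxes, ABoxes, denials -/

/-- Names of concepts, roles, individuals and variables are finite words. The four alphabets are
kept apart by the constructors in which the names are used. -/
abbrev Name := List Bool

/-- A basic role: `P` or its inverse. -/
inductive Role
  | atomic (P : Name)
  | inv (P : Name)

/-- A basic concept: `A`, or the unqualified existential restriction `∃R`. -/
inductive Concept
  | atomic (A : Name)
  | ex (R : Role)

/-- The assertions of a DL-Lite_R TBox. -/
inductive Inclusion
  | conceptIncl (B₁ B₂ : Concept)
  | conceptDisj (B₁ B₂ : Concept)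
  | roleIncl (R₁ R₂ : Role)
  | roleDisj (R₁ R₂ : Role)

abbrev TBox := Finset Inclusion

/-- Ground atoms `A(a)` and `P(a,b)`. -/
inductive GroundAtom
  | concept (A a : Name)
  | role (P a b : Name)

inductive Term
  | var (x : Name)
  | const (c : Name)

inductive QueryAtom
  | concept (A : Name) (t : Term)
  | role (P : Name) (t u : Term)

/-- A Boolean conjunctive query: a non-empty conjunction of atoms, all of whose variables are
existentially quantified. -/
structure BCQ where
  atoms : List QueryAtom
  nonempty : atoms ≠ []

/-- The denial assertion `∀ x, φ(x) → ⊥`, given by the query `∃ x, φ(x)`. -/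
structure Denial where
  body : BCQ

abbrev Policy := Finset Denial

/-! ### Signatures -/

inductive Pred
  | concept (A : Name)
  | role (P : Name)

def Role.pred : Role → Pred
  | .atomic P => .role P
  | .inv P => .role P

def Concept.pred : Concept → Pred
  | .atomic A => .concept A
  | .ex R => R.pred

def Inclusion.sig : Inclusion → Set Pred
  | .conceptIncl B₁ B₂ => {B₁.pred, B₂.pred}
  | .conceptDisj B₁ B₂ => {B₁.pred, B₂.pred}
  | .roleIncl R₁ R₂ => {R₁.pred, R₂.pred}
  | .roleDisj R₁ R₂ => {R₁.pred, R₂.pred}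

def TBox.sig (T : TBox) : Set Pred := {p | ∃ i ∈ T, p ∈ i.sig}

def GroundAtom.pred : GroundAtom → Pred
  | .concept A _ => .concept A
  | .role P _ _ => .role P

def QueryAtom.pred : QueryAtom → Pred
  | .concept A _ => .concept A
  | .role P _ _ => .role P

/-- The policy is specified over the signature of the TBox. -/
def Policy.IsOver (P : Policy) (T : TBox) : Prop :=
  ∀ δ ∈ P, ∀ q ∈ δ.body.atoms, q.pred ∈ TBox.sig T

/-! ### First-order semantics -/

/-- First-order interpretations (without the unique name assumption). The domain is non-empty
since it interprets the constants. -/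
structure Interp where
  Dom : Type
  concept : Name → Dom → Prop
  role : Name → Dom → Dom → Prop
  const : Name → Dom

namespace Interp

variable (I : Interp)

def evalRole : Role → I.Dom → I.Dom → Prop
  | .atomic P => fun x y => I.role P x y
  | .inv P => fun x y => I.role P y x

def evalConcept : Concept → I.Dom → Prop
  | .atomic A => fun x => I.concept A x
  | .ex R => fun x => ∃ y, I.evalRole R x y

def SatInclusion : Inclusion → Prop
  | .conceptIncl B₁ B₂ => ∀ x, I.evalConcept B₁ x → I.evalConcept B₂ x
  | .conceptDisj B₁ B₂ => ∀ x, I.evalConcept B₁ x → ¬ I.evalConcept B₂ x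
  | .roleIncl R₁ R₂ => ∀ x y, I.evalRole R₁ x y → I.evalRole R₂ x y
  | .roleDisj R₁ R₂ => ∀ x y, I.evalRole R₁ x y → ¬ I.evalRole R₂ x y

def SatGround : GroundAtom → Prop
  | .concept A a => I.concept A (I.const a)
  | .role P a b => I.role P (I.const a) (I.const b)

def termVal (v : Name → I.Dom) : Term → I.Dom
  | .var x => v x
  | .const c => I.const c

def SatAtom (v : Name → I.Dom) : QueryAtom → Prop
  | .concept A t => I.concept A (I.termVal v t)
  | .role P t u => I.role P (I.termVal v t) (I.termVal v u)

def SatBCQ (q : BCQ) : Prop := ∃ v : Name → I.Dom, ∀ α ∈ q.atoms, I.SatAtom v α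

def SatDenial (δ : Denial) : Prop := ¬ I.SatBCQ δ.body

end Interp

/-- The first-order theory `T ∪ P ∪ S` is consistent. -/
def Consistent (T : TBox) (P : Policy) (S : Set GroundAtom) : Prop :=
  ∃ I : Interp, (∀ i ∈ T, I.SatInclusion i) ∧ (∀ δ ∈ P, I.SatDenial δ) ∧ ∀ α ∈ S, I.SatGround α

/-- `T ∪ S ⊨ α`. -/
def Entails (T : TBox) (S : Set GroundAtom) (α : GroundAtom) : Prop :=
  ∀ I : Interp, (∀ i ∈ T, I.SatInclusion i) → (∀ β ∈ S, I.SatGround β) → I.SatGround α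

/-- An ABox for `T`: a finite set of ground atoms over the signature of `T`, consistent
with `T`. -/
structure ABoxFor (T : TBox) where
  atoms : Finset GroundAtom
  over_sig : ∀ α ∈ atoms, α.pred ∈ TBox.sig T
  consistent : Consistent T ∅ (atoms : Set GroundAtom)

/-- The ground atoms over the signature of `T ∪ A` that are entailed by `T ∪ A`. -/
def closureGA (T : TBox) (A : ABoxFor T) : Set GroundAtom :=
  {α | (α.pred ∈ TBox.sig T ∨ ∃ β ∈ A.atoms, α.pred = β.pred) ∧
    Entails T (A.atoms : Set GroundAtom) α}

/-! ### Confidentiality-preserving censors in the language of ground atoms -/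

abbrev Censor (T : TBox) := ABoxFor T → Set GroundAtom

def IsCPCensorGA (T : TBox) (P : Policy) (cens : Censor T) : Prop :=
  ∀ A : ABoxFor T, cens A ⊆ closureGA T A ∧ Consistent T P (cens A)

/-- `cens'` is more informative than `cens`. -/
def MoreInformative {T : TBox} (cens' cens : Censor T) : Prop :=
  (∀ A, cens A ⊆ cens' A) ∧ ∃ A, cens A ⊂ cens' A

def IsOptimalCPCensorGA (T : TBox) (P : Policy) (cens : Censor T) : Prop :=
  IsCPCensorGA T P cens ∧
    ¬ ∃ cens' : Censor T, IsCPCensorGA T P cens' ∧ MoreInformative cens' cens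

/-! ### A programming language with a step count

Data are binary trees. A program maps a tree to a tree; its primitive operations are those of
Jones's WHILE language (`nil`, `cons`, `hd`, `tl`, test against `nil`, `while`), each of unit
cost, and there is no comparison of trees in one step. -/

inductive Data
  | nil
  | node (l r : Data)

def Data.hd : Data → Data
  | .nil => .nil
  | .node l _ => l

def Data.tl : Data → Data
  | .nil => .nil
  | .node _ r => r

inductive Prog
  /-- return the input -/
  | arg
  | nil
  | cons (p q : Prog)
  | hd (p : Prog)
  | tl (p : Prog)
  /-- run `p`, then run `q` on the result of `p` -/
  | call (q p : Prog)
  /-- run `p` if `c` returns a tree other than `nil`, and `q` otherwise -/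
  | ite (c p q : Prog)
  /-- while `c` returns a tree other than `nil` on the current tree, replace that tree by the
  result of `b` on it -/
  | loop (c b : Prog)

/-- `Run p x y n`: on the input `x` the program `p` halts after exactly `n` steps with the
result `y`. -/
inductive Run : Prog → Data → Data → ℕ → Prop
  | arg (x : Data) : Run .arg x x 1
  | nil (x : Data) : Run .nil x .nil 1
  | cons {p q : Prog} {x a b : Data} {m n : ℕ} :
      Run p x a m → Run q x b n → Run (.cons p q) x (.node a b) (m + n + 1)
  | hd {p : Prog} {x a : Data} {m : ℕ} : Run p x a m → Run (.hd p) x a.hd (m + 1)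
  | tl {p : Prog} {x a : Data} {m : ℕ} : Run p x a m → Run (.tl p) x a.tl (m + 1)
  | call {p q : Prog} {x a b : Data} {m n : ℕ} :
      Run p x a m → Run q a b n → Run (.call q p) x b (m + n + 1)
  | iteThen {c p q : Prog} {x u v b : Data} {m n : ℕ} :
      Run c x (.node u v) m → Run p x b n → Run (.ite c p q) x b (m + n + 1)
  | iteElse {c p q : Prog} {x b : Data} {m n : ℕ} :
      Run c x .nil m → Run q x b n → Run (.ite c p q) x b (m + n + 1)
  | loopDone {c b : Prog} {x : Data} {m : ℕ} : Run c x .nil m → Run (.loop c b) x x (m + 1)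
  | loopStep {c b : Prog} {x u v y z : Data} {m n k : ℕ} :
      Run c x (.node u v) m → Run b x y n → Run (.loop c b) y z k →
        Run (.loop c b) x z (m + n + k + 1)

/-! ### Trees as representations of the inputs and outputs -/

def encBool : Bool → Data
  | false => .nil
  | true => .node .nil .nil

def encList {α : Type} (enc : α → Data) : List α → Data
  | [] => .nil
  | a :: l => .node (enc a) (encList enc l)

def encName : Name → Data := encList encBool

def Role.enc : Role → Data
  | .atomic P => .node (encBool false) (encName P)
  | .inv P => .node (encBool true) (encName P)

def Concept.enc : Concept → Data
  | .atomic A => .node (encBool false) (encName A)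
  | .ex R => .node (encBool true) R.enc

def Inclusion.enc : Inclusion → Data
  | .conceptIncl B₁ B₂ => .node (.node (encBool false) (encBool false)) (.node B₁.enc B₂.enc)
  | .conceptDisj B₁ B₂ => .node (.node (encBool false) (encBool true)) (.node B₁.enc B₂.enc)
  | .roleIncl R₁ R₂ => .node (.node (encBool true) (encBool false)) (.node R₁.enc R₂.enc)
  | .roleDisj R₁ R₂ => .node (.node (encBool true) (encBool true)) (.node R₁.enc R₂.enc)

def Term.enc : Term → Data
  | .var x => .node (encBool false) (encName x)
  | .const c => .node (encBool true) (encName c)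

def QueryAtom.enc : QueryAtom → Data
  | .concept A t => .node (encBool false) (.node (encName A) t.enc)
  | .role P t u => .node (encBool true) (.node (encName P) (.node t.enc u.enc))

def Denial.enc (δ : Denial) : Data := encList QueryAtom.enc δ.body.atoms

/-- A ground atom written as a list of words: its kind, its predicate and its arguments. -/
def GroundAtom.key : GroundAtom → List Name
  | .concept A a => [[false], A, a]
  | .role P a b => [[true], P, a, b]

def GroundAtom.enc (α : GroundAtom) : Data := encList encName α.key

/-- The lexicographic order of ground atoms. -/
def GroundAtom.LexLT (α β : GroundAtom) : Prop := α.key < β.key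

/-- The number of symbols in a ground atom. -/
def GroundAtom.size : GroundAtom → ℕ
  | .concept A a => 1 + A.length + a.length
  | .role P a b => 1 + P.length + a.length + b.length

def ABoxFor.size {T : TBox} (A : ABoxFor T) : ℕ := ∑ α ∈ A.atoms, α.size

/-- The tree `d` represents the set `S`: it is the list of the elements of `S`, in some order
and without repetitions. -/
def Represents {α : Type} (enc : α → Data) (d : Data) (S : Set α) : Prop :=
  ∃ l : List α, l.Nodup ∧ (∀ a, a ∈ l ↔ a ∈ S) ∧ d = encList enc l

/-! ### The algorithm -/

/-- On every input `(T . A)` the program returns the lexicographically sorted list of the ground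
atoms entailed by `T ∪ A`. -/
def ComputesClosureGA (cl : Prog) : Prop :=
  ∀ (T : TBox) (A : ABoxFor T) (dT dA : Data),
    Represents Inclusion.enc dT (T : Set Inclusion) →
    Represents GroundAtom.enc dA (A.atoms : Set GroundAtom) →
    ∃ (l : List GroundAtom) (n : ℕ), l.Pairwise GroundAtom.LexLT ∧
      (∀ α, α ∈ l ↔ α ∈ closureGA T A) ∧
      Run cl (.node dT dA) (encList GroundAtom.enc l) n

/-- On every input `(T . (P . S))`, with `S` a finite set of ground atoms, the program halts; it
returns a tree other than `nil` iff `T ∪ P ∪ S` is consistent. -/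
def DecidesConsistency (con : Prog) : Prop :=
  ∀ (T : TBox) (P : Policy) (S : Finset GroundAtom) (dT dP dS : Data),
    Represents Inclusion.enc dT (T : Set Inclusion) →
    Represents Denial.enc dP (P : Set Denial) →
    Represents GroundAtom.enc dS (S : Set GroundAtom) →
    ∃ (r : Data) (n : ℕ), Run con (.node dT (.node dP dS)) r n ∧
      (r ≠ .nil ↔ Consistent T P (S : Set GroundAtom))

/-- The algorithm OptGACensor on the input `(T . (P . A))`, where `cl` is called to compute the set
of entailed ground atoms and `con` to test consistency. The loop acts on trees of the form
`((T . P) . (AT . Th))`; as `AT` is a lexicographically sorted list, its first assertion is its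
head. -/
def OptGACensor (cl con : Prog) : Prog :=
  let x := Prog.arg
  -- `AT := cl(T, A); Th := ∅`
  let init : Prog :=
    .cons (.cons (.hd x) (.hd (.tl x))) (.cons (.call cl (.cons (.hd x) (.tl (.tl x)))) .nil)
  let T : Prog := .hd (.hd x)
  let P : Prog := .tl (.hd x)
  let AT : Prog := .hd (.tl x)
  let Th : Prog := .tl (.tl x)
  let α : Prog := .hd AT
  -- `AT := AT \ {α}; if T ∪ Th ∪ {α} ∪ P is consistent then Th := Th ∪ {α}`
  let body : Prog :=
    .cons (.cons T P) (.cons (.tl AT)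
      (.ite (.call con (.cons T (.cons P (.cons α Th)))) (.cons α Th) Th))
  -- `return Th`
  .call Th (.call (.loop AT body) init)

end CQE

/-!
Entailment is decided by the chase of an ABox with the positive inclusions, whose new elements are
Skolem terms, that is, words of roles over an individual. A fact about elements of depth at most `d`
appears after a number of rounds that depends only on `d` and the TBox: a path of inclusions need
not be longer than the number of inclusions, and a Skolem term depends only on a concept of its
parent. A match of a denial can be made shallow, because the facts below an element depend only on
its last role, so a subtree can be moved to a shallower element with the same last role. Hence both
the entailed ground atoms and consistency are found in a bounded number of rounds of the chase,
which takes polynomial time once the TBox and the policy are fixed.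

Consistency is antitone in the set of atoms, so an atom rejected by the greedy algorithm remains
incompatible with its output. The output is therefore a maximal consistent set of entailed ground
atoms, and a censor whose values are maximal is optimal.
-/

namespace CQE

/-! ### The chase -/

/-- An element of the chase: an individual `a` and a word `Rₙ ⋯ R₁`, standing for the Skolem term
`fᴿⁿ(⋯ fᴿ¹(a) ⋯)`. The last applied Skolem function comes first. -/
abbrev Elem := Name × List Role

/-- The Skolem term for the `R`-successor of `x`. -/
def child (x : Elem) (R : Role) : Elem := (x.1, R :: x.2)

/-- An atom over the elements of the chase. -/
inductive Fact
  | concept (A : Name) (x : Elem)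
  | role (P : Name) (x y : Elem)

/-- The elements that occur in a fact. -/
def Fact.elems : Fact → List Elem
  | .concept _ x => [x]
  | .role _ x y => [x, y]

/-- The image of a fact under a map of elements. -/
def Fact.map (σ : Elem → Elem) : Fact → Fact
  | .concept A x => .concept A (σ x)
  | .role P x y => .role P (σ x) (σ y)

/-- The inverse of a basic role. -/
def Role.flip : Role → Role
  | .atomic P => .inv P
  | .inv P => .atomic P

/-- The fact stating that `x` and `y` are in the basic role. -/
def Role.fact : Role → Elem → Elem → Fact
  | .atomic P, x, y => .role P x y
  | .inv P, x, y => .role P y x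

/-- The fact that puts `x` into the basic concept, with a Skolem term for the existential. -/
def Concept.fact : Concept → Elem → Fact
  | .atomic A, x => .concept A x
  | .ex R, x => R.fact x (child x R)

/-- The fact `φ` witnesses that `x` belongs to the concept. -/
def Fact.Shows (φ : Fact) : Concept → Elem → Prop
  | .atomic A, x => φ = .concept A x
  | .ex R, x => ∃ y, φ = R.fact x y

/-- One application of a positive inclusion of `T`. A concept inclusion is applied even where the
conclusion is already witnessed (the chase is oblivious). -/
inductive Step (T : TBox) : Fact → Fact → Prop
  | concept {B₁ B₂ : Concept} {φ : Fact} {x : Elem} :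
      .conceptIncl B₁ B₂ ∈ T → φ.Shows B₁ x → Step T φ (B₂.fact x)
  | role {R₁ R₂ : Role} {x y : Elem} :
      .roleIncl R₁ R₂ ∈ T → Step T (R₁.fact x y) (R₂.fact x y)

/-- The chase of `S` with the positive inclusions of `T`. -/
inductive Derives (T : TBox) (S : Set Fact) : Fact → Prop
  | base {φ : Fact} : φ ∈ S → Derives T S φ
  | step {φ ψ : Fact} : Derives T S ψ → Step T ψ φ → Derives T S φ

/-- The facts of the chase that are derived in at most `n` rounds. -/
def DerivesWithin (T : TBox) (S : Set Fact) : ℕ → Fact → Prop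
  | 0, φ => φ ∈ S
  | n + 1, φ => DerivesWithin T S n φ ∨ ∃ ψ, DerivesWithin T S n ψ ∧ Step T ψ φ

@[simp] theorem Role.flip_flip (R : Role) : R.flip.flip = R := by cases R <;> rfl

theorem Role.fact_flip (R : Role) (x y : Elem) : R.flip.fact x y = R.fact y x := by
  cases R <;> rfl

theorem Role.fact_eq_fact_iff {R Q : Role} {x y z w : Elem} :
    R.fact x y = Q.fact z w ↔ (Q = R ∧ z = x ∧ w = y) ∨ (Q = R.flip ∧ z = y ∧ w = x) := by
  cases R <;> cases Q <;> simp only [Role.fact, Role.flip, Fact.role.injEq] <;> grind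

theorem Role.fact_ne_concept {R : Role} {x y : Elem} {A : Name} {z : Elem} :
    R.fact x y ≠ .concept A z := by
  cases R <;> simp [Role.fact]

@[simp] theorem Role.mem_elems_fact {R : Role} {x y z : Elem} :
    z ∈ (R.fact x y).elems ↔ z = x ∨ z = y := by
  cases R <;> simp [Role.fact, Fact.elems, or_comm]

theorem Role.map_fact (σ : Elem → Elem) (R : Role) (x y : Elem) :
    (R.fact x y).map σ = R.fact (σ x) (σ y) := by
  cases R <;> rfl

theorem Fact.Shows.mem_elems {φ : Fact} {B : Concept} {x : Elem} (h : φ.Shows B x) :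
    x ∈ φ.elems := by
  cases B with
  | atomic A => cases h; simp [Fact.elems]
  | ex R => obtain ⟨y, rfl⟩ := h; simp

theorem Fact.Shows.map {φ : Fact} {B : Concept} {x : Elem} (σ : Elem → Elem) (h : φ.Shows B x) :
    (φ.map σ).Shows B (σ x) := by
  cases B with
  | atomic A => cases h; rfl
  | ex R => obtain ⟨y, rfl⟩ := h; exact ⟨σ y, Role.map_fact σ R x y⟩

theorem Concept.shows_fact (B : Concept) (x : Elem) : (B.fact x).Shows B x := by
  cases B with
  | atomic A => rfl
  | ex R => exact ⟨_, rfl⟩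

theorem Fact.map_id_of_forall {σ : Elem → Elem} {φ : Fact} (h : ∀ x ∈ φ.elems, σ x = x) :
    φ.map σ = φ := by
  cases φ <;> simp_all [Fact.map, Fact.elems]

theorem Fact.map_congr {σ τ : Elem → Elem} {φ : Fact} (h : ∀ x ∈ φ.elems, σ x = τ x) :
    φ.map σ = φ.map τ := by
  cases φ <;> simp_all [Fact.map, Fact.elems]

theorem Role.shows_fact_iff {R : Role} {x y z : Elem} {B : Concept} :
    (R.fact x y).Shows B z ↔ (B = .ex R ∧ z = x) ∨ (B = .ex R.flip ∧ z = y) := by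
  cases B with
  | atomic A => simp [Fact.Shows, Role.fact_ne_concept]
  | ex Q => simp only [Fact.Shows, Role.fact_eq_fact_iff, Concept.ex.injEq]; grind

theorem Concept.shows_fact_iff {B C : Concept} {x z : Elem} :
    (B.fact x).Shows C z ↔
      (C = B ∧ z = x) ∨ ∃ R, B = .ex R ∧ C = .ex R.flip ∧ z = child x R := by
  cases B with
  | atomic A =>
    cases C with
    | atomic A' => simp only [Fact.Shows, Concept.fact, Fact.concept.injEq]; grind
    | ex Q => simp [Fact.Shows, Concept.fact, Role.fact_ne_concept.symm]
  | ex R => simp [Concept.fact, Role.shows_fact_iff]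

theorem Concept.mem_elems_fact {B : Concept} {x z : Elem} (h : z ∈ (B.fact x).elems) :
    z = x ∨ ∃ R, B = .ex R ∧ z = child x R := by
  cases B with
  | atomic A => simpa [Concept.fact, Fact.elems] using h
  | ex R => simpa [Concept.fact] using h

theorem Concept.fact_eq_fact {B : Concept} {R : Role} {x y z : Elem} (h : B.fact x = R.fact y z) :
    ∃ Q, B = .ex Q ∧ ((R = Q ∧ y = x ∧ z = child x Q) ∨ (R = Q.flip ∧ y = child x Q ∧ z = x)) := by
  cases B with
  | atomic A => exact absurd h.symm Role.fact_ne_concept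
  | ex Q => exact ⟨Q, rfl, Role.fact_eq_fact_iff.1 h⟩

/-! ### Rounds of the chase -/

section Rounds

variable {T : TBox} {S : Set Fact}

theorem DerivesWithin.mono {m n : ℕ} (h : m ≤ n) {φ : Fact} (hφ : DerivesWithin T S m φ) :
    DerivesWithin T S n φ := by
  induction h with
  | refl => exact hφ
  | step _ ih => exact .inl ih

theorem DerivesWithin.derives {n : ℕ} {φ : Fact} (h : DerivesWithin T S n φ) : Derives T S φ := by
  induction n generalizing φ with
  | zero => exact .base h
  | succ n ih =>
    rcases h with h | ⟨ψ, h, hs⟩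
    · exact ih h
    · exact .step (ih h) hs

theorem eq_or_exists_avoiding_of_reflTransGen {α : Type*} {r : α → α → Prop} {a b : α}
    (h : Relation.ReflTransGen r a b) :
    a = b ∨ ∃ c, Relation.ReflTransGen (fun x y => r x y ∧ y ≠ b) a c ∧ r c b := by
  induction h using Relation.ReflTransGen.head_induction_on with
  | refl => exact .inl rfl
  | @head a c hac _ ih =>
    by_cases hc : c = b
    · exact .inr ⟨a, .refl, hc ▸ hac⟩
    · obtain ⟨d, hcd, hdb⟩ := ih.resolve_left hc
      exact .inr ⟨d, .head ⟨hac, hc⟩ hcd, hdb⟩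

/-- Cut the path so that its last target occurs only once: the remaining path has one
target less. -/
theorem reach_within_card {α : Type*} {P : ℕ → α → Prop} (hmono : ∀ n a, P n a → P (n + 1) a)
    {r : α → α → Prop} (hr : ∀ n a b, r a b → P n a → P (n + 1) b) (L : Finset α)
    (hL : ∀ a b, r a b → b ∈ L) {m : ℕ} {a b : α} (ha : P m a)
    (hab : Relation.ReflTransGen r a b) : P (m + L.card) b := by
  classical
  have hmono' : ∀ k, P (m + k) a := fun k => by
    induction k with
    | zero => exact ha
    | succ k ih => exact hmono _ _ ih
  induction L using Finset.strongInduction generalizing r b with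
  | H L ih =>
    rcases eq_or_exists_avoiding_of_reflTransGen hab with rfl | ⟨c, hac, hcb⟩
    · exact hmono' _
    · have hb : b ∈ L := hL _ _ hcb
      have hc : P (m + (L.erase b).card) c := ih _ (Finset.erase_ssubset hb)
        (fun n x y hxy => hr n x y hxy.1)
        (fun x y hxy => Finset.mem_erase.2 ⟨hxy.2, hL _ _ hxy.1⟩) hac
      rw [← Finset.card_erase_add_one hb]
      exact hr _ _ _ hcb hc

/-- `T` contains `R ⊑ Q`, possibly with both roles inverted. -/
def RoleEdge (T : TBox) (R Q : Role) : Prop :=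
  .roleIncl R Q ∈ T ∨ .roleIncl R.flip Q.flip ∈ T

/-- The inclusion of `B` in `C` follows from a single positive inclusion of `T`. -/
def ConceptEdge (T : TBox) (B C : Concept) : Prop :=
  .conceptIncl B C ∈ T ∨ ∃ R Q, B = .ex R ∧ C = .ex Q ∧ RoleEdge T R Q

theorem RoleEdge.flip {R Q : Role} (h : RoleEdge T R Q) : RoleEdge T R.flip Q.flip := by
  simpa [RoleEdge, or_comm] using h

theorem RoleEdge.step {R Q : Role} (h : RoleEdge T R Q) (x y : Elem) :
    Step T (R.fact x y) (Q.fact x y) := by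
  rcases h with h | h
  · exact .role h
  · rw [← R.fact_flip, ← Q.fact_flip]
    exact .role h

theorem exists_finset_targets_roleEdge (T : TBox) :
    ∃ L : Finset Role, L.card ≤ 2 * T.card ∧ ∀ R Q, RoleEdge T R Q → Q ∈ L := by
  classical
  let targets : Inclusion → Finset Role
    | .roleIncl _ Q => {Q, Q.flip}
    | _ => ∅
  refine ⟨T.biUnion targets, ?_, ?_⟩
  · rw [mul_comm]
    refine Finset.card_biUnion_le_card_mul _ _ _ fun i _ => ?_
    cases i <;> simp [targets, Finset.card_le_two]
  · rintro R Q (h | h) <;> exact Finset.mem_biUnion.2 ⟨_, h, by simp [targets]⟩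

theorem exists_finset_targets_conceptEdge (T : TBox) :
    ∃ L : Finset Concept, L.card ≤ 2 * T.card ∧ ∀ B C, ConceptEdge T B C → C ∈ L := by
  classical
  let targets : Inclusion → Finset Concept
    | .conceptIncl _ C => {C}
    | .roleIncl _ Q => {.ex Q, .ex Q.flip}
    | _ => ∅
  refine ⟨T.biUnion targets, ?_, ?_⟩
  · rw [mul_comm]
    refine Finset.card_biUnion_le_card_mul _ _ _ fun i _ => ?_
    cases i <;> simp [targets, Finset.card_le_two]
  · rintro B C (h | ⟨R, Q, -, rfl, h | h⟩) <;>
      exact Finset.mem_biUnion.2 ⟨_, h, by simp [targets]⟩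

theorem DerivesWithin.of_reach_role {n : ℕ} {R Q : Role} {x y : Elem}
    (h : DerivesWithin T S n (R.fact x y)) (hRQ : Relation.ReflTransGen (RoleEdge T) R Q) :
    DerivesWithin T S (n + 2 * T.card) (Q.fact x y) := by
  obtain ⟨L, hcard, hL⟩ := exists_finset_targets_roleEdge T
  have hreach := reach_within_card (P := fun n (R : Role) => DerivesWithin T S n (R.fact x y))
    (fun n _ h => h.mono n.le_succ) (fun n R Q hRQ h => .inr ⟨_, h, hRQ.step x y⟩) L hL h hRQ
  exact hreach.mono (by lia)

/-- The first `n` rounds of the chase witness that `x` belongs to `B`. -/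
def ShownWithin (T : TBox) (S : Set Fact) (n : ℕ) (B : Concept) (x : Elem) : Prop :=
  ∃ φ, DerivesWithin T S n φ ∧ φ.Shows B x

theorem ShownWithin.succ_of_conceptEdge {n : ℕ} {B C : Concept} {x : Elem}
    (h : ShownWithin T S n B x) (hBC : ConceptEdge T B C) : ShownWithin T S (n + 1) C x := by
  obtain ⟨φ, hφ, hs⟩ := h
  rcases hBC with hi | ⟨R, Q, rfl, rfl, hRQ⟩
  · exact ⟨_, .inr ⟨φ, hφ, .concept hi hs⟩, C.shows_fact x⟩
  · obtain ⟨y, rfl⟩ := hs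
    exact ⟨Q.fact x y, .inr ⟨_, hφ, hRQ.step x y⟩, y, rfl⟩

theorem ShownWithin.of_reach_concept {n : ℕ} {B C : Concept} {x : Elem}
    (h : ShownWithin T S n B x) (hBC : Relation.ReflTransGen (ConceptEdge T) B C) :
    ShownWithin T S (n + 2 * T.card) C x := by
  obtain ⟨L, hcard, hL⟩ := exists_finset_targets_conceptEdge T
  obtain ⟨φ, hφ, hs⟩ := reach_within_card (P := fun n (B : Concept) => ShownWithin T S n B x)
    (fun n B ⟨φ, hφ, hs⟩ => ⟨φ, .inl hφ, hs⟩) (fun n B C hBC h => h.succ_of_conceptEdge hBC)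
    L hL h hBC
  exact ⟨φ, hφ.mono (by lia), hs⟩

/-- The number of rounds after which the chase is complete on the elements of depth `< d`: along
concept and role inclusions a concept or role is reached in `2 * T.card` rounds, and one more round
creates the next Skolem term. -/
def roundsToDepth (T : TBox) (d : ℕ) : ℕ := d * (2 * T.card + 1)

theorem roundsToDepth_mono {d e : ℕ} (h : d ≤ e) : roundsToDepth T d ≤ roundsToDepth T e :=
  Nat.mul_le_mul_right _ h

theorem roundsToDepth_succ (d : ℕ) :
    roundsToDepth T (d + 1) = roundsToDepth T d + 2 * T.card + 1 := by
  simp only [roundsToDepth]; ring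

theorem ShownWithin.create_child {B : Concept} {R : Role} {x : Elem}
    (h : ShownWithin T S (roundsToDepth T x.2.length + 2 * T.card) B x)
    (hi : .conceptIncl B (.ex R) ∈ T) :
    DerivesWithin T S (roundsToDepth T (child x R).2.length) (R.fact x (child x R)) := by
  obtain ⟨φ, hφ, hs⟩ := h
  rw [child, List.length_cons, roundsToDepth_succ]
  exact .inr ⟨φ, hφ, .concept hi hs⟩

theorem Derives.exists_shownWithin {φ : Fact} (h : Derives T S φ) {B : Concept} {x : Elem}
    (hs : φ.Shows B x) :
    ∃ B₀, ShownWithin T S (roundsToDepth T x.2.length) B₀ x ∧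
      Relation.ReflTransGen (ConceptEdge T) B₀ B := by
  induction h generalizing B x with
  | base h => exact ⟨B, ⟨_, DerivesWithin.mono (Nat.zero_le _) h, hs⟩, .refl⟩
  | step _ hstep ih =>
    cases hstep with
    | concept hi hs₁ =>
      obtain ⟨B₀, hB₀, hpath⟩ := ih hs₁
      rcases Concept.shows_fact_iff.1 hs with ⟨rfl, rfl⟩ | ⟨R, rfl, rfl, rfl⟩
      · exact ⟨B₀, hB₀, hpath.tail (.inl hi)⟩
      · exact ⟨.ex R.flip, ⟨_, (hB₀.of_reach_concept hpath).create_child hi, _,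
          (R.fact_flip _ _).symm⟩, .refl⟩
    | @role R₁ R₂ y z hi =>
      rcases Role.shows_fact_iff.1 hs with ⟨rfl, rfl⟩ | ⟨rfl, rfl⟩
      · obtain ⟨B₀, hB₀, hpath⟩ := ih (B := .ex R₁) ⟨_, rfl⟩
        exact ⟨B₀, hB₀, hpath.tail (.inr ⟨_, _, rfl, rfl, .inl hi⟩)⟩
      · obtain ⟨B₀, hB₀, hpath⟩ := ih (B := .ex R₁.flip) ⟨_, (R₁.fact_flip _ _).symm⟩
        exact ⟨B₀, hB₀, hpath.tail (.inr ⟨_, _, rfl, rfl, RoleEdge.flip (.inl hi)⟩)⟩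

theorem Derives.exists_role_derivesWithin {φ : Fact} (h : Derives T S φ) {R : Role} {x y : Elem}
    (hφ : φ = R.fact x y) :
    ∃ R₀, DerivesWithin T S (roundsToDepth T (max x.2.length y.2.length)) (R₀.fact x y) ∧
      Relation.ReflTransGen (RoleEdge T) R₀ R := by
  induction h generalizing R x y with
  | base h => exact ⟨R, DerivesWithin.mono (Nat.zero_le _) (hφ ▸ h), .refl⟩
  | step hd hstep ih =>
    cases hstep with
    | concept hi hs₁ =>
      obtain ⟨B₀, hB₀, hpath⟩ := hd.exists_shownWithin hs₁
      obtain ⟨Q, rfl, hQ⟩ := Concept.fact_eq_fact hφ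
      have hchild := (hB₀.of_reach_concept hpath).create_child hi
      refine ⟨R, ?_, .refl⟩
      rw [← hφ]
      refine DerivesWithin.mono (roundsToDepth_mono ?_) hchild
      rcases hQ with ⟨rfl, rfl, rfl⟩ | ⟨rfl, rfl, rfl⟩
      · exact le_max_right ..
      · exact le_max_left ..
    | @role R₁ R₂ z w hi =>
      rcases Role.fact_eq_fact_iff.1 hφ with ⟨rfl, rfl, rfl⟩ | ⟨rfl, rfl, rfl⟩
      · obtain ⟨R₀, hR₀, hpath⟩ := ih (R := R₁) rfl
        exact ⟨R₀, hR₀, hpath.tail (.inl hi)⟩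
      · obtain ⟨R₀, hR₀, hpath⟩ := ih (R := R₁.flip) (R₁.fact_flip _ _).symm
        exact ⟨R₀, hR₀, hpath.tail (RoleEdge.flip (.inl hi))⟩

theorem Derives.derivesWithin_roundsToDepth {φ : Fact} (h : Derives T S φ) {d : ℕ}
    (hd : ∀ x ∈ φ.elems, x.2.length ≤ d) : DerivesWithin T S (roundsToDepth T (d + 1)) φ := by
  rw [roundsToDepth_succ]
  cases φ with
  | concept A x =>
    have hx : x.2.length ≤ d := hd x (by simp [Fact.elems])
    obtain ⟨B₀, hB₀, hpath⟩ := h.exists_shownWithin (B := .atomic A) (x := x) rfl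
    obtain ⟨φ, hφ, rfl⟩ := hB₀.of_reach_concept hpath
    exact hφ.mono (by have := roundsToDepth_mono (T := T) hx; lia)
  | role P x y =>
    have hxy : max x.2.length y.2.length ≤ d :=
      max_le (hd x (by simp [Fact.elems])) (hd y (by simp [Fact.elems]))
    obtain ⟨R₀, hR₀, hpath⟩ := h.exists_role_derivesWithin (R := .atomic P) rfl
    exact (hR₀.of_reach_role hpath).mono (by have := roundsToDepth_mono (T := T) hxy; lia)

end Rounds

/-! ### Matches of queries in the chase -/

/-- The facts in `S` mention only individuals. -/
def Grounded (S : Set Fact) : Prop := ∀ φ ∈ S, ∀ x ∈ φ.elems, x.2 = []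

/-- The element `x` is obtained from `e` by Skolem functions. -/
def Below (x e : Elem) : Prop := x.1 = e.1 ∧ e.2 <:+ x.2

open Classical in
/-- Moves the elements below `e` to the corresponding places below `e'`. -/
noncomputable def graft (e e' x : Elem) : Elem :=
  if Below x e then (e'.1, x.2.take (x.2.length - e.2.length) ++ e'.2) else x

theorem Below.refl (e : Elem) : Below e e := ⟨rfl, List.suffix_refl _⟩

theorem Below.trans {x y z : Elem} (hxy : Below x y) (hyz : Below y z) : Below x z :=
  ⟨hxy.1.trans hyz.1, hyz.2.trans hxy.2⟩

theorem below_child (e : Elem) (R : Role) : Below (child e R) e := ⟨rfl, List.suffix_cons ..⟩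

theorem below_child_iff {x e : Elem} {R : Role} :
    Below (child x R) e ↔ child x R = e ∨ Below x e := by
  obtain ⟨a, w⟩ := x
  obtain ⟨b, u⟩ := e
  simp only [Below, child, List.suffix_cons_iff, Prod.mk.injEq]
  grind

theorem Below.not_grounded {x e : Elem} (h : Below x e) (he : e.2 ≠ []) : x.2 ≠ [] := fun hx =>
  he (List.suffix_nil.1 (hx ▸ h.2))

theorem graft_of_below (e' : Elem) {x e : Elem} (h : Below x e) :
    ∃ s, x = (e.1, s ++ e.2) ∧ graft e e' x = (e'.1, s ++ e'.2) := by
  obtain ⟨a, w⟩ := x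
  obtain ⟨h₁, s, h₂⟩ := id h
  dsimp only at h₁ h₂
  subst h₁ h₂
  exact ⟨s, rfl, by simp [graft, h]⟩

theorem graft_of_not_below (e' : Elem) {x e : Elem} (h : ¬ Below x e) : graft e e' x = x :=
  if_neg h

theorem graft_self (e e' : Elem) : graft e e' e = e' := by simp [graft, Below.refl]

theorem graft_child {x e : Elem} (e' : Elem) (R : Role) (h : Below x e) :
    graft e e' (child x R) = child (graft e e' x) R := by
  obtain ⟨s, rfl, hx⟩ := graft_of_below e' h
  obtain ⟨s', hs', hc⟩ := graft_of_below e' (below_child_iff.2 (.inr h) : Below (child _ R) e)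
  obtain rfl : R :: s = s' := List.append_cancel_right (bs := e.2) (by simpa [child] using hs')
  rw [hx, hc]
  rfl

theorem graft_child_child {x c : Elem} (c' : Elem) {R : Role} (h : Below x (child c R)) :
    graft (child c R) (child c' R) x = graft c c' x := by
  obtain ⟨s, rfl, hs⟩ := graft_of_below (child c' R) h
  obtain ⟨s', hs', hx⟩ := graft_of_below c' (h.trans (below_child c R))
  obtain rfl : s ++ [R] = s' := List.append_cancel_right (bs := c.2) (by simpa [child] using hs')
  rw [hs, hx]
  simp [child]

theorem length_graft_lt {x e e' : Elem} (he : e'.2.length < e.2.length) (h : Below x e) :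
    (graft e e' x).2.length < x.2.length := by
  obtain ⟨s, rfl, hx⟩ := graft_of_below e' h
  rw [hx]
  simpa using he

theorem length_graft_le {e e' : Elem} (he : e'.2.length < e.2.length) (x : Elem) :
    (graft e e' x).2.length ≤ x.2.length := by
  by_cases h : Below x e
  · exact (length_graft_lt he h).le
  · rw [graft_of_not_below e' h]

section Chase

variable {T : TBox} {S : Set Fact}

theorem Derives.of_below_child (hS : Grounded S) {φ : Fact} (h : Derives T S φ) {x e : Elem}
    {R : Role} (hx : x ∈ φ.elems) (hxe : Below x (child e R)) :
    Derives T S (R.fact e (child e R)) ∧ ∃ B, .conceptIncl B (.ex R) ∈ T := by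
  induction h generalizing x with
  | base h => exact absurd (hS _ h _ hx) (hxe.not_grounded (by simp [child]))
  | step hd hstep ih =>
    cases hstep with
    | concept hi hs =>
      rcases Concept.mem_elems_fact hx with rfl | ⟨Q, rfl, rfl⟩
      · exact ih hs.mem_elems hxe
      · rcases below_child_iff.1 hxe with h | h
        · obtain ⟨rfl, rfl⟩ : _ = e ∧ Q = R := by
            simp only [child, Prod.mk.injEq, List.cons.injEq] at h
            exact ⟨Prod.ext h.1 h.2.2, h.2.1⟩
          exact ⟨.step hd (.concept hi hs), _, hi⟩
        · exact ih hs.mem_elems h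
    | role hi => exact ih (by simpa using hx) hxe

theorem Derives.parent_or_child (hS : Grounded S) {φ : Fact} (h : Derives T S φ) {R : Role}
    {x y : Elem} (hφ : φ = R.fact x y) :
    (x.2 = [] ∧ y.2 = []) ∨ (∃ Q, y = child x Q) ∨ ∃ Q, x = child y Q := by
  induction h generalizing R x y with
  | base h =>
    subst hφ
    exact .inl ⟨hS _ h _ (by simp), hS _ h _ (by simp)⟩
  | step hd hstep ih =>
    cases hstep with
    | concept hi hs =>
      obtain ⟨Q, rfl, ⟨rfl, rfl, rfl⟩ | ⟨rfl, rfl, rfl⟩⟩ := Concept.fact_eq_fact hφ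
      · exact .inr (.inl ⟨_, rfl⟩)
      · exact .inr (.inr ⟨_, rfl⟩)
    | @role R₁ R₂ z w hi =>
      rcases Role.fact_eq_fact_iff.1 hφ with ⟨rfl, rfl, rfl⟩ | ⟨rfl, rfl, rfl⟩
      · exact ih (R := R₁) rfl
      · exact ih (R := R₁.flip) (R₁.fact_flip _ _).symm

theorem Derives.below_iff_below (hS : Grounded S) {R : Role} {x y e : Elem}
    (h : Derives T S (R.fact x y)) (he : e.2 ≠ []) (hx : x ≠ e) (hy : y ≠ e) :
    Below x e ↔ Below y e := by
  rcases h.parent_or_child hS rfl with ⟨hx₀, hy₀⟩ | ⟨Q, rfl⟩ | ⟨Q, rfl⟩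
  · exact iff_of_false (fun h => h.not_grounded he hx₀) fun h => h.not_grounded he hy₀
  · rw [below_child_iff, or_iff_right hy]
  · rw [below_child_iff, or_iff_right hx]

/-- What holds below an element depends only on the last role of its word. -/
theorem Derives.map_graft (hS : Grounded S) {φ : Fact} (h : Derives T S φ) {c c' : Elem} {R : Role}
    (hc' : Derives T S (R.fact c' (child c' R))) {x : Elem} (hx : x ∈ φ.elems)
    (hxc : Below x (child c R)) : Derives T S (φ.map (graft c c')) := by
  induction h generalizing x with
  | base h => exact absurd (hS _ h _ hx) (hxc.not_grounded (by simp [child]))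
  | step hd hstep ih =>
    cases hstep with
    | @concept B₁ B₂ φ y hi hs =>
      by_cases hyc : Below y (child c R)
      · have hmap : (B₂.fact y).map (graft c c') = B₂.fact (graft c c' y) := by
          cases B₂ with
          | atomic A => rfl
          | ex Q =>
            rw [Concept.fact, Concept.fact, Role.map_fact,
              graft_child c' Q (hyc.trans (below_child c R))]
        rw [hmap]
        exact (ih hs.mem_elems hyc).step (.concept hi (hs.map _))
      · obtain ⟨Q, rfl, rfl⟩ := (Concept.mem_elems_fact hx).resolve_left fun h => hyc (h ▸ hxc)
        have hchild : child y Q = child c R := (below_child_iff.1 hxc).resolve_right hyc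
        obtain ⟨rfl, rfl⟩ : y = c ∧ Q = R := by
          simp only [child, Prod.mk.injEq, List.cons.injEq] at hchild
          exact ⟨Prod.ext hchild.1 hchild.2.2, hchild.2.1⟩
        rw [Concept.fact, Role.map_fact, graft_child c' _ (Below.refl y), graft_self]
        exact hc'
    | role hi =>
      have hmap := ih (by simpa using hx) hxc
      rw [Role.map_fact] at hmap ⊢
      exact hmap.step (.role hi)

/-- A fact that does not mention `child c R` lies on one side of that element, because role facts
connect only parents and children. -/
theorem Derives.map_graft_child (hS : Grounded S) {φ : Fact} (h : Derives T S φ) {c c' : Elem}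
    {R : Role} (hc' : Derives T S (R.fact c' (child c' R))) (hφ : child c R ∉ φ.elems) :
    Derives T S (φ.map (graft (child c R) (child c' R))) := by
  have hsame : ∀ x ∈ φ.elems, ∀ y ∈ φ.elems, Below x (child c R) → Below y (child c R) := by
    cases φ with
    | concept A z => simp [Fact.elems]
    | role P z w =>
      have hzw := Derives.below_iff_below hS (R := .atomic P) h (e := child c R) (by simp [child])
        (fun hz => hφ (by simp [Fact.elems, hz])) (fun hw => hφ (by simp [Fact.elems, hw]))
      simp [Fact.elems, hzw]
  by_cases hbelow : ∃ x ∈ φ.elems, Below x (child c R)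
  · obtain ⟨x, hx, hxc⟩ := hbelow
    rw [Fact.map_congr fun y hy => graft_child_child c' (hsame x hx y hy hxc)]
    exact h.map_graft hS hc' hx hxc
  · push Not at hbelow
    rwa [Fact.map_id_of_forall fun x hx => graft_of_not_below _ (hbelow x hx)]

end Chase

theorem exists_suffixes_with_same_head {α : Type*} (w : List α) (V : Finset (List α))
    (H : Finset α) (hH : ∀ x ∈ w, x ∈ H) (hcard : V.card + H.card < w.length) :
    ∃ x u v, x :: u <:+ w ∧ x :: v <:+ w ∧ v.length < u.length ∧ x :: u ∉ V := by
  classical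
  let good : Finset (Fin w.length) := {i | w.drop i ∉ V}
  have hbad : ({i | w.drop i ∈ V} : Finset (Fin w.length)).card ≤ V.card := by
    refine Finset.card_le_card_of_injOn (fun i => w.drop i) (fun i hi => by simpa using hi) ?_
    intro i _ j _ hij
    have := congrArg List.length hij
    simp only [List.length_drop] at this
    lia
  have hgood : H.card < good.card := by
    have hsum := Finset.card_filter_add_card_filter_not (s := (Finset.univ : Finset (Fin w.length)))
      (fun i => w.drop i ∈ V)
    rw [Finset.card_univ, Fintype.card_fin] at hsum
    lia
  obtain ⟨i, hi, j, hj, hij, hget⟩ := Finset.exists_ne_map_eq_of_card_lt_of_maps_to hgood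
    (f := fun i => w[i]) fun i _ => hH _ (List.getElem_mem i.2)
  have hdrop (i : Fin w.length) : w[i] :: w.drop (i + 1) = w.drop i :=
    (List.drop_eq_getElem_cons i.2).symm
  wlog hlt : i < j generalizing i j
  · exact this j hj i hi hij.symm hget.symm (lt_of_le_of_ne (not_lt.1 hlt) hij.symm)
  · refine ⟨w[i], w.drop (i + 1), w.drop (j + 1), ?_, ?_, ?_, ?_⟩
    · exact hdrop i ▸ w.drop_suffix i
    · exact hget ▸ hdrop j ▸ w.drop_suffix j
    · simp only [List.length_drop]; lia
    · rw [hdrop i]; simpa [good] using hi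

/-- The value of a term in the chase. -/
def Term.elem (v : Name → Elem) : Term → Elem
  | .var x => v x
  | .const c => (c, [])

/-- The instance of a query atom in the chase. -/
def QueryAtom.fact (v : Name → Elem) : QueryAtom → Fact
  | .concept A t => .concept A (t.elem v)
  | .role P t u => .role P (t.elem v) (u.elem v)

/-- The terms that occur in a query atom. -/
def QueryAtom.terms : QueryAtom → List Term
  | .concept _ t => [t]
  | .role _ t u => [t, u]

theorem QueryAtom.elems_fact (v : Name → Elem) (α : QueryAtom) :
    (α.fact v).elems = α.terms.map (Term.elem v) := by
  cases α <;> rfl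

theorem QueryAtom.map_fact {v v' : Name → Elem} {τ : Elem → Elem}
    (h : ∀ t : Term, t.elem v' = τ (t.elem v)) (α : QueryAtom) :
    (α.fact v).map τ = α.fact v' := by
  cases α <;> simp [QueryAtom.fact, Fact.map, h]

theorem Term.elem_graft (v : Name → Elem) (c : Elem) (R : Role) (e' : Elem) (t : Term) :
    t.elem (fun x => graft (child c R) e' (v x)) = graft (child c R) e' (t.elem v) := by
  cases t with
  | var x => rfl
  | const b =>
    exact (graft_of_not_below e' fun h => h.not_grounded (by simp [child]) rfl).symm

/-- The terms in a query, with repetitions. -/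
def queryTerms (q : List QueryAtom) : List Term := q.flatMap QueryAtom.terms

theorem length_queryTerms_le (q : List QueryAtom) : (queryTerms q).length ≤ 2 * q.length := by
  rw [queryTerms, List.length_flatMap, mul_comm, ← smul_eq_mul, ← List.length_map (as := q)]
  refine List.sum_le_card_nsmul _ _ fun k hk => ?_
  obtain ⟨α, -, rfl⟩ := List.mem_map.1 hk
  cases α <;> simp [QueryAtom.terms]

section Matches

variable {T : TBox} {S : Set Fact} {q : List QueryAtom}

theorem Derives.exists_roles_of_match (hS : Grounded S) {v : Name → Elem}
    (hv : ∀ α ∈ q, Derives T S (α.fact v)) {t : Term} (ht : t ∈ queryTerms q) {c : Elem} {R : Role}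
    (htc : Below (t.elem v) (child c R)) :
    Derives T S (R.fact c (child c R)) ∧ ∃ B, .conceptIncl B (.ex R) ∈ T := by
  obtain ⟨α, hα, htα⟩ := List.mem_flatMap.1 ht
  refine (hv α hα).of_below_child hS ?_ htc
  rw [QueryAtom.elems_fact]
  exact List.mem_map_of_mem htα

theorem exists_finset_existential_roles (T : TBox) :
    ∃ H : Finset Role, H.card ≤ T.card ∧ ∀ B R, .conceptIncl B (.ex R) ∈ T → R ∈ H := by
  classical
  let existential : Inclusion → Finset Role
    | .conceptIncl _ (.ex R) => {R}
    | _ => ∅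
  refine ⟨T.biUnion existential, ?_, fun B R h => Finset.mem_biUnion.2 ⟨_, h, ?_⟩⟩
  · refine (Finset.card_biUnion_le_card_mul _ _ 1 fun i _ => ?_).trans (mul_one _).le
    rcases i with ⟨_, _ | _⟩ | _ | _ | _ <;> simp [existential]
  · simp [existential]

/-- Two ancestors of the deep element have the same last role, and the lower one is not itself a
value of a term; grafting its subtree onto the upper one makes the match shallower. -/
theorem exists_shallower_match (hS : Grounded S) {v : Name → Elem}
    (hv : ∀ α ∈ q, Derives T S (α.fact v)) {t₀ : Term} (ht₀ : t₀ ∈ queryTerms q)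
    (hdeep : (queryTerms q).length + T.card < (t₀.elem v).2.length) :
    ∃ v' : Name → Elem, (∀ α ∈ q, Derives T S (α.fact v')) ∧
      ((queryTerms q).map fun t => (t.elem v').2.length).sum <
        ((queryTerms q).map fun t => (t.elem v).2.length).sum := by
  classical
  obtain ⟨H, hcard, hH⟩ := exists_finset_existential_roles T
  obtain ⟨⟨a, w⟩, hx₀⟩ : ∃ x, t₀.elem v = x := ⟨_, rfl⟩
  have hroles : ∀ {R u}, R :: u <:+ w →
      Derives T S (R.fact (a, u) (child (a, u) R)) ∧ ∃ B, .conceptIncl B (.ex R) ∈ T :=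
    fun h => Derives.exists_roles_of_match hS hv ht₀ ⟨by rw [hx₀, child], by rwa [hx₀]⟩
  have hw : ∀ R ∈ w, R ∈ H := fun R hR => by
    obtain ⟨s, u, rfl⟩ := List.append_of_mem hR
    obtain ⟨B, hB⟩ := (hroles (List.suffix_append s (R :: u))).2
    exact hH B R hB
  obtain ⟨R, u, u', hu, hu', hlt, hV⟩ := exists_suffixes_with_same_head w
    ((queryTerms q).map fun t => (t.elem v).2).toFinset H hw (by
      have := List.toFinset_card_le ((queryTerms q).map fun t => (t.elem v).2)
      rw [hx₀] at hdeep
      simp only [List.length_map] at this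
      lia)
  have hlt' : (child (a, u') R).2.length < (child (a, u) R).2.length := by simpa [child] using hlt
  have helem := Term.elem_graft v (a, u) R (child (a, u') R)
  refine ⟨fun x => graft (child (a, u) R) (child (a, u') R) (v x), fun α hα => ?_, ?_⟩
  · rw [← QueryAtom.map_fact helem]
    refine (hv α hα).map_graft_child hS (hroles hu').1 fun hmem => hV ?_
    rw [QueryAtom.elems_fact] at hmem
    obtain ⟨t, ht, htv⟩ := List.mem_map.1 hmem
    have htq : t ∈ queryTerms q := List.mem_flatMap.2 ⟨α, hα, ht⟩
    exact List.mem_toFinset.2 (List.mem_map.2 ⟨t, htq, by rw [htv, child]⟩)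
  · refine List.sum_lt_sum _ _ (fun t _ => ?_) ⟨t₀, ht₀, ?_⟩
    · rw [helem]
      exact length_graft_le hlt' _
    · rw [helem]
      exact length_graft_lt hlt' ⟨by rw [hx₀, child], by rwa [hx₀]⟩

theorem exists_shallow_match (hS : Grounded S) {v : Name → Elem}
    (hv : ∀ α ∈ q, Derives T S (α.fact v)) :
    ∃ v' : Name → Elem, (∀ α ∈ q, Derives T S (α.fact v')) ∧
      ∀ t ∈ queryTerms q, (t.elem v').2.length ≤ (queryTerms q).length + T.card := by
  induction hn : ((queryTerms q).map fun t => (t.elem v).2.length).sum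
    using Nat.strong_induction_on generalizing v with
  | _ n ih =>
    by_cases hdeep : ∃ t ∈ queryTerms q, (queryTerms q).length + T.card < (t.elem v).2.length
    · obtain ⟨t, ht, hlt⟩ := hdeep
      obtain ⟨v', hv', hsum⟩ := exists_shallower_match hS hv ht hlt
      exact ih _ (hn ▸ hsum) hv' rfl
    · push Not at hdeep
      exact ⟨v, hv, hdeep⟩

/-- The number of rounds after which the chase has a match of every query with `n` atoms that
matches at all. -/
def matchRounds (T : TBox) (n : ℕ) : ℕ := roundsToDepth T (2 * n + T.card + 1)

/-- The query has a match in the first rounds of the chase. -/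
def Matches (T : TBox) (S : Set Fact) (q : List QueryAtom) : Prop :=
  ∃ v : Name → Elem, ∀ α ∈ q, DerivesWithin T S (matchRounds T q.length) (α.fact v)

theorem matches_iff_exists_derives (hS : Grounded S) :
    Matches T S q ↔ ∃ v : Name → Elem, ∀ α ∈ q, Derives T S (α.fact v) := by
  refine ⟨fun ⟨v, hv⟩ => ⟨v, fun α hα => (hv α hα).derives⟩, fun ⟨v, hv⟩ => ?_⟩
  obtain ⟨v', hv', hdepth⟩ := exists_shallow_match hS hv
  refine ⟨v', fun α hα => (hv' α hα).derivesWithin_roundsToDepth fun x hx => ?_⟩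
  rw [QueryAtom.elems_fact] at hx
  obtain ⟨t, ht, rfl⟩ := List.mem_map.1 hx
  exact (hdepth t (List.mem_flatMap.2 ⟨α, hα, ht⟩)).trans
    (Nat.add_le_add_right (length_queryTerms_le q) _)

end Matches

/-! ### Consistency and entailment by the chase -/

/-- The ground atom as a fact of the chase. -/
def GroundAtom.fact : GroundAtom → Fact
  | .concept A a => .concept A (a, [])
  | .role P a b => .role P (a, []) (b, [])

theorem GroundAtom.snd_eq_nil {α : GroundAtom} {x : Elem} (h : x ∈ α.fact.elems) : x.2 = [] := by
  cases α <;> simp only [GroundAtom.fact, Fact.elems, List.mem_cons, List.not_mem_nil] at h <;>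
    grind

theorem grounded_image_fact (S : Set GroundAtom) : Grounded (GroundAtom.fact '' S) := by
  rintro _ ⟨α, -, rfl⟩ x hx
  exact α.snd_eq_nil hx

/-- The query atom stating that the two terms are in the basic role. -/
def Role.atom : Role → Term → Term → QueryAtom
  | .atomic P, t, u => .role P t u
  | .inv P, t, u => .role P u t

/-- The query atom stating that `t` is in the basic concept; `u` is the witness of an existential
restriction. -/
def Concept.atom : Concept → Term → Term → QueryAtom
  | .atomic A, t, _ => .concept A t
  | .ex R, t, u => R.atom t u

/-- The queries that a negative inclusion forbids. The words `[]`, `[false]` and `[true]` serve as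
variable names. -/
def Inclusion.negQueries : Inclusion → List (List QueryAtom)
  | .conceptDisj B C => [[B.atom (.var []) (.var [false]), C.atom (.var []) (.var [true])]]
  | .roleDisj R Q => [[R.atom (.var []) (.var [false]), Q.atom (.var []) (.var [false])]]
  | _ => []

/-- The queries that are forbidden by the negative inclusions of `T` and the denials of `P`. -/
def forbiddenQueries (T : TBox) (P : Policy) : Set (List QueryAtom) :=
  {q | (∃ i ∈ T, q ∈ i.negQueries) ∨ ∃ δ ∈ P, q = δ.body.atoms}

namespace Interp

variable (I : Interp)

/-- The conjunctive query has a match in the interpretation. -/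
def HasMatch (q : List QueryAtom) : Prop := ∃ v : Name → I.Dom, ∀ α ∈ q, I.SatAtom v α

theorem satAtom_role (v : Name → I.Dom) (R : Role) (t u : Term) :
    I.SatAtom v (R.atom t u) ↔ I.evalRole R (I.termVal v t) (I.termVal v u) := by
  cases R <;> rfl

theorem exists_satAtom_of_evalConcept (B : Concept) {x : I.Dom} (y : Name)
    (h : I.evalConcept B x) : ∃ d, ∀ v : Name → I.Dom, v [] = x → v y = d →
      I.SatAtom v (B.atom (.var []) (.var y)) := by
  cases B with
  | atomic A => exact ⟨x, fun v hx _ => (congrArg (I.concept A) hx).mpr h⟩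
  | ex R =>
    obtain ⟨d, hd⟩ := h
    refine ⟨d, ?_⟩
    rintro v rfl rfl
    exact (I.satAtom_role v R _ _).2 hd

theorem evalConcept_of_satAtom (B : Concept) (v : Name → I.Dom) (u : Term)
    (h : I.SatAtom v (B.atom (.var []) u)) : I.evalConcept B (v []) := by
  cases B with
  | atomic A => exact h
  | ex R => exact ⟨_, (I.satAtom_role v R _ _).1 h⟩

theorem satInclusion_conceptDisj_iff (B C : Concept) :
    I.SatInclusion (.conceptDisj B C) ↔
      ¬ I.HasMatch [B.atom (.var []) (.var [false]), C.atom (.var []) (.var [true])] := by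
  simp only [HasMatch, List.forall_mem_cons, SatInclusion]
  constructor
  · rintro h ⟨v, hB, hC, -⟩
    exact h (v []) (I.evalConcept_of_satAtom B v _ hB) (I.evalConcept_of_satAtom C v _ hC)
  · intro h x hB hC
    obtain ⟨d, hd⟩ := I.exists_satAtom_of_evalConcept B [false] hB
    obtain ⟨e, he⟩ := I.exists_satAtom_of_evalConcept C [true] hC
    let v : Name → I.Dom := fun z => if z = [] then x else if z = [false] then d else e
    exact h ⟨v, hd v (by simp [v]) (by simp [v]), he v (by simp [v]) (by simp [v]), by simp⟩

theorem satInclusion_roleDisj_iff (R Q : Role) :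
    I.SatInclusion (.roleDisj R Q) ↔
      ¬ I.HasMatch [R.atom (.var []) (.var [false]), Q.atom (.var []) (.var [false])] := by
  simp only [HasMatch, List.forall_mem_cons, SatInclusion, satAtom_role, termVal]
  constructor
  · rintro h ⟨v, hR, hQ, -⟩
    exact h _ _ hR hQ
  · intro h x y hR hQ
    exact h ⟨fun z => if z = [] then x else y, by simpa using hR, by simpa using hQ, by simp⟩

theorem not_hasMatch_of_satInclusion {i : Inclusion} (hi : I.SatInclusion i) {q : List QueryAtom}
    (hq : q ∈ i.negQueries) : ¬ I.HasMatch q := by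
  cases i with
  | conceptIncl | roleIncl => cases hq
  | conceptDisj B C =>
    rw [List.mem_singleton.1 hq]
    exact (I.satInclusion_conceptDisj_iff B C).1 hi
  | roleDisj R Q =>
    rw [List.mem_singleton.1 hq]
    exact (I.satInclusion_roleDisj_iff R Q).1 hi

open Classical in
/-- The value of a Skolem term in an interpretation. -/
noncomputable def skolem : Elem → I.Dom
  | (a, []) => I.const a
  | (a, R :: w) => if h : ∃ y, I.evalRole R (skolem (a, w)) y then h.choose else I.const a
termination_by x => x.2

theorem skolem_nil (a : Name) : I.skolem (a, []) = I.const a := by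
  rw [skolem]

theorem evalRole_skolem_child {R : Role} {x : Elem} (h : I.evalConcept (.ex R) (I.skolem x)) :
    I.evalRole R (I.skolem x) (I.skolem (child x R)) := by
  obtain ⟨a, w⟩ := x
  have hex : ∃ y, I.evalRole R (I.skolem (a, w)) y := h
  simp only [child, skolem, dif_pos hex]
  exact hex.choose_spec

/-- The fact is true in the interpretation. -/
def SatFact : Fact → Prop
  | .concept A x => I.concept A (I.skolem x)
  | .role P x y => I.role P (I.skolem x) (I.skolem y)

theorem satFact_role (R : Role) (x y : Elem) :
    I.SatFact (R.fact x y) ↔ I.evalRole R (I.skolem x) (I.skolem y) := by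
  cases R <;> rfl

theorem satFact_ground (α : GroundAtom) : I.SatFact α.fact ↔ I.SatGround α := by
  cases α <;> simp only [GroundAtom.fact, SatFact, SatGround, skolem_nil]

theorem evalConcept_of_satFact {φ : Fact} {B : Concept} {x : Elem} (hφ : I.SatFact φ)
    (hs : φ.Shows B x) : I.evalConcept B (I.skolem x) := by
  cases B with
  | atomic A =>
    cases hs
    exact hφ
  | ex R =>
    obtain ⟨y, rfl⟩ := hs
    exact ⟨_, (I.satFact_role R x y).1 hφ⟩

theorem satFact_of_evalConcept {B : Concept} {x : Elem} (h : I.evalConcept B (I.skolem x)) :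
    I.SatFact (B.fact x) := by
  cases B with
  | atomic A => exact h
  | ex R => exact (I.satFact_role R _ _).2 (I.evalRole_skolem_child h)

variable {T : TBox} {S : Set GroundAtom}

theorem satFact_of_derives (hT : ∀ i ∈ T, I.SatInclusion i) (hS : ∀ α ∈ S, I.SatGround α)
    {φ : Fact} (h : Derives T (GroundAtom.fact '' S) φ) : I.SatFact φ := by
  induction h with
  | base h =>
    obtain ⟨α, hα, rfl⟩ := h
    exact (I.satFact_ground α).2 (hS α hα)
  | step _ hstep ih =>
    cases hstep with
    | concept hi hs =>
      exact I.satFact_of_evalConcept (hT _ hi _ (I.evalConcept_of_satFact ih hs))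
    | @role R Q x y hi => exact (I.satFact_role Q x y).2 (hT _ hi _ _ ((I.satFact_role R x y).1 ih))

theorem satAtom_of_satFact (v : Name → Elem) (α : QueryAtom) (h : I.SatFact (α.fact v)) :
    I.SatAtom (fun x => I.skolem (v x)) α := by
  have hterm (t : Term) : I.termVal (fun x => I.skolem (v x)) t = I.skolem (t.elem v) := by
    cases t with
    | var x => rfl
    | const c => exact (I.skolem_nil c).symm
  cases α <;> simpa only [SatAtom, hterm, QueryAtom.fact, SatFact] using h

end Interp

/-- The canonical model, whose domain consists of the Skolem terms. -/
def canonical (T : TBox) (S : Set Fact) : Interp where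
  Dom := Elem
  concept A x := Derives T S (.concept A x)
  role P x y := Derives T S (.role P x y)
  const a := (a, [])

section Canonical

variable {T : TBox} {S : Set Fact}

theorem canonical_evalRole {R : Role} {x y : Elem} :
    (canonical T S).evalRole R x y ↔ Derives T S (R.fact x y) := by
  cases R <;> rfl

theorem canonical_evalConcept {B : Concept} {x : Elem} :
    (canonical T S).evalConcept B x ↔ ∃ φ, Derives T S φ ∧ φ.Shows B x := by
  cases B with
  | atomic A =>
    constructor
    · exact fun h => ⟨_, h, rfl⟩
    · rintro ⟨φ, h, rfl⟩
      exact h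
  | ex R =>
    constructor
    · rintro ⟨y, h⟩
      exact ⟨_, canonical_evalRole.1 h, y, rfl⟩
    · rintro ⟨φ, h, y, rfl⟩
      exact ⟨y, canonical_evalRole.2 h⟩

theorem canonical_satAtom {v : Name → Elem} {α : QueryAtom} :
    (canonical T S).SatAtom v α ↔ Derives T S (α.fact v) := by
  have hterm (t : Term) : (canonical T S).termVal v t = t.elem v := by cases t <;> rfl
  cases α <;> simp only [Interp.SatAtom, hterm] <;> rfl

theorem canonical_hasMatch (hS : Grounded S) {q : List QueryAtom} :
    (canonical T S).HasMatch q ↔ Matches T S q := by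
  rw [matches_iff_exists_derives hS]
  exact exists_congr fun v => forall₂_congr fun α _ => canonical_satAtom

theorem canonical_satInclusion {i : Inclusion} (hi : i ∈ T)
    (hneg : ∀ q ∈ i.negQueries, ¬ (canonical T S).HasMatch q) :
    (canonical T S).SatInclusion i := by
  cases i with
  | conceptIncl B C =>
    intro x hx
    obtain ⟨φ, hφ, hs⟩ := canonical_evalConcept.1 hx
    exact canonical_evalConcept.2 ⟨_, hφ.step (.concept hi hs), C.shows_fact x⟩
  | roleIncl R Q =>
    intro x y hxy
    exact canonical_evalRole.2 ((canonical_evalRole.1 hxy).step (.role hi))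
  | conceptDisj B C => exact (Interp.satInclusion_conceptDisj_iff _ B C).2 (hneg _ (.head _))
  | roleDisj R Q => exact (Interp.satInclusion_roleDisj_iff _ R Q).2 (hneg _ (.head _))

theorem canonical_satGround {α : GroundAtom} :
    (canonical T S).SatGround α ↔ Derives T S α.fact := by
  cases α <;> rfl

end Canonical

section Consistency

variable {T : TBox} {P : Policy} {S : Set GroundAtom}

theorem canonical_sat (h : ∀ q ∈ forbiddenQueries T P, ¬ Matches T (GroundAtom.fact '' S) q) :
    (∀ i ∈ T, (canonical T (GroundAtom.fact '' S)).SatInclusion i) ∧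
    (∀ δ ∈ P, (canonical T (GroundAtom.fact '' S)).SatDenial δ) ∧
    ∀ α ∈ S, (canonical T (GroundAtom.fact '' S)).SatGround α := by
  simp only [← canonical_hasMatch (grounded_image_fact S)] at h
  exact ⟨fun i hi => canonical_satInclusion hi fun q hq => h q (.inl ⟨i, hi, hq⟩),
    fun δ hδ => h _ (.inr ⟨δ, hδ, rfl⟩),
    fun α hα => canonical_satGround.2 (.base (Set.mem_image_of_mem _ hα))⟩

theorem consistent_iff :
    Consistent T P S ↔ ∀ q ∈ forbiddenQueries T P, ¬ Matches T (GroundAtom.fact '' S) q := by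
  refine ⟨fun ⟨I, hT, hP, hS⟩ q hq hmatch => ?_, fun h => ⟨_, canonical_sat h⟩⟩
  obtain ⟨v, hv⟩ := (matches_iff_exists_derives (grounded_image_fact S)).1 hmatch
  have hsat : I.HasMatch q :=
    ⟨_, fun α hα => I.satAtom_of_satFact v α (I.satFact_of_derives hT hS (hv α hα))⟩
  rcases hq with ⟨i, hi, hq⟩ | ⟨δ, hδ, rfl⟩
  · exact I.not_hasMatch_of_satInclusion (hT i hi) hq hsat
  · exact hP δ hδ hsat

theorem entails_iff_derives (hc : Consistent T ∅ S) (α : GroundAtom) :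
    Entails T S α ↔ Derives T (GroundAtom.fact '' S) α.fact := by
  obtain ⟨hT, -, hS⟩ := canonical_sat (consistent_iff.1 hc)
  exact ⟨fun h => canonical_satGround.1 (h _ hT hS),
    fun h I hIT hIS => (I.satFact_ground α).1 (I.satFact_of_derives hIT hIS h)⟩

theorem derives_ground_iff {α : GroundAtom} {F : Set Fact} :
    Derives T F α.fact ↔ DerivesWithin T F (roundsToDepth T 1) α.fact :=
  ⟨fun h => h.derivesWithin_roundsToDepth (d := 0) fun x hx => by simp [α.snd_eq_nil hx],
    DerivesWithin.derives⟩

/-- The predicate symbol of a fact. -/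
def Fact.pred : Fact → Pred
  | .concept A _ => .concept A
  | .role P _ _ => .role P

theorem GroundAtom.pred_fact (α : GroundAtom) : α.fact.pred = α.pred := by cases α <;> rfl

theorem Role.pred_fact (R : Role) (x y : Elem) : (R.fact x y).pred = R.pred := by cases R <;> rfl

theorem Concept.pred_fact (B : Concept) (x : Elem) : (B.fact x).pred = B.pred := by
  cases B with
  | atomic A => rfl
  | ex R => exact R.pred_fact _ _

theorem Derives.pred_mem {φ : Fact} {F : Set Fact} (h : Derives T F φ) :
    φ.pred ∈ TBox.sig T ∨ ∃ ψ ∈ F, φ.pred = ψ.pred := by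
  cases h with
  | base h => exact .inr ⟨φ, h, rfl⟩
  | step _ hstep =>
    cases hstep with
    | @concept B C ψ x hi _ => exact .inl ⟨_, hi, .inr (C.pred_fact x)⟩
    | @role R Q x y hi => exact .inl ⟨_, hi, .inr (Q.pred_fact x y)⟩

theorem mem_closureGA_iff {A : ABoxFor T} {α : GroundAtom} :
    α ∈ closureGA T A ↔
      DerivesWithin T (GroundAtom.fact '' A.atoms) (roundsToDepth T 1) α.fact := by
  rw [← derives_ground_iff, ← entails_iff_derives A.consistent]
  refine and_iff_right_of_imp fun h => ?_
  rcases ((entails_iff_derives A.consistent α).1 h).pred_mem with hT | ⟨_, ⟨β, hβ, rfl⟩, hpred⟩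
  · exact .inl (α.pred_fact ▸ hT)
  · exact .inr ⟨β, hβ, by rw [← α.pred_fact, hpred, β.pred_fact]⟩

end Consistency

/-! ### Feasible functions on trees -/

/-- The number of inner nodes of a tree. -/
def Data.size : Data → ℕ
  | .nil => 0
  | .node l r => l.size + r.size + 1

/-- The elements of the list that a tree stands for. Every tree stands for a list. -/
def Data.toList : Data → List Data
  | .nil => []
  | .node a l => a :: l.toList

/-- The case distinction of `Prog.ite` as a function on trees. -/
def Data.ite : Data → Data → Data → Data
  | .nil, _, b => b
  | .node _ _, a, _ => a

@[simp] theorem Data.hd_node (a b : Data) : (Data.node a b).hd = a := rfl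
@[simp] theorem Data.tl_node (a b : Data) : (Data.node a b).tl = b := rfl
@[simp] theorem Data.ite_nil (a b : Data) : Data.ite .nil a b = b := rfl
@[simp] theorem Data.ite_node (c d a b : Data) : Data.ite (.node c d) a b = a := rfl
@[simp] theorem Data.size_nil : Data.nil.size = 0 := rfl
@[simp] theorem Data.size_node (a b : Data) : (Data.node a b).size = a.size + b.size + 1 := rfl
@[simp] theorem Data.toList_nil : Data.nil.toList = [] := rfl
@[simp] theorem Data.toList_node (a l : Data) : (Data.node a l).toList = a :: l.toList := rfl

theorem Data.size_hd_le (x : Data) : x.hd.size ≤ x.size := by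
  cases x with
  | nil => rfl
  | node a b => simp only [hd_node, size_node]; lia

theorem Data.size_tl_le (x : Data) : x.tl.size ≤ x.size := by
  cases x with
  | nil => rfl
  | node a b => simp only [tl_node, size_node]; lia

theorem Data.length_toList_le (x : Data) : x.toList.length ≤ x.size := by
  induction x with
  | nil => rfl
  | node a l _ ih => simp only [toList_node, List.length_cons, size_node]; lia

theorem Data.size_le_of_mem {x e : Data} (h : e ∈ x.toList) : e.size ≤ x.size := by
  induction x with
  | nil => simp at h
  | node a l _ ih =>
    simp only [toList_node, List.mem_cons, size_node] at h ⊢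
    rcases h with rfl | h
    · lia
    · have := ih h
      lia

/-- For every bound on the parameter `κ`, the function `g` is bounded by a polynomial in the size
of the tree, whose degree may depend on that bound. -/
def PolyBounded (κ : Data → ℕ) (g : Data → ℕ) : Prop :=
  ∀ K, ∃ k, ∀ x, κ x ≤ K → g x ≤ (x.size + 2) ^ k

namespace PolyBounded

variable {κ κ' : Data → ℕ} {f g : Data → ℕ}

theorem mono (hg : PolyBounded κ g) (h : ∀ x, f x ≤ g x) : PolyBounded κ f := fun K =>
  let ⟨k, hk⟩ := hg K
  ⟨k, fun x hx => (h x).trans (hk x hx)⟩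

theorem const (κ : Data → ℕ) (c : ℕ) : PolyBounded κ fun _ => c := fun _ =>
  ⟨c, fun _ _ => Nat.lt_two_pow_self.le.trans (Nat.pow_le_pow_left (Nat.le_add_left ..) _)⟩

theorem size (κ : Data → ℕ) : PolyBounded κ Data.size := fun _ => ⟨1, fun x _ => by simp⟩

theorem add (hf : PolyBounded κ f) (hg : PolyBounded κ g) :
    PolyBounded κ fun x => f x + g x := by
  intro K
  obtain ⟨a, ha⟩ := hf K
  obtain ⟨b, hb⟩ := hg K
  refine ⟨a + b + 1, fun x hx => ?_⟩
  have hfx : f x ≤ (x.size + 2) ^ (a + b) :=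
    (ha x hx).trans (Nat.pow_le_pow_right (by lia) (by lia))
  have hgx : g x ≤ (x.size + 2) ^ (a + b) :=
    (hb x hx).trans (Nat.pow_le_pow_right (by lia) (by lia))
  rw [pow_succ]
  nlinarith

theorem mul (hf : PolyBounded κ f) (hg : PolyBounded κ g) :
    PolyBounded κ fun x => f x * g x := by
  intro K
  obtain ⟨a, ha⟩ := hf K
  obtain ⟨b, hb⟩ := hg K
  refine ⟨a + b, fun x hx => ?_⟩
  rw [pow_add]
  exact Nat.mul_le_mul (ha x hx) (hb x hx)

theorem pow (hf : PolyBounded κ f) (d : ℕ) : PolyBounded κ fun x => f x ^ d := by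
  induction d with
  | zero => simpa using const κ 1
  | succ d ih => simpa only [pow_succ] using ih.mul hf

theorem size_pow (κ : Data → ℕ) (d : ℕ) : PolyBounded κ fun x => (x.size + 2) ^ d :=
  ((size κ).add (const _ 2)).pow d

theorem pow_add_two_pow_le (n a b : ℕ) : ((n + 2) ^ a + 2) ^ b ≤ (n + 2) ^ ((a + 2) * b) := by
  rw [pow_mul]
  refine Nat.pow_le_pow_left ?_ _
  have hpos : 1 ≤ (n + 2) ^ a := Nat.one_le_pow _ _ (by lia)
  calc (n + 2) ^ a + 2 ≤ (n + 2) ^ a * 4 := by lia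
    _ ≤ (n + 2) ^ a * (n + 2) ^ 2 :=
      Nat.mul_le_mul_left _ (Nat.pow_le_pow_left (by lia : 2 ≤ n + 2) 2)
    _ = (n + 2) ^ (a + 2) := (pow_add ..).symm

theorem comp {F : Data → Data} (hg : PolyBounded κ' g) (hF : PolyBounded κ fun x => (F x).size)
    (hκ : ∀ K, ∃ K', ∀ x, κ x ≤ K → κ' (F x) ≤ K') : PolyBounded κ fun x => g (F x) := by
  intro K
  obtain ⟨K', hK'⟩ := hκ K
  obtain ⟨a, ha⟩ := hF K
  obtain ⟨b, hb⟩ := hg K'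
  refine ⟨(a + 2) * b, fun x hx => ?_⟩
  calc g (F x) ≤ ((F x).size + 2) ^ b := hb _ (hK' x hx)
    _ ≤ ((x.size + 2) ^ a + 2) ^ b := Nat.pow_le_pow_left (Nat.add_le_add_right (ha x hx) 2) _
    _ ≤ (x.size + 2) ^ ((a + 2) * b) := pow_add_two_pow_le _ a b

end PolyBounded

/-- The function is computed by a program that runs in polynomial time, and has values of polynomial
size, for bounded values of the parameter `κ`. The bound on the size is not implied by the bound on
the time, since `Prog.cons` can double the size of a tree in one step. -/
def Feasible (κ : Data → ℕ) (f : Data → Data) : Prop :=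
  ∃ (p : Prog) (b : Data → ℕ), (∀ x, ∃ n ≤ b x, Run p x (f x) n) ∧ PolyBounded κ b ∧
    PolyBounded κ fun x => (f x).size

/-- Feasibility without a parameter. -/
abbrev PolyTime (f : Data → Data) : Prop := Feasible (fun _ => 0) f

namespace Feasible

variable {κ κ' : Data → ℕ} {f g h : Data → Data}

theorem id : Feasible κ fun x => x :=
  ⟨.arg, fun _ => 1, fun x => ⟨1, le_rfl, .arg x⟩, .const _ _, .size _⟩

theorem nil : Feasible κ fun _ => .nil :=
  ⟨.nil, fun _ => 1, fun x => ⟨1, le_rfl, .nil x⟩, .const _ _, .const _ _⟩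

theorem node (hf : Feasible κ f) (hg : Feasible κ g) : Feasible κ fun x => .node (f x) (g x) := by
  obtain ⟨p, b, hp, hb, hs⟩ := hf
  obtain ⟨q, c, hq, hc, ht⟩ := hg
  refine ⟨.cons p q, fun x => b x + c x + 1, fun x => ?_, (hb.add hc).add (.const _ _),
    (hs.add ht).add (.const _ _)⟩
  obtain ⟨m, hm, hpx⟩ := hp x
  obtain ⟨n, hn, hqx⟩ := hq x
  exact ⟨m + n + 1, by lia, .cons hpx hqx⟩

theorem hd (hf : Feasible κ f) : Feasible κ fun x => (f x).hd := by
  obtain ⟨p, b, hp, hb, hs⟩ := hf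
  refine ⟨.hd p, fun x => b x + 1, fun x => ?_, hb.add (.const _ _),
    hs.mono fun x => Data.size_hd_le _⟩
  obtain ⟨m, hm, hpx⟩ := hp x
  exact ⟨m + 1, by lia, .hd hpx⟩

theorem tl (hf : Feasible κ f) : Feasible κ fun x => (f x).tl := by
  obtain ⟨p, b, hp, hb, hs⟩ := hf
  refine ⟨.tl p, fun x => b x + 1, fun x => ?_, hb.add (.const _ _),
    hs.mono fun x => Data.size_tl_le _⟩
  obtain ⟨m, hm, hpx⟩ := hp x
  exact ⟨m + 1, by lia, .tl hpx⟩

theorem ite (hf : Feasible κ f) (hg : Feasible κ g) (hh : Feasible κ h) :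
    Feasible κ fun x => Data.ite (f x) (g x) (h x) := by
  obtain ⟨p, b, hp, hb, -⟩ := hf
  obtain ⟨q, c, hq, hc, ht⟩ := hg
  obtain ⟨r, d, hr, hd, hu⟩ := hh
  refine ⟨.ite p q r, fun x => b x + (c x + d x) + 1, fun x => ?_,
    (hb.add (hc.add hd)).add (.const _ _), (ht.add hu).mono fun x => ?_⟩ <;> beta_reduce
  · obtain ⟨m, hm, hpx⟩ := hp x
    cases hfx : f x with
    | nil =>
      obtain ⟨k, hk, hrx⟩ := hr x
      exact ⟨m + k + 1, by lia, .iteElse (hfx ▸ hpx) hrx⟩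
    | node u v =>
      obtain ⟨n, hn, hqx⟩ := hq x
      exact ⟨m + n + 1, by lia, .iteThen (hfx ▸ hpx) hqx⟩
  · cases f x <;> simp

theorem comp (hg : Feasible κ' g) (hf : Feasible κ f)
    (hκ : ∀ K, ∃ K', ∀ x, κ x ≤ K → κ' (f x) ≤ K') : Feasible κ fun x => g (f x) := by
  obtain ⟨p, b, hp, hb, hs⟩ := hf
  obtain ⟨q, c, hq, hc, ht⟩ := hg
  refine ⟨.call q p, fun x => b x + c (f x) + 1, fun x => ?_,
    (hb.add (hc.comp hs hκ)).add (.const _ _), ht.comp hs hκ⟩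
  obtain ⟨m, hm, hpx⟩ := hp x
  obtain ⟨n, hn, hqx⟩ := hq (f x)
  exact ⟨m + n + 1, by lia, .call hpx hqx⟩

theorem const (d : Data) : Feasible κ fun _ => d := by
  induction d with
  | nil => exact nil
  | node a b iha ihb => exact iha.node ihb

end Feasible

namespace PolyTime

variable {κ : Data → ℕ} {g h k : Data → Data}

theorem comp₁ {f : Data → Data} (hf : PolyTime f) (hg : Feasible κ g) :
    Feasible κ fun x => f (g x) :=
  Feasible.comp hf hg fun _ => ⟨0, fun _ _ => le_rfl⟩

theorem comp₂ {f : Data → Data → Data} (hf : PolyTime fun z => f z.hd z.tl) (hg : Feasible κ g)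
    (hh : Feasible κ h) : Feasible κ fun x => f (g x) (h x) :=
  PolyTime.comp₁ hf (hg.node hh)

theorem comp₃ {f : Data → Data → Data → Data} (hf : PolyTime fun z => f z.hd z.tl.hd z.tl.tl)
    (hg : Feasible κ g) (hh : Feasible κ h) (hk : Feasible κ k) :
    Feasible κ fun x => f (g x) (h x) (k x) :=
  PolyTime.comp₁ hf (hg.node (hh.node hk))

end PolyTime

/-! ### Recursion over lists -/

theorem Feasible.polyBounded_size {κ : Data → ℕ} {f : Data → Data} (hf : Feasible κ f) :
    PolyBounded κ fun x => (f x).size :=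
  let ⟨_, _, _, _, hs⟩ := hf
  hs

/-- The tree that stands for a list; the inverse of `Data.toList`. -/
def Data.ofList : List Data → Data
  | [] => .nil
  | a :: l => .node a (Data.ofList l)

theorem Data.ofList_toList (x : Data) : Data.ofList x.toList = x := by
  induction x with
  | nil => rfl
  | node a l _ ih => rw [toList_node, ofList, ih]

/-- Moves the entries of the first list of a pair, one at a time, to the front of the second. -/
def Prog.reverseLoop : Prog :=
  .loop (.hd .arg) (.cons (.tl (.hd .arg)) (.cons (.hd (.hd .arg)) (.tl .arg)))

/-- The program that reverses a list. -/
def Prog.reverse : Prog :=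
  .call (.tl .arg) (.call .reverseLoop (.cons .arg .nil))

theorem run_reverseLoop (l : List Data) (r : Data) : ∃ n ≤ 14 * l.length + 3,
    Run .reverseLoop (.node (.ofList l) r) (.node .nil (.ofList (l.reverse ++ r.toList))) n := by
  induction l generalizing r with
  | nil =>
    refine ⟨3, by simp, ?_⟩
    rw [List.reverse_nil, List.nil_append, Data.ofList_toList]
    exact .loopDone (.hd (.arg _))
  | cons a l ih =>
    obtain ⟨n, hn, hrest⟩ := ih (.node a r)
    have hcond : Run (.hd .arg) (.node (.ofList (a :: l)) r) (.ofList (a :: l)) 2 := .hd (.arg _)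
    have hbody : Run (.cons (.tl (.hd .arg)) (.cons (.hd (.hd .arg)) (.tl .arg)))
        (.node (.ofList (a :: l)) r) (.node (.ofList l) (.node a r)) (3 + (3 + 2 + 1) + 1) :=
      .cons (.tl (.hd (.arg _))) (.cons (.hd (.hd (.arg _))) (.tl (.arg _)))
    rw [show l.reverse ++ (Data.node a r).toList = (a :: l).reverse ++ r.toList by simp] at hrest
    exact ⟨_, by simp only [List.length_cons]; lia, .loopStep hcond hbody hrest⟩

theorem run_reverse (x : Data) : ∃ n ≤ 14 * x.size + 20,
    Run .reverse x (.ofList x.toList.reverse) n := by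
  obtain ⟨n, hn, hloop⟩ := run_reverseLoop x.toList .nil
  rw [Data.ofList_toList, Data.toList_nil, List.append_nil] at hloop
  have hinit : Run (.cons .arg .nil) x (.node x .nil) (1 + 1 + 1) := .cons (.arg _) (.nil _)
  have := x.length_toList_le
  exact ⟨_, by lia, .call (.call hinit hloop) (.tl (.arg _))⟩

/-- The loop that folds the program `B` over a reversed list. Its state consists of the rest of the
list, the accumulated value and the parameter of the recursion. -/
def Prog.foldLoop (B : Prog) : Prog :=
  .loop (.hd .arg) (.cons (.tl (.hd .arg))
    (.cons (.call B (.cons (.hd (.hd .arg)) (.tl .arg))) (.tl (.tl .arg))))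

/-- The program that computes `List.foldr` for the list computed by `L`, the initial value computed
by `I` and the step computed by `B`. -/
def Prog.fold (L I B : Prog) : Prog :=
  .call (.hd (.tl .arg)) (.call (.foldLoop B) (.cons (.call .reverse L) (.cons I .arg)))

/-- A bound on the cost of `Prog.foldLoop`, where `b` bounds the cost of the step. -/
def foldCost (b : Data → ℕ) (f : Data → Data → Data) (z x : Data) : List Data → ℕ
  | [] => 0
  | e :: l => foldCost b f z x l + b (.node e (.node (l.foldr f z) x)) + 20

section Fold

variable {B : Prog} {b : Data → ℕ} {f : Data → Data → Data} {x : Data}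

theorem run_foldLoop
    (hB : ∀ e acc, ∃ n ≤ b (.node e (.node acc x)), Run B (.node e (.node acc x)) (f e acc) n)
    (z : Data) (l : List Data) (r : List Data) (y : Data) (n : ℕ)
    (h : Run (.foldLoop B) (.node (.ofList r) (.node (l.foldr f z) x)) y n) :
    ∃ m ≤ n + foldCost b f z x l,
      Run (.foldLoop B) (.node (.ofList (l.reverse ++ r)) (.node z x)) y m := by
  induction l generalizing r n with
  | nil => exact ⟨n, by simp [foldCost], h⟩
  | cons e l ih =>
    obtain ⟨k, hk, hstep⟩ := hB e (l.foldr f z)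
    set s : Data := .node (.ofList (e :: r)) (.node (l.foldr f z) x)
    have hcond : Run (.hd .arg) s (.ofList (e :: r)) 2 := .hd (.arg _)
    have harg : Run (.cons (.hd (.hd .arg)) (.tl .arg)) s (.node e (.node (l.foldr f z) x)) _ :=
      .cons (.hd (.hd (.arg _))) (.tl (.arg _))
    have hbody : Run (.cons (.tl (.hd .arg))
        (.cons (.call B (.cons (.hd (.hd .arg)) (.tl .arg))) (.tl (.tl .arg)))) s
        (.node (.ofList r) (.node (f e (l.foldr f z)) x)) _ :=
      .cons (.tl (.hd (.arg _))) (.cons (.call harg hstep) (.tl (.tl (.arg _))))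
    obtain ⟨m, hm, hfin⟩ := ih (e :: r) _ (.loopStep hcond hbody h)
    refine ⟨m, ?_, by simpa using hfin⟩
    simp only [foldCost]
    lia

theorem run_fold {pL pI : Prog} {L : Data} {z : Data} {nL nI : ℕ}
    (hB : ∀ e acc, ∃ n ≤ b (.node e (.node acc x)), Run B (.node e (.node acc x)) (f e acc) n)
    (hL : Run pL x L nL) (hI : Run pI x z nI) :
    ∃ n ≤ nL + nI + 14 * L.size + foldCost b f z x L.toList + 40,
      Run (.fold pL pI B) x (L.toList.foldr f z) n := by
  obtain ⟨n, hn, hrev⟩ := run_reverse L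
  have hend : Run (.foldLoop B) (.node (.ofList []) (.node (L.toList.foldr f z) x))
      (.node .nil (.node (L.toList.foldr f z) x)) 3 := .loopDone (.hd (.arg _))
  obtain ⟨m, hm, hloop⟩ := run_foldLoop hB z L.toList [] _ _ hend
  rw [List.append_nil] at hloop
  exact ⟨_, by lia, .call (.call (.cons (.call hL hrev) (.cons hI (.arg x))) hloop)
    (.hd (.tl (.arg _)))⟩

theorem foldCost_le {z : Data} {M : ℕ} {l : List Data}
    (h : ∀ e l', e :: l' <:+ l → b (.node e (.node (l'.foldr f z) x)) ≤ M) :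
    foldCost b f z x l ≤ l.length * (M + 20) := by
  induction l with
  | nil => simp [foldCost]
  | cons e l ih =>
    have hhead := h e l (List.suffix_refl _)
    have htail := ih fun e' l' hl => h e' l' (hl.trans (List.suffix_cons e l))
    simp only [foldCost, List.length_cons]
    nlinarith

end Fold

section Recursion

variable {κ κ' : Data → ℕ} {L I : Data → Data} {B : Data → Data → Data → Data}

theorem polyBounded_foldCost {b : Data → ℕ} (hL : PolyBounded κ fun x => (L x).size)
    (hb : PolyBounded κ' b)
    (hκ : ∀ K, ∃ K', ∀ x, κ x ≤ K → ∀ e ∈ (L x).toList, ∀ acc, κ' (.node e (.node acc x)) ≤ K')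
    (hacc : ∀ K, ∃ k, ∀ x, κ x ≤ K → ∀ l, l <:+ (L x).toList →
      (l.foldr (fun e acc => B e acc x) (I x)).size ≤ (x.size + 2) ^ k) :
    PolyBounded κ fun x => foldCost b (fun e acc => B e acc x) (I x) x (L x).toList := by
  intro K
  obtain ⟨K', hK'⟩ := hκ K
  obtain ⟨a, ha⟩ := hacc K
  obtain ⟨c, hc⟩ := hL K
  obtain ⟨d, hd⟩ := hb K'
  have hn := PolyBounded.size_pow κ
  have hbound : PolyBounded κ fun x => (x.size + 2) ^ c *
      ((((x.size + 2) ^ c + ((x.size + 2) ^ a + x.size + 1) + 1) + 2) ^ d + 20) :=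
    (hn c).mul ((((((hn c).add (((hn a).add (.size _)).add (.const _ _))).add
      (.const _ _)).add (.const _ _)).pow d).add (.const _ _))
  obtain ⟨k, hk⟩ := hbound K
  refine ⟨k, fun x hx => le_trans ?_ (hk x hx)⟩
  refine (foldCost_le fun e l' hl => ?_).trans
    (Nat.mul_le_mul_right _ ((Data.length_toList_le _).trans (hc x hx)))
  have he : e ∈ (L x).toList := hl.subset List.mem_cons_self
  have hentry := (Data.size_le_of_mem he).trans (hc x hx)
  have hvalue := ha x hx l' ((List.suffix_cons e l').trans hl)
  refine (hd _ (hK' x hx e he _)).trans (Nat.pow_le_pow_left ?_ _)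
  simp only [Data.size_node]
  lia

theorem Feasible.foldr (hL : Feasible κ L) (hI : Feasible κ I)
    (hB : Feasible κ' fun z => B z.hd z.tl.hd z.tl.tl)
    (hκ : ∀ K, ∃ K', ∀ x, κ x ≤ K → ∀ e ∈ (L x).toList, ∀ acc, κ' (.node e (.node acc x)) ≤ K')
    (hacc : ∀ K, ∃ k, ∀ x, κ x ≤ K → ∀ l, l <:+ (L x).toList →
      (l.foldr (fun e acc => B e acc x) (I x)).size ≤ (x.size + 2) ^ k) :
    Feasible κ fun x => (L x).toList.foldr (fun e acc => B e acc x) (I x) := by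
  obtain ⟨pL, bL, hpL, hbL, hsL⟩ := hL
  obtain ⟨pI, bI, hpI, hbI, -⟩ := hI
  obtain ⟨pB, bB, hpB, hbB, -⟩ := hB
  refine ⟨.fold pL pI pB, fun x => bL x + bI x + 14 * (L x).size +
    foldCost bB (fun e acc => B e acc x) (I x) x (L x).toList + 40, fun x => ?_,
    (((hbL.add hbI).add ((PolyBounded.const _ 14).mul hsL)).add
      (polyBounded_foldCost hsL hbB hκ hacc)).add (.const _ _), fun K => ?_⟩
  · obtain ⟨nL, hnL, hrunL⟩ := hpL x
    obtain ⟨nI, hnI, hrunI⟩ := hpI x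
    obtain ⟨n, hn, hrun⟩ := run_fold (f := fun e acc => B e acc x)
      (fun e acc => hpB (.node e (.node acc x))) hrunL hrunI
    exact ⟨n, by lia, hrun⟩
  · obtain ⟨k, hk⟩ := hacc K
    exact ⟨k, fun x hx => hk x hx _ (List.suffix_refl _)⟩

theorem exists_size_foldr_le_pow (hL : PolyBounded κ fun x => (L x).size)
    (hI : PolyBounded κ fun x => (I x).size)
    (hB : PolyBounded κ' fun z => (B z.hd z.tl.hd z.tl.tl).size)
    (hκ : ∀ K, ∃ K', ∀ x, κ x ≤ K → ∀ e ∈ (L x).toList, ∀ acc, κ' (.node e (.node acc x)) ≤ K')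
    (K n : ℕ) : ∃ k, ∀ x, κ x ≤ K → ∀ l, l <:+ (L x).toList → l.length ≤ n →
      (l.foldr (fun e acc => B e acc x) (I x)).size ≤ (x.size + 2) ^ k := by
  obtain ⟨K', hK'⟩ := hκ K
  obtain ⟨d, hd⟩ := hI K
  induction n with
  | zero =>
    refine ⟨d, fun x hx l _ hl => ?_⟩
    rw [List.length_eq_zero_iff.1 (Nat.le_zero.1 hl)]
    exact hd x hx
  | succ n ih =>
    obtain ⟨k, hk⟩ := ih
    obtain ⟨j, hj⟩ := hB K'
    have hn := PolyBounded.size_pow κ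
    obtain ⟨r, hr⟩ := (((hL.add ((hn k).add (.size _))).add (.const _ 4)).pow j) K
    refine ⟨max d r, fun x hx l hl hlen => ?_⟩
    cases l with
    | nil => exact (hd x hx).trans (Nat.pow_le_pow_right (by lia) (le_max_left _ _))
    | cons e l =>
      have he : e ∈ (L x).toList := hl.subset List.mem_cons_self
      have hentry := Data.size_le_of_mem he
      have hvalue := hk x hx l ((List.suffix_cons e l).trans hl) (by simpa using hlen)
      refine (hj (.node e (.node _ x)) (hK' x hx e he _)).trans ?_
      refine le_trans (Nat.pow_le_pow_left ?_ _)
        ((hr x hx).trans (Nat.pow_le_pow_right (by lia) (le_max_right _ _)))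
      simp only [Data.size_node]
      lia

theorem Feasible.foldr_of_length_le (hL : Feasible κ L) (hI : Feasible κ I)
    (hB : Feasible κ' fun z => B z.hd z.tl.hd z.tl.tl)
    (hκ : ∀ K, ∃ K', ∀ x, κ x ≤ K → ∀ e ∈ (L x).toList, ∀ acc, κ' (.node e (.node acc x)) ≤ K')
    (hlen : ∀ K, ∃ N, ∀ x, κ x ≤ K → (L x).toList.length ≤ N) :
    Feasible κ fun x => (L x).toList.foldr (fun e acc => B e acc x) (I x) := by
  refine hL.foldr hI hB hκ fun K => ?_
  obtain ⟨N, hN⟩ := hlen K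
  obtain ⟨k, hk⟩ := exists_size_foldr_le_pow hL.polyBounded_size hI.polyBounded_size
    hB.polyBounded_size hκ K N
  exact ⟨k, fun x hx l hl => hk x hx l hl (hl.length_le.trans (hN x hx))⟩

theorem size_foldr_le_of_additive {f : Data → Data → Data} {g : Data → ℕ} {z : Data} {M : ℕ}
    (hf : ∀ e acc, (f e acc).size ≤ acc.size + g e) {l : List Data} (hg : ∀ e ∈ l, g e ≤ M) :
    (l.foldr f z).size ≤ z.size + l.length * M := by
  induction l with
  | nil => simp
  | cons e l ih =>
    have htail := ih fun e' he' => hg e' (List.mem_cons_of_mem _ he')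
    have hhead := hg e List.mem_cons_self
    have hstep := hf e (l.foldr f z)
    simp only [List.foldr_cons, List.length_cons, Nat.succ_mul]
    lia

theorem Feasible.foldr_of_additive {G : Data → Data → Data} (hL : Feasible κ L)
    (hI : Feasible κ I) (hB : Feasible κ' fun z => B z.hd z.tl.hd z.tl.tl)
    (hκ : ∀ K, ∃ K', ∀ x, κ x ≤ K → ∀ e ∈ (L x).toList, ∀ acc, κ' (.node e (.node acc x)) ≤ K')
    (hG : Feasible κ' fun z => G z.hd z.tl.tl)
    (hsize : ∀ e acc x, (B e acc x).size ≤ acc.size + (G e x).size) :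
    Feasible κ fun x => (L x).toList.foldr (fun e acc => B e acc x) (I x) := by
  refine hL.foldr hI hB hκ fun K => ?_
  obtain ⟨K', hK'⟩ := hκ K
  obtain ⟨j, hj⟩ := hG.polyBounded_size K'
  have hsL := hL.polyBounded_size
  obtain ⟨k, hk⟩ := (hI.polyBounded_size.add
    (hsL.mul (((hsL.add (.size _)).add (.const _ 4)).pow j))) K
  refine ⟨k, fun x hx l hl => le_trans ?_ (hk x hx)⟩
  refine (size_foldr_le_of_additive (hsize · · x) fun e he => ?_).trans
    (Nat.add_le_add_left (Nat.mul_le_mul_right _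
      (hl.length_le.trans (Data.length_toList_le _))) _)
  have hentry := Data.size_le_of_mem (hl.subset he)
  refine (hj (.node e (.node .nil x)) (hK' x hx e (hl.subset he) _)).trans
    (Nat.pow_le_pow_left ?_ _)
  simp only [Data.size_node, Data.size_nil]
  lia

end Recursion

/-- The concatenation of two lists. -/
def Data.append (a b : Data) : Data := a.toList.foldr .node b

/-- The concatenation of the lists `g e`, for the entries `e` of a list, and of `z`. -/
def Data.flatMap (g : Data → Data) (z d : Data) : Data :=
  d.toList.foldr (fun e acc => (g e).append acc) z

/-- The value of `v` at the first entry of a list that satisfies `c`, or else `z`. -/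
def Data.first (c v : Data → Data) (z d : Data) : Data :=
  d.toList.foldr (fun e acc => Data.ite (c e) (v e) acc) z

theorem Data.size_append_le (a b : Data) : (a.append b).size ≤ b.size + a.size := by
  induction a with
  | nil => simp [append]
  | node e l _ ih =>
    simp only [append, toList_node, List.foldr_cons, size_node] at ih ⊢
    lia

theorem PolyTime.append : PolyTime fun z => z.hd.append z.tl :=
  Feasible.foldr_of_additive (B := fun e acc _ => .node e acc)
    (G := fun e _ => .node e .nil) (κ' := fun _ => 0) Feasible.id.hd Feasible.id.tl
    (Feasible.id.hd.node Feasible.id.tl.hd) (fun _ => ⟨0, fun _ _ _ _ _ => le_rfl⟩)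
    (Feasible.id.hd.node .nil) (fun e acc _ => by simp only [Data.size_node, Data.size_nil]; lia)

section

variable {κ κ' : Data → ℕ} {L I : Data → Data} {C G : Data → Data → Data}

theorem Feasible.flatMap (hG : PolyTime fun z => G z.hd z.tl) (hI : Feasible κ I)
    (hL : Feasible κ L) : Feasible κ fun x => Data.flatMap (fun e => G e x) (I x) (L x) :=
  have hG' : PolyTime fun z => G z.hd z.tl.tl := PolyTime.comp₂ hG Feasible.id.hd Feasible.id.tl.tl
  hL.foldr_of_additive (B := fun e acc x => (G e x).append acc) hI
    (PolyTime.comp₂ PolyTime.append hG' Feasible.id.tl.hd)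
    (fun _ => ⟨0, fun _ _ _ _ _ => le_rfl⟩) hG' (fun _ _ _ => Data.size_append_le _ _)

theorem Feasible.first (hC : Feasible κ' fun z => C z.hd z.tl)
    (hG : Feasible κ' fun z => G z.hd z.tl) (hI : Feasible κ I) (hL : Feasible κ L)
    (hκ : ∀ K, ∃ K', ∀ x, κ x ≤ K → ∀ e ∈ (L x).toList, κ' (.node e x) ≤ K') :
    Feasible κ fun x => Data.first (fun e => C e x) (fun e => G e x) (I x) (L x) := by
  have skipAcc : ∀ {F : Data → Data → Data}, Feasible κ' (fun z => F z.hd z.tl) →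
      Feasible (fun z => κ' (.node z.hd z.tl.tl)) fun z => F z.hd z.tl.tl := fun hF =>
    hF.comp (f := fun z => .node z.hd z.tl.tl) (Feasible.id.hd.node Feasible.id.tl.tl)
      fun K => ⟨K, fun _ h => h⟩
  refine hL.foldr_of_additive (B := fun e acc x => Data.ite (C e x) (G e x) acc) hI
    ((skipAcc hC).ite (skipAcc hG) Feasible.id.tl.hd) (fun K => ?_) (skipAcc hG)
    (fun e acc x => ?_)
  · obtain ⟨K', hK'⟩ := hκ K
    exact ⟨K', fun x hx e he _ => hK' x hx e he⟩
  · cases C e x <;> simp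

theorem PolyTime.first (hC : PolyTime fun z => C z.hd z.tl) (hG : PolyTime fun z => G z.hd z.tl)
    (hI : Feasible κ I) (hL : Feasible κ L) :
    Feasible κ fun x => Data.first (fun e => C e x) (fun e => G e x) (I x) (L x) :=
  Feasible.first hC hG hI hL fun _ => ⟨0, fun _ _ _ _ => le_rfl⟩

end

/-! ### Comparison of trees -/

/-- `nil` if the trees are equal, and otherwise a tree whose head is `nil` iff the first one comes
first in the lexicographic order. -/
def Data.cmp : Data → Data → Data
  | .nil, .nil => .nil
  | .nil, .node _ _ => .node .nil .nil
  | .node _ _, .nil => .node (.node .nil .nil) .nil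
  | .node a b, .node c d => Data.ite (Data.cmp a c) (Data.cmp a c) (Data.cmp b d)

/-- One step of the comparison of trees. The state consists of a stack of pairs of trees that remain
to be compared and of the result. -/
def Prog.cmpBody : Prog :=
  let x : Prog := .hd (.hd (.hd .arg))
  let y : Prog := .tl (.hd (.hd .arg))
  let rest : Prog := .tl (.hd .arg)
  .ite x
    (.ite y
      (.cons (.cons (.cons (.hd x) (.hd y)) (.cons (.cons (.tl x) (.tl y)) rest)) .nil)
      (.cons .nil (.cons (.cons .nil .nil) .nil)))
    (.ite y (.cons .nil (.cons .nil .nil)) (.cons rest .nil))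

/-- The loop of the comparison of trees; it ends when the stack is empty. -/
def Prog.cmpLoop : Prog := .loop (.hd .arg) .cmpBody

/-- The program that compares the two trees of a pair. -/
def Prog.cmp : Prog :=
  .call (.tl .arg) (.call .cmpLoop (.cons (.cons .arg .nil) .nil))

theorem run_cmpLoop_halted (r : Data) : Run .cmpLoop (.node .nil r) (.node .nil r) 3 :=
  .loopDone (.hd (.arg _))

section

variable (x y rest : Data)

theorem run_cmpBody_fst :
    Run (.hd (.hd (.hd .arg))) (.node (.node (.node x y) rest) .nil) x 4 :=
  .hd (.hd (.hd (.arg _)))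

theorem run_cmpBody_snd :
    Run (.tl (.hd (.hd .arg))) (.node (.node (.node x y) rest) .nil) y 4 :=
  .tl (.hd (.hd (.arg _)))

theorem run_cmpBody_rest :
    Run (.tl (.hd .arg)) (.node (.node (.node x y) rest) .nil) rest 3 :=
  .tl (.hd (.arg _))

end

theorem run_cmpLoop (x y rest z : Data) (n : ℕ) (h : Run .cmpLoop (.node rest .nil) z n) :
    ∃ m ≤ n + 50 * (2 * x.size + 1), Run .cmpLoop (.node (.node (.node x y) rest) .nil)
      (Data.ite (x.cmp y) (.node .nil (x.cmp y)) z) m := by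
  induction x generalizing y rest z n with
  | nil =>
    cases y with
    | nil =>
      exact ⟨_, by simp only [Data.size_nil]; lia, .loopStep (.hd (.arg _))
        (.iteElse (run_cmpBody_fst ..) (.iteElse (run_cmpBody_snd ..)
          (.cons (run_cmpBody_rest ..) (.nil _)))) h⟩
    | node u v =>
      exact ⟨_, by simp only [Data.size_nil]; lia, .loopStep (.hd (.arg _))
        (.iteElse (run_cmpBody_fst ..) (.iteThen (run_cmpBody_snd ..)
          (.cons (.nil _) (.cons (.nil _) (.nil _))))) (run_cmpLoop_halted _)⟩
  | node a b iha ihb =>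
    have hx := run_cmpBody_fst (.node a b) y rest
    have hy := run_cmpBody_snd (.node a b) y rest
    cases y with
    | nil =>
      exact ⟨_, by simp only [Data.size_node]; lia, .loopStep (.hd (.arg _))
        (.iteThen hx (.iteElse hy (.cons (.nil _) (.cons (.cons (.nil _) (.nil _)) (.nil _)))))
        (run_cmpLoop_halted _)⟩
    | node u v =>
      obtain ⟨m, hm, hright⟩ := ihb v rest z n h
      obtain ⟨m', hm', hleft⟩ := iha u (.node (.node b v) rest) _ m hright
      have hres : Data.ite (a.cmp u) (.node .nil (a.cmp u))
          (Data.ite (b.cmp v) (.node .nil (b.cmp v)) z) =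
          Data.ite ((Data.node a b).cmp (.node u v))
            (.node .nil ((Data.node a b).cmp (.node u v))) z := by
        simp only [Data.cmp]
        cases a.cmp u <;> simp only [Data.ite_nil, Data.ite_node]
      rw [hres] at hleft
      refine ⟨_, ?_, .loopStep (.hd (.arg _)) (.iteThen hx (.iteThen hy (.cons (.cons
        (.cons (.hd hx) (.hd hy)) (.cons (.cons (.tl hx) (.tl hy)) (run_cmpBody_rest ..)))
        (.nil _)))) hleft⟩
      simp only [Data.size_node]
      lia

theorem Data.size_cmp_le (x y : Data) : (x.cmp y).size ≤ 2 := by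
  induction x generalizing y with
  | nil => cases y <;> simp [cmp]
  | node a b iha ihb =>
    cases y with
    | nil => simp [cmp]
    | node c d =>
      have hfst := iha c
      have hsnd := ihb d
      simp only [cmp]
      cases h : a.cmp c with
      | nil => exact hsnd
      | node u v => rwa [h] at hfst

theorem PolyTime.cmp : PolyTime fun z => z.hd.cmp z.tl := by
  refine ⟨.call .cmp (.cons (.hd .arg) (.tl .arg)), fun z => 100 * z.size + 100, fun z => ?_,
    ((PolyBounded.const _ _).mul (.size _)).add (.const _ _),
    (PolyBounded.const _ 2).mono fun z => Data.size_cmp_le _ _⟩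
  obtain ⟨m, hm, hloop⟩ := run_cmpLoop z.hd z.tl .nil _ 3 (run_cmpLoop_halted .nil)
  have hres : z.hd.cmp z.tl = (Data.ite (z.hd.cmp z.tl) (.node .nil (z.hd.cmp z.tl))
      (.node .nil .nil)).tl := by
    cases z.hd.cmp z.tl <;> rfl
  have hinit : Run (.cons (.cons .arg .nil) .nil) (.node z.hd z.tl)
      (.node (.node (.node z.hd z.tl) .nil) .nil) _ := .cons (.cons (.arg _) (.nil _)) (.nil _)
  have hpair : Run (.cons (.hd .arg) (.tl .arg)) z (.node z.hd z.tl) (2 + 2 + 1) :=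
    .cons (.hd (.arg _)) (.tl (.arg _))
  have := z.size_hd_le
  beta_reduce
  rw [hres]
  exact ⟨_, by lia, .call hpair (.call (.call hinit hloop) (.tl (.arg _)))⟩

theorem Data.cmp_eq_nil_iff (x y : Data) : x.cmp y = .nil ↔ x = y := by
  induction x generalizing y with
  | nil => cases y <;> simp [cmp]
  | node a b iha ihb =>
    cases y with
    | nil => simp [cmp]
    | node c d =>
      simp only [cmp, node.injEq, ← iha c, ← ihb d]
      cases h : a.cmp c <;> simp

/-- The equality test on trees: `node nil nil` if they are equal, and `nil` otherwise. -/
def Data.eq (x y : Data) : Data := Data.ite (x.cmp y) .nil (.node .nil .nil)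

theorem Data.eq_self (x : Data) : Data.eq x x = .node .nil .nil := by
  rw [eq, (cmp_eq_nil_iff x x).2 rfl, ite_nil]

theorem Data.eq_of_ne {x y : Data} (h : x ≠ y) : Data.eq x y = .nil := by
  rw [eq]
  cases hc : x.cmp y with
  | nil => exact absurd ((cmp_eq_nil_iff x y).1 hc) h
  | node => rfl

theorem PolyTime.eq : PolyTime fun z => Data.eq z.hd z.tl :=
  PolyTime.cmp.ite .nil (Feasible.nil.node .nil)

/-! ### Encodings -/

/-- The encoding of chase elements as an individual paired with a list of roles. -/
def Elem.enc (x : Elem) : Data := .node (encName x.1) (encList Role.enc x.2)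

/-- The encoding of facts, tagged as that of query atoms. -/
def Fact.enc : Fact → Data
  | .concept A x => .node (encBool false) (.node (encName A) (Elem.enc x))
  | .role P x y => .node (encBool true) (.node (encName P) (.node (Elem.enc x) (Elem.enc y)))

theorem encList_injective {α : Type} {enc : α → Data} (h : Function.Injective enc) :
    Function.Injective (encList enc) := by
  intro l
  induction l with
  | nil => intro m hm; cases m <;> simp_all [encList]
  | cons a l ih =>
    intro m hm
    cases m with
    | nil => simp [encList] at hm
    | cons b m =>
      simp only [encList, Data.node.injEq] at hm
      rw [h hm.1, ih hm.2]

theorem encBool_injective : Function.Injective encBool := by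
  intro a b; cases a <;> cases b <;> simp [encBool]

theorem encName_injective : Function.Injective encName := encList_injective encBool_injective

theorem encName_inj {a b : Name} : encName a = encName b ↔ a = b := encName_injective.eq_iff

theorem Role.enc_injective : Function.Injective Role.enc := by
  intro R Q; cases R <;> cases Q <;> simp [enc, encBool, encName_inj]

theorem Elem.enc_injective : Function.Injective Elem.enc := by
  intro x y h
  simp only [enc, Data.node.injEq] at h
  exact Prod.ext (encName_injective h.1) (encList_injective Role.enc_injective h.2)

theorem Fact.enc_injective : Function.Injective Fact.enc := by
  intro φ ψ
  cases φ <;> cases ψ <;> simp [enc, encBool, encName_inj, Elem.enc_injective.eq_iff]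

theorem Term.enc_injective : Function.Injective Term.enc := by
  intro t u; cases t <;> cases u <;> simp [enc, encBool, encName_inj]

theorem toList_encList {α : Type} (enc : α → Data) (l : List α) :
    (encList enc l).toList = l.map enc := by
  induction l with
  | nil => rfl
  | cons a l ih => rw [encList, Data.toList_node, ih, List.map_cons]

theorem append_encList {α : Type} (enc : α → Data) (l m : List α) :
    (encList enc l).append (encList enc m) = encList enc (l ++ m) := by
  rw [Data.append, toList_encList, List.foldr_map]
  induction l with
  | nil => rfl
  | cons a l ih => rw [List.foldr_cons, ih, List.cons_append, encList]

/-- The tree `d` is a list of the elements that satisfy `Q`, possibly with repetitions. -/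
def Lists {α : Type} (enc : α → Data) (d : Data) (Q : α → Prop) : Prop :=
  ∃ l : List α, d = encList enc l ∧ ∀ a, a ∈ l ↔ Q a

theorem Represents.lists {α : Type} {enc : α → Data} {d : Data} {S : Set α}
    (h : Represents enc d S) : Lists enc d (· ∈ S) :=
  let ⟨l, _, hl, hd⟩ := h
  ⟨l, hd, hl⟩

theorem Represents.length_toList {α : Type} {enc : α → Data} {d : Data} {s : Finset α}
    (h : Represents enc d (s : Set α)) : d.toList.length = s.card := by
  classical
  obtain ⟨l, hnodup, hl, rfl⟩ := h
  have hs : l.toFinset = s := by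
    ext a
    rw [List.mem_toFinset, hl, Finset.mem_coe]
  rw [toList_encList, List.length_map, ← hs, List.toFinset_card_of_nodup hnodup]

namespace Lists

variable {α β : Type} {enc : α → Data} {enc' : β → Data} {d z : Data} {Q Q' : α → Prop}

theorem congr (h : Lists enc d Q) (hQ : ∀ a, Q a ↔ Q' a) : Lists enc d Q' := by
  obtain ⟨l, hl, hm⟩ := h
  exact ⟨l, hl, fun a => (hm a).trans (hQ a)⟩

theorem of_list (l : List α) : Lists enc (encList enc l) (· ∈ l) := ⟨l, rfl, fun _ => Iff.rfl⟩

theorem nil (h : ∀ a, ¬ Q a) : Lists enc .nil Q :=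
  ⟨[], rfl, fun a => iff_of_false List.not_mem_nil (h a)⟩

theorem single (a : α) : Lists enc (.node (enc a) .nil) (· = a) :=
  ⟨[a], rfl, fun _ => List.mem_singleton⟩

theorem append {Q₂ : α → Prop} (h : Lists enc d Q) (h₂ : Lists enc z Q₂) :
    Lists enc (d.append z) fun a => Q a ∨ Q₂ a := by
  obtain ⟨l, rfl, hl⟩ := h
  obtain ⟨m, rfl, hm⟩ := h₂
  exact ⟨l ++ m, append_encList enc l m, fun a => by rw [List.mem_append, hl, hm]⟩

theorem flatMap {g : Data → Data} {G : α → β → Prop} {Z : β → Prop} (hd : Lists enc d Q)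
    (hz : Lists enc' z Z) (hg : ∀ a, Q a → Lists enc' (g (enc a)) (G a)) :
    Lists enc' (Data.flatMap g z d) fun b => (∃ a, Q a ∧ G a b) ∨ Z b := by
  obtain ⟨l, rfl, hm⟩ := hd
  rw [Data.flatMap, toList_encList]
  have hg' : ∀ a ∈ l, Lists enc' (g (enc a)) (G a) := fun a ha => hg a ((hm a).1 ha)
  simp only [← hm]
  clear hm hg
  induction l with
  | nil => exact hz.congr fun b => by simp
  | cons a l ih =>
    have hrest := ih fun b hb => hg' b (List.mem_cons_of_mem _ hb)
    refine ((hg' a List.mem_cons_self).append hrest).congr fun b => ?_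
    rw [List.exists_mem_cons_iff, or_assoc]

theorem toList (h : Lists enc d Q) (e : Data) : e ∈ d.toList ↔ ∃ a, Q a ∧ enc a = e := by
  obtain ⟨l, rfl, hm⟩ := h
  simp only [toList_encList, List.mem_map, hm]

end Lists

/-- The truth value true; false is `nil`. -/
def Data.true : Data := .node .nil .nil

theorem Data.first_true_ne_nil (c : Data → Data) (d : Data) :
    Data.first c (fun _ => Data.true) .nil d ≠ .nil ↔ ∃ e ∈ d.toList, c e ≠ .nil := by
  rw [first]
  induction d.toList with
  | nil => simp
  | cons e l ih =>
    simp only [List.foldr_cons, List.exists_mem_cons_iff, ← ih]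
    cases c e <;> simp [Data.true]

theorem Data.first_nil_ne_nil (c : Data → Data) (d : Data) :
    Data.first c (fun _ => .nil) Data.true d ≠ .nil ↔ ∀ e ∈ d.toList, c e = .nil := by
  rw [first]
  induction d.toList with
  | nil => simp [Data.true]
  | cons e l ih =>
    simp only [List.foldr_cons, List.forall_mem_cons, ← ih]
    cases c e <;> simp

/-! ### The chase on trees -/

/-- The pair of the elements between which the fact `φ` asserts the basic role `R`, or else
`nil`. -/
def matchRoleD (R φ : Data) : Data :=
  Data.ite φ.hd (Data.ite (Data.eq φ.tl.hd R.tl)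
    (Data.ite R.hd (.node φ.tl.tl.tl φ.tl.tl.hd) φ.tl.tl) .nil) .nil

/-- The element for which `φ` shows the basic concept `B`, or else `nil`. -/
def matchConceptD (B φ : Data) : Data :=
  Data.ite B.hd (matchRoleD B.tl φ).hd
    (Data.ite φ.hd .nil (Data.ite (Data.eq φ.tl.hd B.tl) φ.tl.tl .nil))

/-- The atom that asserts `R` between `x` and `y`; both facts and query atoms have this form. -/
def roleAtomD (R x y : Data) : Data :=
  .node Data.true (.node R.tl (Data.ite R.hd (.node y x) (.node x y)))

/-- The atom that asserts `B` of `x`, with the witness `y` if `B` is an existential. -/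
def conceptAtomD (B x y : Data) : Data :=
  Data.ite B.hd (roleAtomD B.tl x y) (.node .nil (.node B.tl x))

/-- The Skolem term for the `R`-successor of `x`; compare `child`. -/
def childD (R x : Data) : Data := .node x.hd (.node R x.tl)

/-- The facts that the inclusion `i` yields from the fact `φ`. -/
def applyD (i φ : Data) : Data :=
  Data.ite i.hd.tl .nil (Data.ite i.hd.hd
    (Data.ite (matchRoleD i.tl.hd φ)
      (.node (roleAtomD i.tl.tl (matchRoleD i.tl.hd φ).hd (matchRoleD i.tl.hd φ).tl) .nil) .nil)
    (Data.ite (matchConceptD i.tl.hd φ)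
      (.node (conceptAtomD i.tl.tl (matchConceptD i.tl.hd φ)
        (childD i.tl.tl.tl (matchConceptD i.tl.hd φ))) .nil) .nil))

/-- One round of the chase of the facts `F`. -/
def roundD (T F : Data) : Data :=
  Data.flatMap (fun φ => Data.flatMap (fun i => applyD i φ) .nil T) F F

/-- As many rounds of the chase as complete it on the next level of Skolem terms. -/
def saturateD (T F : Data) : Data :=
  roundD T (T.toList.foldr (fun _ F => roundD T (roundD T F)) F)

/-- As many rounds of the chase as are needed to find the matches of the query `q`. -/
def chaseD (T q F : Data) : Data :=
  saturateD T (T.toList.foldr (fun _ F => saturateD T F)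
    (q.toList.foldr (fun _ F => saturateD T (saturateD T F)) F))

theorem matchRoleD_fact (R : Role) (x y : Elem) :
    matchRoleD R.enc (R.fact x y).enc = .node (Elem.enc x) (Elem.enc y) := by
  cases R <;> simp [matchRoleD, Role.fact, Fact.enc, Role.enc, encBool, Data.eq_self]

theorem matchRoleD_eq_nil {R : Role} {φ : Fact} (h : ∀ x y, φ ≠ R.fact x y) :
    matchRoleD R.enc φ.enc = .nil := by
  cases φ with
  | concept A x => rfl
  | role P x y =>
    have hname : encName P ≠ R.enc.tl := by
      cases R with
      | atomic Q => exact fun hPQ => h x y (by rw [encName_injective hPQ, Role.fact])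
      | inv Q => exact fun hPQ => h y x (by rw [encName_injective hPQ, Role.fact])
    simp [matchRoleD, Fact.enc, encBool, Data.eq_of_ne hname]

theorem matchConceptD_of_shows {B : Concept} {φ : Fact} {x : Elem} (h : φ.Shows B x) :
    matchConceptD B.enc φ.enc = Elem.enc x := by
  cases B with
  | atomic A => cases h; simp [matchConceptD, Concept.enc, Fact.enc, encBool, Data.eq_self]
  | ex R => obtain ⟨y, rfl⟩ := h; simp [matchConceptD, Concept.enc, encBool, matchRoleD_fact]

theorem matchConceptD_eq_nil {B : Concept} {φ : Fact} (h : ∀ x, ¬ φ.Shows B x) :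
    matchConceptD B.enc φ.enc = .nil := by
  cases B with
  | ex R =>
    have hrole : matchRoleD R.enc φ.enc = .nil :=
      matchRoleD_eq_nil fun x y hφ => h x ⟨y, hφ⟩
    simp [matchConceptD, Concept.enc, encBool, hrole, Data.hd]
  | atomic A =>
    cases φ with
    | role P x y => rfl
    | concept A' x =>
      have hname : encName A' ≠ encName A := fun hA => h x (by rw [encName_injective hA]; rfl)
      simp [matchConceptD, Concept.enc, Fact.enc, encBool, Data.eq_of_ne hname]

theorem roleAtomD_fact (R : Role) (x y : Elem) :
    roleAtomD R.enc (Elem.enc x) (Elem.enc y) = (R.fact x y).enc := by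
  cases R <;> rfl

theorem conceptAtomD_fact (B : Concept) (x : Elem) :
    conceptAtomD B.enc (Elem.enc x) (childD B.enc.tl (Elem.enc x)) = (B.fact x).enc := by
  cases B with
  | atomic A => rfl
  | ex R => exact roleAtomD_fact R x (child x R)

theorem Fact.Shows.unique {φ : Fact} {B : Concept} {x y : Elem} (hx : φ.Shows B x)
    (hy : φ.Shows B y) : x = y :=
  Elem.enc_injective ((matchConceptD_of_shows hx).symm.trans (matchConceptD_of_shows hy))

theorem Role.fact_injective {R : Role} {x y z w : Elem} (h : R.fact x y = R.fact z w) :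
    x = z ∧ y = w := by
  cases R <;> simp_all [fact]

/-- The fact `ψ` follows from the fact `φ` by the inclusion. -/
def Inclusion.Yields : Inclusion → Fact → Fact → Prop
  | .conceptIncl B C, φ, ψ => ∃ x, φ.Shows B x ∧ ψ = C.fact x
  | .roleIncl R Q, φ, ψ => ∃ x y, φ = R.fact x y ∧ ψ = Q.fact x y
  | _, _, _ => False

theorem step_iff_exists_yields {T : TBox} {φ ψ : Fact} :
    Step T φ ψ ↔ ∃ i ∈ T, i.Yields φ ψ := by
  constructor
  · rintro (⟨hi, hs⟩ | hi)
    · exact ⟨_, hi, _, hs, rfl⟩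
    · exact ⟨_, hi, _, _, rfl, rfl⟩
  · rintro ⟨_ | _ | _ | _, hi, h⟩
    · obtain ⟨x, hs, rfl⟩ := h
      exact .concept hi hs
    · exact h.elim
    · obtain ⟨x, y, rfl, rfl⟩ := h
      exact .role hi
    · exact h.elim

theorem lists_applyD_conceptIncl (B C : Concept) (φ : Fact) :
    Lists Fact.enc (applyD (Inclusion.conceptIncl B C).enc φ.enc)
      ((Inclusion.conceptIncl B C).Yields φ) := by
  have happly : applyD (Inclusion.conceptIncl B C).enc φ.enc =
      Data.ite (matchConceptD B.enc φ.enc) (.node (conceptAtomD C.enc (matchConceptD B.enc φ.enc)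
        (childD C.enc.tl (matchConceptD B.enc φ.enc))) .nil) .nil := rfl
  rw [happly]
  by_cases h : ∃ x, φ.Shows B x
  · obtain ⟨x, hx⟩ := h
    rw [matchConceptD_of_shows hx, conceptAtomD_fact]
    refine (Lists.single (C.fact x)).congr fun ψ => ⟨fun hψ => ⟨x, hx, hψ⟩, ?_⟩
    rintro ⟨y, hy, rfl⟩
    rw [hx.unique hy]
  · rw [matchConceptD_eq_nil (not_exists.1 h)]
    exact Lists.nil fun ψ ⟨x, hx, _⟩ => h ⟨x, hx⟩

theorem lists_applyD_roleIncl (R Q : Role) (φ : Fact) :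
    Lists Fact.enc (applyD (Inclusion.roleIncl R Q).enc φ.enc)
      ((Inclusion.roleIncl R Q).Yields φ) := by
  have happly : applyD (Inclusion.roleIncl R Q).enc φ.enc =
      Data.ite (matchRoleD R.enc φ.enc) (.node (roleAtomD Q.enc (matchRoleD R.enc φ.enc).hd
        (matchRoleD R.enc φ.enc).tl) .nil) .nil := rfl
  rw [happly]
  by_cases h : ∃ x y, φ = R.fact x y
  · obtain ⟨x, y, rfl⟩ := h
    rw [matchRoleD_fact, Data.ite_node, Data.hd_node, Data.tl_node, roleAtomD_fact]
    refine (Lists.single (Q.fact x y)).congr fun ψ => ⟨fun hψ => ⟨x, y, rfl, hψ⟩, ?_⟩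
    rintro ⟨z, w, hzw, rfl⟩
    obtain ⟨rfl, rfl⟩ := Role.fact_injective hzw
    rfl
  · rw [matchRoleD_eq_nil fun x y hφ => h ⟨x, y, hφ⟩]
    exact Lists.nil fun ψ ⟨x, y, hφ, _⟩ => h ⟨x, y, hφ⟩

theorem lists_applyD (i : Inclusion) (φ : Fact) :
    Lists Fact.enc (applyD i.enc φ.enc) (i.Yields φ) := by
  cases i with
  | conceptIncl B C => exact lists_applyD_conceptIncl B C φ
  | roleIncl R Q => exact lists_applyD_roleIncl R Q φ
  | conceptDisj | roleDisj => exact Lists.nil fun _ => id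

section

variable {T : TBox} {S : Set Fact} {dT F : Data} {n : ℕ}

theorem lists_roundD (hT : Represents Inclusion.enc dT (T : Set Inclusion))
    (hF : Lists Fact.enc F (DerivesWithin T S n)) :
    Lists Fact.enc (roundD dT F) (DerivesWithin T S (n + 1)) := by
  refine (hF.flatMap (G := Step T) hF fun φ _ => ?_).congr fun ψ => or_comm
  refine (hT.lists.flatMap (G := fun i => i.Yields φ) (Lists.nil fun _ => not_false)
    fun i _ => lists_applyD i φ).congr fun ψ => ?_
  rw [or_false, step_iff_exists_yields]
  rfl

theorem lists_iterate {f : Data → Data} {k : ℕ}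
    (hf : ∀ n F, Lists Fact.enc F (DerivesWithin T S n) →
      Lists Fact.enc (f F) (DerivesWithin T S (n + k)))
    (hF : Lists Fact.enc F (DerivesWithin T S n)) (l : List Data) :
    Lists Fact.enc (l.foldr (fun _ F => f F) F) (DerivesWithin T S (n + k * l.length)) := by
  induction l with
  | nil => exact hF
  | cons e l ih =>
    rw [List.length_cons, Nat.mul_succ, ← Nat.add_assoc]
    exact hf _ _ ih

theorem lists_saturateD (hT : Represents Inclusion.enc dT (T : Set Inclusion))
    (hF : Lists Fact.enc F (DerivesWithin T S n)) :
    Lists Fact.enc (saturateD dT F) (DerivesWithin T S (n + roundsToDepth T 1)) := by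
  have hiter := lists_iterate (k := 2) (f := fun F => roundD dT (roundD dT F))
    (fun n F h => lists_roundD hT (lists_roundD hT h)) hF dT.toList
  rw [hT.length_toList] at hiter
  rw [roundsToDepth, one_mul]
  exact lists_roundD hT hiter

theorem lists_chaseD (hT : Represents Inclusion.enc dT (T : Set Inclusion)) {α : Type}
    (enc : α → Data) (q : List α) (hF : Lists Fact.enc F (· ∈ S)) :
    Lists Fact.enc (chaseD dT (encList enc q) F)
      (DerivesWithin T S (matchRounds T q.length)) := by
  have hquery := lists_iterate (T := T) (n := 0) (k := roundsToDepth T 1 + roundsToDepth T 1)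
    (f := fun F => saturateD dT (saturateD dT F))
    (fun n F h => by rw [← Nat.add_assoc]; exact lists_saturateD hT (lists_saturateD hT h)) hF
    (encList enc q).toList
  have hTBox := lists_iterate (f := saturateD dT) (fun n F h => lists_saturateD hT h) hquery
    dT.toList
  refine (lists_saturateD hT hTBox).congr fun φ => ?_
  rw [hT.length_toList, toList_encList, List.length_map, matchRounds]
  have hrounds : 0 + (roundsToDepth T 1 + roundsToDepth T 1) * q.length +
      roundsToDepth T 1 * T.card + roundsToDepth T 1 =
      roundsToDepth T (2 * q.length + T.card + 1) := by
    simp only [roundsToDepth]; ring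
  rw [hrounds]

end

/-! ### Feasibility of the chase -/

section

variable {κ : Data → ℕ} {f g h : Data → Data}

theorem Feasible.eq (hf : Feasible κ f) (hg : Feasible κ g) :
    Feasible κ fun x => Data.eq (f x) (g x) :=
  PolyTime.comp₂ (f := Data.eq) PolyTime.eq hf hg

theorem Feasible.matchRoleD (hf : Feasible κ f) (hg : Feasible κ g) :
    Feasible κ fun x => matchRoleD (f x) (g x) :=
  hg.hd.ite ((hg.tl.hd.eq hf.tl).ite (hf.hd.ite (hg.tl.tl.tl.node hg.tl.tl.hd) hg.tl.tl) .nil) .nil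

theorem Feasible.matchConceptD (hf : Feasible κ f) (hg : Feasible κ g) :
    Feasible κ fun x => matchConceptD (f x) (g x) :=
  hf.hd.ite (hf.tl.matchRoleD hg).hd (hg.hd.ite .nil ((hg.tl.hd.eq hf.tl).ite hg.tl.tl .nil))

theorem Feasible.roleAtomD (hf : Feasible κ f) (hg : Feasible κ g) (hh : Feasible κ h) :
    Feasible κ fun x => roleAtomD (f x) (g x) (h x) :=
  (Feasible.const _).node (hf.tl.node (hf.hd.ite (hh.node hg) (hg.node hh)))

theorem Feasible.conceptAtomD (hf : Feasible κ f) (hg : Feasible κ g) (hh : Feasible κ h) :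
    Feasible κ fun x => conceptAtomD (f x) (g x) (h x) :=
  hf.hd.ite (hf.tl.roleAtomD hg hh) (Feasible.nil.node (hf.tl.node hg))

theorem Feasible.childD (hf : Feasible κ f) (hg : Feasible κ g) :
    Feasible κ fun x => childD (f x) (g x) :=
  hg.hd.node (hf.node hg.tl)

theorem Feasible.applyD (hf : Feasible κ f) (hg : Feasible κ g) :
    Feasible κ fun x => applyD (f x) (g x) :=
  have hr := hf.tl.hd.matchRoleD hg
  have hc := hf.tl.hd.matchConceptD hg
  hf.hd.tl.ite .nil (hf.hd.hd.ite
    (hr.ite ((hf.tl.tl.roleAtomD hr.hd hr.tl).node .nil) .nil)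
    (hc.ite ((hf.tl.tl.conceptAtomD hc (hf.tl.tl.tl.childD hc)).node .nil) .nil))

theorem PolyTime.roundD : PolyTime fun z => roundD z.hd z.tl :=
  have happly : PolyTime fun z => Data.flatMap (fun i => CQE.applyD i z.hd) .nil z.tl.hd :=
    Feasible.flatMap (G := fun i z => CQE.applyD i z.hd) (Feasible.id.hd.applyD Feasible.id.tl.hd)
      .nil Feasible.id.tl.hd
  Feasible.flatMap (G := fun φ z => Data.flatMap (fun i => CQE.applyD i φ) .nil z.hd) happly
    Feasible.id.tl Feasible.id.tl

theorem Feasible.roundD (hf : Feasible κ f) (hg : Feasible κ g) :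
    Feasible κ fun x => roundD (f x) (g x) :=
  PolyTime.comp₂ (f := CQE.roundD) PolyTime.roundD hf hg

theorem feasible_saturateD : Feasible (fun z => z.hd.size) fun z => saturateD z.hd z.tl :=
  Feasible.id.hd.roundD <| Feasible.foldr_of_length_le (κ' := fun _ => 0) (L := fun z => z.hd)
    (B := fun _ F z => roundD z.hd (roundD z.hd F)) Feasible.id.hd Feasible.id.tl
    (Feasible.id.tl.tl.hd.roundD (Feasible.id.tl.tl.hd.roundD Feasible.id.tl.hd))
    (fun _ => ⟨0, fun _ _ _ _ _ => le_rfl⟩)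
    (fun K => ⟨K, fun x hx => x.hd.length_toList_le.trans hx⟩)

theorem Feasible.saturateD (hf : Feasible κ f) (hg : Feasible κ g)
    (hκ : ∀ x, (f x).size ≤ κ x) : Feasible κ fun x => saturateD (f x) (g x) :=
  feasible_saturateD.comp (f := fun x => .node (f x) (g x)) (hf.node hg)
    fun K => ⟨K, fun x hx => (hκ x).trans hx⟩

theorem Feasible.foldr_saturateD {L I : Data → Data} {B : Data → Data → Data}
    (hL : Feasible κ L) (hI : Feasible κ I) (hLκ : ∀ x, (L x).size ≤ κ x)
    (hTκ : ∀ x, x.hd.size ≤ κ x)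
    (hB : Feasible (fun z => z.tl.tl.hd.size) fun z => B z.tl.tl.hd z.tl.hd) :
    Feasible κ fun x => (L x).toList.foldr (fun _ F => B x.hd F) (I x) :=
  hL.foldr_of_length_le (B := fun _ F z => B z.hd F) hI hB
    (fun K => ⟨K, fun x hx _ _ _ => (hTκ x).trans hx⟩)
    (fun K => ⟨K, fun x hx => (L x).length_toList_le.trans ((hLκ x).trans hx)⟩)

theorem feasible_chaseD :
    Feasible (fun z => z.hd.size + z.tl.hd.size) fun z => chaseD z.hd z.tl.hd z.tl.tl :=
  have hsat : Feasible (fun z => z.tl.tl.hd.size) fun z => saturateD z.tl.tl.hd z.tl.hd :=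
    Feasible.id.tl.tl.hd.saturateD Feasible.id.tl.hd fun _ => le_rfl
  have hquery : Feasible (fun z => z.hd.size + z.tl.hd.size) fun z =>
      z.tl.hd.toList.foldr (fun _ F => saturateD z.hd (saturateD z.hd F)) z.tl.tl :=
    Feasible.id.tl.hd.foldr_saturateD (B := fun T F => saturateD T (saturateD T F))
      Feasible.id.tl.tl (fun _ => Nat.le_add_left _ _) (fun _ => Nat.le_add_right _ _)
      (Feasible.id.tl.tl.hd.saturateD hsat fun _ => le_rfl)
  Feasible.id.hd.saturateD (Feasible.id.hd.foldr_saturateD hquery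
    (fun _ => Nat.le_add_right _ _) (fun _ => Nat.le_add_right _ _) hsat)
    fun _ => Nat.le_add_right _ _

end

/-! ### Query evaluation on trees -/

/-- The arguments of the atoms in a list of query atoms or facts. -/
def argsD (q : Data) : Data :=
  Data.flatMap (fun α => Data.ite α.hd (.node α.tl.tl.hd (.node α.tl.tl.tl .nil))
    (.node α.tl.tl .nil)) .nil q

/-- All extensions of the assignments in `Θ` that map the additional term `t` to an entry of
`E`. -/
def extendD (t Θ E : Data) : Data :=
  Data.flatMap (fun θ => Data.flatMap (fun e => .node (.node (.node t e) θ) .nil) .nil E) .nil Θ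

/-- All assignments of entries of `E` to the entries of `ts`, as association lists. -/
def assignsD (ts E : Data) : Data :=
  ts.toList.foldr (fun t Θ => extendD t Θ E) (.node .nil .nil)

/-- The first value that the association list `θ` gives to the key `t`. -/
def lookupD (θ t : Data) : Data := Data.first (fun p => Data.eq p.hd t) (fun p => p.tl) .nil θ

/-- The value of the term `t` under the assignment `θ`; a constant stands for itself. -/
def valueD (θ t : Data) : Data := Data.ite t.hd (.node t.tl .nil) (lookupD θ t)

/-- The instance of the query atom `α` under the assignment `θ`. -/
def substD (θ α : Data) : Data :=
  .node α.hd (.node α.tl.hd (Data.ite α.hd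
    (.node (valueD θ α.tl.tl.hd) (valueD θ α.tl.tl.tl)) (valueD θ α.tl.tl)))

/-- The test whether `x` is an entry of `l`. -/
def memD (x l : Data) : Data := Data.first (fun e => Data.eq e x) (fun _ => Data.true) .nil l

/-- The test whether all atoms of `q` become entries of `F` under the assignment `θ`. -/
def holdsD (θ q F : Data) : Data :=
  Data.first (fun α => Data.ite (memD (substD θ α) F) .nil Data.true) (fun _ => .nil) Data.true q

/-- The test whether some assignment maps the query `q` into the facts `F`. -/
def matchD (q F : Data) : Data :=
  Data.first (fun θ => holdsD θ q F) (fun _ => Data.true) .nil (assignsD (argsD q) (argsD F))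

theorem argsD_query (q : List QueryAtom) :
    argsD (encList QueryAtom.enc q) = encList Term.enc (queryTerms q) := by
  rw [argsD, Data.flatMap, toList_encList, queryTerms]
  induction q with
  | nil => rfl
  | cons α q ih =>
    rw [List.map_cons, List.foldr_cons, ih, List.flatMap_cons]
    cases α <;> rfl

section

variable {F E θ : Data} {Q : Fact → Prop} {v : Name → Elem} {q : List QueryAtom}

theorem lists_argsD_fact (hF : Lists Fact.enc F Q) :
    Lists Elem.enc (argsD F) fun x => ∃ φ, Q φ ∧ x ∈ φ.elems := by
  refine (hF.flatMap (G := fun φ x => x ∈ φ.elems) (Lists.nil fun _ => not_false)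
    fun φ _ => ?_).congr fun x => by rw [or_false]
  cases φ with
  | concept A x => exact .of_list [x]
  | role P x y => exact .of_list [x, y]

/-- The encoding of assignments of chase elements to terms. -/
def encAssign : List (Term × Elem) → Data := encList fun p => .node p.1.enc (Elem.enc p.2)

theorem lists_assignsD (ts : List Term) {Q : Elem → Prop} (hE : Lists Elem.enc E Q) :
    Lists encAssign (assignsD (encList Term.enc ts) E) fun θ =>
      θ.map Prod.fst = ts ∧ ∀ p ∈ θ, Q p.2 := by
  rw [assignsD, toList_encList]
  induction ts with
  | nil =>
    refine (Lists.single (enc := encAssign) []).congr fun θ =>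
      ⟨?_, fun h => List.map_eq_nil_iff.1 h.1⟩
    rintro rfl
    exact ⟨rfl, fun _ h => absurd h List.not_mem_nil⟩
  | cons t ts ih =>
    refine (ih.flatMap (enc' := encAssign) (G := fun θ θ' => ∃ x, Q x ∧ θ' = (t, x) :: θ)
      (Lists.nil fun _ => not_false) fun θ _ => ?_).congr fun θ' => ?_
    · exact (hE.flatMap (enc' := encAssign) (G := fun x θ' => θ' = (t, x) :: θ)
        (Lists.nil fun _ => not_false)
        fun x _ => Lists.single (enc := encAssign) ((t, x) :: θ)).congr fun θ' => by rw [or_false]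
    · rw [or_false]
      constructor
      · rintro ⟨θ, ⟨hkeys, hvalues⟩, x, hx, rfl⟩
        exact ⟨by rw [List.map_cons, hkeys], List.forall_mem_cons.2 ⟨hx, hvalues⟩⟩
      · rintro ⟨hkeys, hvalues⟩
        obtain ⟨p, θ, rfl, rfl, hθ⟩ := List.map_eq_cons_iff.1 hkeys
        rw [List.forall_mem_cons] at hvalues
        exact ⟨θ, ⟨hθ, hvalues.2⟩, p.2, hvalues.1, rfl⟩

theorem exists_lookupD_eq (θ : List (Term × Elem)) {t : Term} (h : t ∈ θ.map Prod.fst) :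
    ∃ x, (t, x) ∈ θ ∧ lookupD (encAssign θ) t.enc = Elem.enc x := by
  induction θ with
  | nil => exact absurd h List.not_mem_nil
  | cons p θ ih =>
    have hcons : lookupD (encAssign (p :: θ)) t.enc =
        Data.ite (Data.eq p.1.enc t.enc) (Elem.enc p.2) (lookupD (encAssign θ) t.enc) := rfl
    rw [hcons]
    by_cases hp : p.1 = t
    · exact ⟨p.2, hp ▸ List.mem_cons_self, by rw [hp, Data.eq_self, Data.ite_node]⟩
    · rw [Data.eq_of_ne fun h' => hp (Term.enc_injective h'), Data.ite_nil]
      obtain ⟨x, hx, heq⟩ := ih ((List.mem_cons.1 h).resolve_left fun h' => hp h'.symm)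
      exact ⟨x, List.mem_cons_of_mem _ hx, heq⟩

theorem exists_valueD_eq_elem (θ : List (Term × Elem)) :
    ∃ v : Name → Elem, ∀ t ∈ θ.map Prod.fst, valueD (encAssign θ) t.enc = Elem.enc (t.elem v) := by
  have hvar : ∀ x : Name, ∃ y : Elem, Term.var x ∈ θ.map Prod.fst →
      lookupD (encAssign θ) (Term.var x).enc = Elem.enc y := fun x => by
    by_cases hx : Term.var x ∈ θ.map Prod.fst
    · obtain ⟨y, -, hy⟩ := exists_lookupD_eq θ hx
      exact ⟨y, fun _ => hy⟩
    · exact ⟨([], []), fun h => absurd h hx⟩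
  choose v hv using hvar
  refine ⟨v, fun t ht => ?_⟩
  cases t with
  | var x => exact hv x ht
  | const c => rfl

theorem valueD_map_elem {ts : List Term} (v : Name → Elem) {t : Term} (ht : t ∈ ts) :
    valueD (encAssign (ts.map fun t => (t, t.elem v))) t.enc = Elem.enc (t.elem v) := by
  cases t with
  | const c => rfl
  | var x =>
    obtain ⟨y, hy, heq⟩ := exists_lookupD_eq (ts.map fun t => (t, t.elem v)) (t := .var x)
      (by rwa [List.map_map, Function.comp_def, List.map_id'])
    obtain ⟨t, -, htx⟩ := List.mem_map.1 hy
    obtain ⟨rfl, rfl⟩ := Prod.mk.inj htx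
    exact heq

theorem substD_enc {α : QueryAtom}
    (h : ∀ t ∈ α.terms, valueD θ t.enc = Elem.enc (t.elem v)) :
    substD θ α.enc = (α.fact v).enc := by
  cases α with
  | concept A t =>
    simp [substD, QueryAtom.enc, encBool, QueryAtom.fact, Fact.enc, h t (by simp [QueryAtom.terms])]
  | role P t u =>
    simp [substD, QueryAtom.enc, encBool, QueryAtom.fact, Fact.enc,
      h t (by simp [QueryAtom.terms]), h u (by simp [QueryAtom.terms])]

theorem memD_ne_nil (hF : Lists Fact.enc F Q) (φ : Fact) : memD φ.enc F ≠ .nil ↔ Q φ := by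
  rw [memD, Data.first_true_ne_nil]
  constructor
  · rintro ⟨e, he, hne⟩
    obtain ⟨ψ, hψ, rfl⟩ := (hF.toList e).1 he
    by_contra hφ
    exact hne (Data.eq_of_ne fun h => hφ (Fact.enc_injective h ▸ hψ))
  · intro hφ
    exact ⟨_, (hF.toList _).2 ⟨φ, hφ, rfl⟩, by simp [Data.eq_self]⟩

theorem holdsD_ne_nil (hF : Lists Fact.enc F Q)
    (hθ : ∀ t ∈ queryTerms q, valueD θ t.enc = Elem.enc (t.elem v)) :
    holdsD θ (encList QueryAtom.enc q) F ≠ .nil ↔ ∀ α ∈ q, Q (α.fact v) := by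
  rw [holdsD, Data.first_nil_ne_nil, toList_encList, List.forall_mem_map]
  refine forall₂_congr fun α hα => ?_
  rw [substD_enc fun t ht => hθ t (List.mem_flatMap.2 ⟨α, hα, ht⟩), ← memD_ne_nil hF]
  cases memD (α.fact v).enc F <;> simp [Data.true]

theorem matchD_ne_nil (hF : Lists Fact.enc F Q) (q : List QueryAtom) :
    matchD (encList QueryAtom.enc q) F ≠ .nil ↔ ∃ v : Name → Elem, ∀ α ∈ q, Q (α.fact v) := by
  have hassigns := lists_assignsD (queryTerms q) (lists_argsD_fact hF)
  rw [matchD, Data.first_true_ne_nil, argsD_query]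
  constructor
  · rintro ⟨e, he, hne⟩
    obtain ⟨θ, ⟨hkeys, -⟩, rfl⟩ := (hassigns.toList e).1 he
    obtain ⟨v, hv⟩ := exists_valueD_eq_elem θ
    exact ⟨v, (holdsD_ne_nil hF (hkeys ▸ hv)).1 hne⟩
  · rintro ⟨v, hv⟩
    refine ⟨_, (hassigns.toList _).2 ⟨(queryTerms q).map fun t => (t, t.elem v), ⟨?_, ?_⟩, rfl⟩,
      (holdsD_ne_nil hF fun t ht => valueD_map_elem v ht).2 hv⟩
    · rw [List.map_map, Function.comp_def, List.map_id']
    · rw [List.forall_mem_map]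
      intro t ht
      obtain ⟨α, hα, htα⟩ := List.mem_flatMap.1 ht
      exact ⟨_, hv α hα, QueryAtom.elems_fact v α ▸ List.mem_map_of_mem htα⟩

end

section

variable {κ : Data → ℕ} {f g : Data → Data}

theorem PolyTime.exists_size_le_pow (hf : PolyTime f) :
    ∃ k, ∀ x, (f x).size ≤ (x.size + 2) ^ k := by
  obtain ⟨k, hk⟩ := hf.polyBounded_size 0
  exact ⟨k, fun x => hk x le_rfl⟩

theorem PolyTime.argsD : PolyTime argsD :=
  Feasible.flatMap (G := fun α _ => Data.ite α.hd (.node α.tl.tl.hd (.node α.tl.tl.tl .nil))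
    (.node α.tl.tl .nil)) (Feasible.id.hd.hd.ite
      (Feasible.id.hd.tl.tl.hd.node (Feasible.id.hd.tl.tl.tl.node .nil))
      (Feasible.id.hd.tl.tl.node .nil)) .nil Feasible.id

theorem PolyTime.extendD : PolyTime fun z => extendD z.hd z.tl.hd z.tl.tl :=
  have hinner : PolyTime fun z => Data.flatMap
      (fun e => .node (.node (.node z.tl.hd e) z.hd) .nil) .nil z.tl.tl.tl :=
    Feasible.flatMap (G := fun e z => .node (.node (.node z.tl.hd e) z.hd) .nil)
      (((Feasible.id.tl.tl.hd.node Feasible.id.hd).node Feasible.id.tl.hd).node .nil) .nil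
      Feasible.id.tl.tl.tl
  Feasible.flatMap (G := fun θ z => Data.flatMap
    (fun e => .node (.node (.node z.hd e) θ) .nil) .nil z.tl.tl) hinner .nil Feasible.id.tl.hd

theorem feasible_assignsD : Feasible (fun z => z.hd.size) fun z => assignsD z.hd z.tl :=
  Feasible.foldr_of_length_le (κ' := fun _ => 0) (L := fun z => z.hd)
    (B := fun t Θ z => CQE.extendD t Θ z.tl) Feasible.id.hd (.const _)
    (PolyTime.comp₃ (f := CQE.extendD) .extendD Feasible.id.hd Feasible.id.tl.hd
      Feasible.id.tl.tl.tl)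
    (fun _ => ⟨0, fun _ _ _ _ _ => le_rfl⟩)
    (fun K => ⟨K, fun x hx => x.hd.length_toList_le.trans hx⟩)

theorem PolyTime.lookupD : PolyTime fun z => lookupD z.hd z.tl :=
  PolyTime.first (C := fun p z => Data.eq p.hd z.tl) (G := fun p _ => p.tl)
    (Feasible.id.hd.hd.eq Feasible.id.tl.tl) Feasible.id.hd.tl .nil Feasible.id.hd

theorem Feasible.valueD (hf : Feasible κ f) (hg : Feasible κ g) :
    Feasible κ fun x => valueD (f x) (g x) :=
  hg.hd.ite (hg.tl.node .nil) (PolyTime.comp₂ (f := CQE.lookupD) .lookupD hf hg)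

theorem Feasible.substD (hf : Feasible κ f) (hg : Feasible κ g) :
    Feasible κ fun x => substD (f x) (g x) :=
  hg.hd.node (hg.tl.hd.node (hg.hd.ite ((hf.valueD hg.tl.tl.hd).node (hf.valueD hg.tl.tl.tl))
    (hf.valueD hg.tl.tl)))

theorem PolyTime.memD : PolyTime fun z => memD z.hd z.tl :=
  PolyTime.first (C := fun e z => Data.eq e z.hd) (G := fun _ _ => Data.true)
    (Feasible.id.hd.eq Feasible.id.tl.hd) (.const _) .nil Feasible.id.tl

theorem PolyTime.holdsD : PolyTime fun z => holdsD z.hd z.tl.hd z.tl.tl :=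
  have hmem : PolyTime fun z => CQE.memD (CQE.substD z.tl.hd z.hd) z.tl.tl.tl :=
    PolyTime.comp₂ (f := CQE.memD) .memD (Feasible.id.tl.hd.substD Feasible.id.hd)
      Feasible.id.tl.tl.tl
  PolyTime.first (C := fun α z => Data.ite (CQE.memD (CQE.substD z.hd α) z.tl.tl) .nil Data.true)
    (G := fun _ _ => .nil) (hmem.ite .nil (.const _)) .nil (.const _) Feasible.id.tl.hd

theorem feasible_matchD : Feasible (fun z => z.hd.size) fun z => matchD z.hd z.tl := by
  have hholds : PolyTime fun z => CQE.holdsD z.hd z.tl.hd z.tl.tl :=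
    .comp₃ (f := CQE.holdsD) .holdsD Feasible.id.hd Feasible.id.tl.hd Feasible.id.tl.tl
  refine PolyTime.first (C := fun θ z => CQE.holdsD θ z.hd z.tl) (G := fun _ _ => Data.true)
    hholds (.const _) .nil ?_
  obtain ⟨k, hk⟩ := PolyTime.argsD.exists_size_le_pow
  exact feasible_assignsD.comp (f := fun z => .node (CQE.argsD z.hd) (CQE.argsD z.tl))
    ((PolyTime.comp₁ .argsD Feasible.id.hd).node (PolyTime.comp₁ .argsD Feasible.id.tl))
    fun K => ⟨(K + 2) ^ k, fun x hx => (hk _).trans (Nat.pow_le_pow_left (by lia) _)⟩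

end

/-! ### The consistency test -/

/-- The queries that a negative inclusion forbids; compare `Inclusion.negQueries`. -/
def negQueriesD (i : Data) : Data :=
  let x := (Term.var []).enc
  let y := (Term.var [false]).enc
  let z := (Term.var [true]).enc
  Data.ite i.hd.tl (.node (Data.ite i.hd.hd
    (.node (roleAtomD i.tl.hd x y) (.node (roleAtomD i.tl.tl x y) .nil))
    (.node (conceptAtomD i.tl.hd x y) (.node (conceptAtomD i.tl.tl x z) .nil))) .nil) .nil

/-- The queries forbidden by the TBox `T` and the policy `P`; a denial is encoded by its query. -/
def forbiddenQueriesD (T P : Data) : Data := Data.flatMap negQueriesD P T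

/-- The ground atom `α` as a fact. -/
def groundFactD (α : Data) : Data :=
  Data.ite α.hd.hd
    (.node Data.true (.node α.tl.hd (.node (.node α.tl.tl.hd .nil) (.node α.tl.tl.tl.hd .nil))))
    (.node .nil (.node α.tl.hd (.node α.tl.tl.hd .nil)))

/-- The ground atoms `S` as facts. -/
def groundFactsD (S : Data) : Data := Data.flatMap (fun α => .node (groundFactD α) .nil) .nil S

/-- The test whether the query `q` has a match in the chase of the ground atoms `S`. -/
def matchesD (T q S : Data) : Data := matchD q (chaseD T q (groundFactsD S))

/-- The consistency test on an input `(T . (P . S))`. -/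
def consistentD (x : Data) : Data :=
  Data.first (fun q => matchesD x.hd q x.tl.tl) (fun _ => .nil) Data.true
    (forbiddenQueriesD x.hd x.tl.hd)

theorem roleAtomD_atom (R : Role) (t u : Term) :
    roleAtomD R.enc t.enc u.enc = (R.atom t u).enc := by
  cases R <;> rfl

theorem conceptAtomD_atom (B : Concept) (t u : Term) :
    conceptAtomD B.enc t.enc u.enc = (B.atom t u).enc := by
  cases B with
  | atomic A => rfl
  | ex R => exact roleAtomD_atom R t u

theorem negQueriesD_enc (i : Inclusion) :
    negQueriesD i.enc = encList (encList QueryAtom.enc) i.negQueries := by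
  cases i with
  | conceptIncl | roleIncl => rfl
  | conceptDisj B C =>
    simp [negQueriesD, Inclusion.enc, Inclusion.negQueries, encBool, encList, conceptAtomD_atom]
  | roleDisj R Q =>
    simp [negQueriesD, Inclusion.enc, Inclusion.negQueries, encBool, encList, roleAtomD_atom]

theorem groundFactD_enc (α : GroundAtom) : groundFactD α.enc = α.fact.enc := by
  cases α <;> rfl

theorem encList_map {α β : Type} (enc : β → Data) (f : α → β) (l : List α) :
    encList enc (l.map f) = encList (fun a => enc (f a)) l := by
  induction l with
  | nil => rfl
  | cons a l ih => rw [List.map_cons, encList, encList, ih]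

section

variable {T : TBox} {P : Policy} {S : Set GroundAtom} {dT dP dS : Data}

theorem lists_forbiddenQueriesD (hT : Represents Inclusion.enc dT (T : Set Inclusion))
    (hP : Represents Denial.enc dP (P : Set Denial)) :
    Lists (encList QueryAtom.enc) (forbiddenQueriesD dT dP) (· ∈ forbiddenQueries T P) := by
  obtain ⟨lP, -, hlP, rfl⟩ := hP
  have hbodies : Lists (encList QueryAtom.enc) (encList Denial.enc lP)
      fun q => ∃ δ ∈ P, q = δ.body.atoms :=
    ⟨_, (encList_map (encList QueryAtom.enc) (fun δ : Denial => δ.body.atoms) lP).symm, fun q => by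
      simp only [List.mem_map, hlP, Finset.mem_coe, eq_comm]⟩
  exact hT.lists.flatMap (G := fun i q => q ∈ i.negQueries) hbodies fun i _ =>
    ⟨i.negQueries, negQueriesD_enc i, fun _ => Iff.rfl⟩

theorem lists_groundFactsD (hS : Lists GroundAtom.enc dS (· ∈ S)) :
    Lists Fact.enc (groundFactsD dS) (· ∈ GroundAtom.fact '' S) := by
  refine (hS.flatMap (G := fun α φ => φ = α.fact) (Lists.nil fun _ => not_false)
    fun α _ => ?_).congr fun φ => ?_
  · rw [groundFactD_enc]
    exact Lists.single _
  · simp only [or_false, Set.mem_image, eq_comm]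

theorem matchesD_ne_nil (hT : Represents Inclusion.enc dT (T : Set Inclusion))
    (hS : Lists GroundAtom.enc dS (· ∈ S)) (q : List QueryAtom) :
    matchesD dT (encList QueryAtom.enc q) dS ≠ .nil ↔ Matches T (GroundAtom.fact '' S) q :=
  matchD_ne_nil (lists_chaseD hT QueryAtom.enc q (lists_groundFactsD hS)) q

theorem consistentD_ne_nil (hT : Represents Inclusion.enc dT (T : Set Inclusion))
    (hP : Represents Denial.enc dP (P : Set Denial)) (hS : Lists GroundAtom.enc dS (· ∈ S)) :
    consistentD (.node dT (.node dP dS)) ≠ .nil ↔ Consistent T P S := by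
  rw [consistentD, Data.first_nil_ne_nil, consistent_iff]
  simp only [Data.hd_node, Data.tl_node, (lists_forbiddenQueriesD hT hP).toList]
  constructor
  · intro h q hq hmatch
    exact (matchesD_ne_nil hT hS q).2 hmatch (h _ ⟨q, hq, rfl⟩)
  · rintro h _ ⟨q, hq, rfl⟩
    exact not_not.1 fun hne => h q hq ((matchesD_ne_nil hT hS q).1 hne)

end

section

variable {κ : Data → ℕ} {f : Data → Data}

theorem PolyTime.negQueriesD : PolyTime negQueriesD :=
  have hi : PolyTime fun i => i := Feasible.id
  hi.hd.tl.ite ((hi.hd.hd.ite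
    ((hi.tl.hd.roleAtomD (.const _) (.const _)).node
      ((hi.tl.tl.roleAtomD (.const _) (.const _)).node .nil))
    ((hi.tl.hd.conceptAtomD (.const _) (.const _)).node
      ((hi.tl.tl.conceptAtomD (.const _) (.const _)).node .nil))).node .nil) .nil

theorem PolyTime.forbiddenQueriesD : PolyTime fun z => forbiddenQueriesD z.hd z.tl :=
  Feasible.flatMap (G := fun i _ => CQE.negQueriesD i)
    (PolyTime.comp₁ .negQueriesD Feasible.id.hd) Feasible.id.tl Feasible.id.hd

theorem Feasible.groundFactD (hf : Feasible κ f) : Feasible κ fun x => groundFactD (f x) :=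
  hf.hd.hd.ite
    ((Feasible.const _).node (hf.tl.hd.node ((hf.tl.tl.hd.node .nil).node
      (hf.tl.tl.tl.hd.node .nil))))
    (Feasible.nil.node (hf.tl.hd.node (hf.tl.tl.hd.node .nil)))

theorem PolyTime.groundFactsD : PolyTime groundFactsD :=
  Feasible.flatMap (G := fun α _ => .node (CQE.groundFactD α) .nil)
    (Feasible.id.hd.groundFactD.node .nil) .nil Feasible.id

theorem feasible_matchesD :
    Feasible (fun z => z.hd.size + z.tl.hd.size) fun z => matchesD z.tl.hd z.hd z.tl.tl.tl :=
  have hchase : Feasible (fun z => z.hd.size + z.tl.hd.size) fun z =>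
      chaseD z.tl.hd z.hd (groundFactsD z.tl.tl.tl) :=
    feasible_chaseD.comp (f := fun z => .node z.tl.hd (.node z.hd (groundFactsD z.tl.tl.tl)))
      (Feasible.id.tl.hd.node (Feasible.id.hd.node
        (PolyTime.comp₁ .groundFactsD Feasible.id.tl.tl.tl)))
      fun K => ⟨K, fun _ hx => (Nat.add_comm _ _).trans_le hx⟩
  feasible_matchD.comp
    (f := fun z => .node z.hd (chaseD z.tl.hd z.hd (groundFactsD z.tl.tl.tl)))
    (Feasible.id.hd.node hchase) fun K => ⟨K, fun _ hx => (Nat.le_add_right _ _).trans hx⟩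

theorem feasible_consistentD :
    Feasible (fun z => z.hd.size + z.tl.hd.size) consistentD := by
  refine Feasible.first (κ' := fun z => z.hd.size + z.tl.hd.size)
    (C := fun q x => matchesD x.hd q x.tl.tl) (G := fun _ _ => .nil) feasible_matchesD .nil
    (.const _) (PolyTime.comp₂ .forbiddenQueriesD Feasible.id.hd Feasible.id.tl.hd) fun K => ?_
  obtain ⟨k, hk⟩ := PolyTime.forbiddenQueriesD.exists_size_le_pow
  refine ⟨(K + 3) ^ k + K, fun x hx e he => Nat.add_le_add ?_ ((Nat.le_add_right _ _).trans hx)⟩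
  calc e.size ≤ ((Data.node x.hd x.tl.hd).size + 2) ^ k :=
        (Data.size_le_of_mem he).trans (hk (.node x.hd x.tl.hd))
    _ ≤ (K + 3) ^ k := Nat.pow_le_pow_left (by rw [Data.size_node]; lia) k

end

/-! ### The sorted list of the entailed ground atoms -/

/-- Whether `x` comes before `y` in the lexicographic order on trees. -/
def Data.lt (x y : Data) : Data :=
  Data.ite (x.cmp y) (Data.ite (x.cmp y).hd .nil Data.true) .nil

/-- The entries of a list that satisfy `c`. -/
def Data.filter (c : Data → Data) (d : Data) : Data :=
  Data.flatMap (fun e => Data.ite (c e) (.node e .nil) .nil) .nil d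

/-- Insertion of `a` into a sorted list without repetitions, to which `a` may already belong. -/
def insertD (a l : Data) : Data :=
  (Data.filter (Data.lt · a) l).append (.node a (Data.filter (Data.lt a ·) l))

/-- The entries of a list in increasing order, without repetitions. -/
def sortD (l : Data) : Data := l.toList.foldr insertD .nil

/-- The list of the ground atom that the fact `φ` is, or the empty list if `φ` involves a Skolem
term. -/
def groundAtomD (φ : Data) : Data :=
  Data.ite φ.hd
    (Data.ite φ.tl.tl.hd.tl .nil (Data.ite φ.tl.tl.tl.tl .nil
      (.node (.node (encName [true]) (.node φ.tl.hd
        (.node φ.tl.tl.hd.hd (.node φ.tl.tl.tl.hd .nil)))) .nil)))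
    (Data.ite φ.tl.tl.tl .nil
      (.node (.node (encName [false]) (.node φ.tl.hd (.node φ.tl.tl.hd .nil))) .nil))

/-- The sorted list of the entailed ground atoms, on an input `(T . A)`. -/
def closureD (x : Data) : Data :=
  sortD (Data.flatMap groundAtomD .nil (saturateD x.hd (groundFactsD x.tl)))

theorem Data.lt_node {a b c d : Data} :
    Data.lt (.node a b) (.node c d) ≠ .nil ↔ a.lt c ≠ .nil ∨ a = c ∧ b.lt d ≠ .nil := by
  simp only [lt, cmp, ← cmp_eq_nil_iff a c]
  cases a.cmp c <;> simp

theorem Data.lt_asymm {x y : Data} (h : x.lt y ≠ .nil) : y.lt x = .nil := by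
  induction x generalizing y with
  | nil => cases y <;> rfl
  | node a b iha ihb =>
    cases y with
    | nil => exact absurd rfl h
    | node c d =>
      by_contra hdc
      rcases lt_node.1 h with hac | ⟨rfl, hbd⟩ <;> rcases lt_node.1 hdc with hca | ⟨hca, hdb⟩
      · exact hca (iha hac)
      · exact hac (hca ▸ iha hac)
      · exact hca (iha hca)
      · exact hdb (ihb hbd)

theorem filter_encList {α : Type} {enc : α → Data} {c : Data → Data} {p : α → Bool}
    (h : ∀ a, c (enc a) ≠ .nil ↔ p a) (l : List α) :
    Data.filter c (encList enc l) = encList enc (l.filter p) := by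
  rw [Data.filter, Data.flatMap, toList_encList, List.foldr_map]
  induction l with
  | nil => rfl
  | cons a l ih =>
    rw [List.foldr_cons, ih]
    cases hc : c (enc a) with
    | nil => rw [List.filter_cons_of_neg fun ha => (h a).2 ha hc]; rfl
    | node => rw [List.filter_cons_of_pos ((h a).1 (by simp [hc]))]; rfl

theorem size_filter_add_size_filter_le {c c' : Data → Data}
    (h : ∀ e, c e ≠ .nil → c' e = .nil) (l : Data) :
    (Data.filter c l).size + (Data.filter c' l).size ≤ l.size := by
  induction l with
  | nil => exact le_rfl
  | node e l _ ih =>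
    have hfilter : ∀ c : Data → Data, Data.filter c (.node e l) =
        Data.ite (c e) (.node e (Data.filter c l)) (Data.filter c l) := fun c => by
      simp only [Data.filter, Data.flatMap, Data.toList_node, List.foldr_cons]
      cases c e <;> rfl
    have he := h e
    rw [hfilter c, hfilter c']
    cases hc : c e with
    | nil => cases c' e <;> simp only [Data.ite_nil, Data.ite_node, Data.size_node] <;> lia
    | node =>
      rw [he (by simp [hc]), Data.ite_nil, Data.ite_node, Data.size_node, Data.size_node]
      lia

/-- The order of trees agrees with the order `<` under the encoding. -/
def ReflectsLT {α : Type} [LT α] (enc : α → Data) : Prop :=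
  ∀ a b, (enc a).lt (enc b) ≠ .nil ↔ a < b

theorem reflectsLT_encBool : ReflectsLT encBool := by
  intro a b; cases a <;> cases b <;> simp [encBool, Data.lt, Data.cmp, Data.true]

theorem ReflectsLT.encList {α : Type} [LT α] {enc : α → Data} (h : ReflectsLT enc)
    (hinj : Function.Injective enc) : ReflectsLT (encList enc) := by
  intro l
  induction l with
  | nil => intro m; cases m <;> simp [CQE.encList, Data.lt, Data.cmp, Data.true]
  | cons a l ih =>
    intro m
    cases m with
    | nil => simp [CQE.encList, Data.lt, Data.cmp]
    | cons b m =>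
      rw [CQE.encList, CQE.encList, Data.lt_node, h, ih, hinj.eq_iff, List.cons_lt_cons_iff]

theorem GroundAtom.lt_enc_ne_nil {α β : GroundAtom} : α.enc.lt β.enc ≠ .nil ↔ α.LexLT β :=
  (reflectsLT_encBool.encList encBool_injective).encList encName_injective _ _

theorem GroundAtom.key_injective : Function.Injective GroundAtom.key := by
  intro α β; cases α <;> cases β <;> simp [key]

theorem GroundAtom.lexLT_trichotomy (α β : GroundAtom) : α.LexLT β ∨ α = β ∨ β.LexLT α := by
  rw [← key_injective.eq_iff]
  exact lt_trichotomy α.key β.key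

theorem exists_sorted_insertD (α : GroundAtom) {l : List GroundAtom}
    (hl : l.Pairwise GroundAtom.LexLT) : ∃ m : List GroundAtom, m.Pairwise GroundAtom.LexLT ∧
      (∀ β, β ∈ m ↔ β = α ∨ β ∈ l) ∧
      insertD α.enc (encList GroundAtom.enc l) = encList GroundAtom.enc m := by
  classical
  refine ⟨l.filter (·.LexLT α) ++ α :: l.filter (α.LexLT ·), ?_, fun β => ?_, ?_⟩
  · simp only [List.pairwise_append, List.pairwise_cons, List.mem_cons, List.mem_filter,
      decide_eq_true_eq]
    refine ⟨hl.filter _, ⟨fun β hβ => hβ.2, hl.filter _⟩, ?_⟩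
    rintro β ⟨-, hβ⟩ γ (rfl | ⟨-, hγ⟩)
    · exact hβ
    · exact lt_trans (a := β.key) hβ hγ
  · have := β.lexLT_trichotomy α
    simp only [List.mem_append, List.mem_cons, List.mem_filter, decide_eq_true_eq]
    tauto
  · rw [insertD, ← append_encList, encList, filter_encList (p := (·.LexLT α)),
      filter_encList (p := (α.LexLT ·))]
    all_goals exact fun β => GroundAtom.lt_enc_ne_nil.trans decide_eq_true_iff.symm

theorem exists_sorted_sortD {d : Data} {Q : GroundAtom → Prop} (h : Lists GroundAtom.enc d Q) :
    ∃ l : List GroundAtom, l.Pairwise GroundAtom.LexLT ∧ (∀ α, α ∈ l ↔ Q α) ∧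
      sortD d = encList GroundAtom.enc l := by
  obtain ⟨k, rfl, hk⟩ := h
  simp only [← hk, sortD, toList_encList]
  clear hk
  induction k with
  | nil => exact ⟨[], .nil, fun _ => Iff.rfl, rfl⟩
  | cons α k ih =>
    obtain ⟨l, hl, hmem, hsort⟩ := ih
    obtain ⟨m, hm, hmem', hinsert⟩ := exists_sorted_insertD α hl
    exact ⟨m, hm, fun β => by rw [hmem', hmem, List.mem_cons],
      by rw [List.map_cons, List.foldr_cons, hsort, hinsert]⟩

theorem lists_groundAtomD (φ : Fact) :
    Lists GroundAtom.enc (groundAtomD φ.enc) fun α => φ = α.fact := by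
  rcases φ with ⟨A, a, _ | ⟨R, w⟩⟩ | ⟨P, ⟨a, _ | ⟨R, w⟩⟩, b, _ | ⟨Q, u⟩⟩
  · exact (Lists.single (enc := GroundAtom.enc) (.concept A a)).congr fun α => by
      cases α <;> simp [GroundAtom.fact, eq_comm]
  · exact Lists.nil fun α => by cases α <;> simp [GroundAtom.fact]
  · exact (Lists.single (enc := GroundAtom.enc) (.role P a b)).congr fun α => by
      cases α <;> simp [GroundAtom.fact, eq_comm]
  all_goals exact Lists.nil fun α => by cases α <;> simp [GroundAtom.fact]

theorem exists_sorted_closureD {T : TBox} {A : ABoxFor T} {dT dA : Data}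
    (hT : Represents Inclusion.enc dT (T : Set Inclusion))
    (hA : Represents GroundAtom.enc dA (A.atoms : Set GroundAtom)) :
    ∃ l : List GroundAtom, l.Pairwise GroundAtom.LexLT ∧ (∀ α, α ∈ l ↔ α ∈ closureGA T A) ∧
      closureD (.node dT dA) = encList GroundAtom.enc l := by
  have hsat := lists_saturateD (n := 0) hT (lists_groundFactsD hA.lists)
  refine exists_sorted_sortD ((hsat.flatMap (Lists.nil fun _ => not_false)
    fun φ _ => lists_groundAtomD φ).congr fun α => ?_)
  rw [mem_closureGA_iff, Nat.zero_add]
  simp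

section

variable {κ : Data → ℕ} {f g : Data → Data}

theorem Feasible.lt (hf : Feasible κ f) (hg : Feasible κ g) :
    Feasible κ fun x => (f x).lt (g x) :=
  have hcmp : Feasible κ fun x => (f x).cmp (g x) := PolyTime.comp₂ .cmp hf hg
  hcmp.ite (hcmp.hd.ite .nil (.const _)) .nil

theorem Feasible.filter {C : Data → Data → Data} (hC : PolyTime fun z => C z.hd z.tl)
    (hf : Feasible κ f) : Feasible κ fun x => Data.filter (fun e => C e x) (f x) :=
  Feasible.flatMap (G := fun e x => Data.ite (C e x) (.node e .nil) .nil)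
    (hC.ite (Feasible.id.hd.node .nil) .nil) .nil hf

theorem PolyTime.insertD : PolyTime fun z => insertD z.hd z.tl :=
  PolyTime.comp₂ (f := Data.append) .append
    (Feasible.filter (C := fun e z => e.lt z.hd) (Feasible.id.hd.lt Feasible.id.tl.hd)
      Feasible.id.tl)
    (Feasible.id.hd.node (Feasible.filter (C := fun e z => z.hd.lt e)
      (Feasible.id.tl.hd.lt Feasible.id.hd) Feasible.id.tl))

theorem size_insertD_le (a l : Data) : (insertD a l).size ≤ l.size + (Data.node a .nil).size := by
  have happend := Data.size_append_le (Data.filter (Data.lt · a) l)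
    (.node a (Data.filter (Data.lt a ·) l))
  have hfilter := size_filter_add_size_filter_le (fun e => Data.lt_asymm (x := e) (y := a)) l
  simp only [Data.size_node, Data.size_nil, insertD] at happend ⊢
  lia

theorem PolyTime.sortD : PolyTime sortD :=
  Feasible.foldr_of_additive (κ' := fun _ => 0) (L := fun x => x)
    (B := fun e acc _ => CQE.insertD e acc) (G := fun e _ => .node e .nil) Feasible.id .nil
    (PolyTime.comp₂ .insertD Feasible.id.hd Feasible.id.tl.hd)
    (fun _ => ⟨0, fun _ _ _ _ _ => le_rfl⟩) (Feasible.id.hd.node .nil)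
    (fun e acc _ => size_insertD_le e acc)

theorem Feasible.groundAtomD (hf : Feasible κ f) : Feasible κ fun x => groundAtomD (f x) :=
  hf.hd.ite
    (hf.tl.tl.hd.tl.ite .nil (hf.tl.tl.tl.tl.ite .nil
      (((Feasible.const _).node (hf.tl.hd.node
        (hf.tl.tl.hd.hd.node (hf.tl.tl.tl.hd.node .nil)))).node .nil)))
    (hf.tl.tl.tl.ite .nil
      (((Feasible.const _).node (hf.tl.hd.node (hf.tl.tl.hd.node .nil))).node .nil))

theorem feasible_closureD : Feasible (fun z => z.hd.size) closureD :=
  have hsat : Feasible (fun z => z.hd.size) fun z => saturateD z.hd (groundFactsD z.tl) :=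
    Feasible.id.hd.saturateD (PolyTime.comp₁ .groundFactsD Feasible.id.tl) fun _ => le_rfl
  PolyTime.comp₁ (f := sortD) .sortD (Feasible.flatMap (G := fun φ _ => groundAtomD φ)
    Feasible.id.hd.groundAtomD .nil hsat)

end

/-! ### The greedy censor -/

open Classical in
/-- Adds the atom `α` to `Th` if this preserves consistency. -/
noncomputable def addIfConsistent (T : TBox) (P : Policy) (Th : List GroundAtom)
    (α : GroundAtom) : List GroundAtom :=
  if Consistent T P {β | β ∈ α :: Th} then α :: Th else Th

/-- Adds the atoms of the list `l` to `Th`, one at a time, as long as consistency is preserved. -/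
noncomputable def greedy (T : TBox) (P : Policy) (Th l : List GroundAtom) : List GroundAtom :=
  l.foldl (addIfConsistent T P) Th

section

variable {T : TBox} {P : Policy}

theorem Consistent.mono {S S' : Set GroundAtom} (h : Consistent T P S') (hS : S ⊆ S') :
    Consistent T P S :=
  let ⟨I, hT, hP, hS'⟩ := h
  ⟨I, hT, hP, fun α hα => hS' α (hS hα)⟩

theorem greedy_cons (Th : List GroundAtom) (α : GroundAtom) (l : List GroundAtom) :
    greedy T P Th (α :: l) = greedy T P (addIfConsistent T P Th α) l := rfl

theorem subset_addIfConsistent (Th : List GroundAtom) (α : GroundAtom) :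
    Th ⊆ addIfConsistent T P Th α := by
  rw [addIfConsistent]
  split_ifs
  exacts [List.subset_cons_self α Th, List.Subset.refl Th]

theorem subset_greedy (Th l : List GroundAtom) : Th ⊆ greedy T P Th l := by
  induction l generalizing Th with
  | nil => exact List.Subset.refl Th
  | cons α l ih => exact List.Subset.trans (subset_addIfConsistent Th α) (ih _)

theorem greedy_subperm (Th l : List GroundAtom) : (greedy T P Th l).Subperm (l ++ Th) := by
  induction l generalizing Th with
  | nil => exact List.Subperm.refl Th
  | cons α l ih =>
    rw [greedy_cons, addIfConsistent]
    split_ifs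
    · exact (ih _).trans List.perm_middle.subperm
    · exact (ih _).trans (List.sublist_cons_self _ _).subperm

theorem consistent_greedy {Th : List GroundAtom} (h : Consistent T P {β | β ∈ Th})
    (l : List GroundAtom) : Consistent T P {β | β ∈ greedy T P Th l} := by
  induction l generalizing Th with
  | nil => exact h
  | cons α l ih =>
    rw [greedy_cons, addIfConsistent]
    split_ifs with hα
    exacts [ih hα, ih h]

theorem mem_greedy_of_consistent {Th l : List GroundAtom} {α : GroundAtom} (hα : α ∈ l)
    (h : Consistent T P (insert α {β | β ∈ greedy T P Th l})) : α ∈ greedy T P Th l := by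
  induction l generalizing Th with
  | nil => exact absurd hα List.not_mem_nil
  | cons γ l ih =>
    rcases List.mem_cons.1 hα with rfl | hα
    · have hadd : Consistent T P {β | β ∈ α :: Th} := h.mono fun β hβ =>
        (List.mem_cons.1 hβ).imp_right fun hβ => subset_greedy Th (α :: l) hβ
      rw [greedy_cons, addIfConsistent, if_pos hadd]
      exact subset_greedy _ _ List.mem_cons_self
    · exact ih hα h

theorem exists_represents {α : Type} (enc : α → Data) (s : Finset α) :
    ∃ d, Represents enc d (s : Set α) :=
  ⟨_, s.toList, s.nodup_toList, fun _ => Finset.mem_toList, rfl⟩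

theorem exists_sorted_closureGA (A : ABoxFor T) : ∃ l : List GroundAtom,
    l.Pairwise GroundAtom.LexLT ∧ ∀ α, α ∈ l ↔ α ∈ closureGA T A := by
  obtain ⟨dT, hT⟩ := exists_represents Inclusion.enc T
  obtain ⟨dA, hA⟩ := exists_represents GroundAtom.enc A.atoms
  obtain ⟨l, hl, hmem, -⟩ := exists_sorted_closureD hT hA
  exact ⟨l, hl, hmem⟩

/-- The entailed ground atoms as a sorted list. -/
noncomputable def closureList (A : ABoxFor T) : List GroundAtom :=
  (exists_sorted_closureGA A).choose

theorem pairwise_closureList (A : ABoxFor T) : (closureList A).Pairwise GroundAtom.LexLT :=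
  (exists_sorted_closureGA A).choose_spec.1

theorem mem_closureList {A : ABoxFor T} {α : GroundAtom} :
    α ∈ closureList A ↔ α ∈ closureGA T A :=
  (exists_sorted_closureGA A).choose_spec.2 α

theorem nodup_of_pairwise_lexLT {l : List GroundAtom} (h : l.Pairwise GroundAtom.LexLT) :
    l.Nodup := by
  refine List.Pairwise.imp (fun {α β} hlt => ?_) h
  rintro rfl
  exact lt_irrefl α.key hlt

theorem eq_of_pairwise_lexLT {l m : List GroundAtom} (hl : l.Pairwise GroundAtom.LexLT)
    (hm : m.Pairwise GroundAtom.LexLT) (h : ∀ α, α ∈ l ↔ α ∈ m) : l = m :=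
  List.Perm.eq_of_pairwise (fun α _ _ _ hαβ hβα => absurd hβα (lt_asymm (a := α.key) hαβ)) hl hm
    ((List.perm_ext_iff_of_nodup (nodup_of_pairwise_lexLT hl) (nodup_of_pairwise_lexLT hm)).2 h)

theorem closureD_eq_closureList {A : ABoxFor T} {dT dA : Data}
    (hT : Represents Inclusion.enc dT (T : Set Inclusion))
    (hA : Represents GroundAtom.enc dA (A.atoms : Set GroundAtom)) :
    closureD (.node dT dA) = encList GroundAtom.enc (closureList A) := by
  obtain ⟨l, hl, hmem, hclosure⟩ := exists_sorted_closureD hT hA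
  rw [hclosure, eq_of_pairwise_lexLT hl (pairwise_closureList A) fun α =>
    (hmem α).trans mem_closureList.symm]

/-- The censor that discloses the entailed ground atoms in their lexicographic order, as long as
consistency with the TBox and the policy is preserved. -/
noncomputable def greedyCensor (T : TBox) (P : Policy) : Censor T :=
  fun A => {α | α ∈ greedy T P [] (closureList A)}

theorem isCPCensorGA_greedyCensor (h : Consistent T P ∅) :
    IsCPCensorGA T P (greedyCensor T P) := by
  refine fun A => ⟨fun α hα => mem_closureList.1 ?_,
    consistent_greedy (h.mono fun β hβ => absurd hβ List.not_mem_nil) _⟩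
  simpa only [List.append_nil] using (greedy_subperm [] (closureList A)).subset hα

theorem isOptimalCPCensorGA_greedyCensor (h : Consistent T P ∅) :
    IsOptimalCPCensorGA T P (greedyCensor T P) := by
  refine ⟨isCPCensorGA_greedyCensor h, ?_⟩
  rintro ⟨cens', hcens', hsub, A, hA⟩
  obtain ⟨α, hα, hnotin⟩ := Set.exists_of_ssubset hA
  exact hnotin (mem_greedy_of_consistent (mem_closureList.2 ((hcens' A).1 hα))
    ((hcens' A).2.mono (Set.insert_subset hα (hsub A))))

theorem represents_greedyCensor (A : ABoxFor T) :
    Represents GroundAtom.enc (encList GroundAtom.enc (greedy T P [] (closureList A)))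
      (greedyCensor T P A) := by
  refine ⟨_, ?_, fun _ => Iff.rfl, rfl⟩
  obtain ⟨m, hperm, hsub⟩ := greedy_subperm (T := T) (P := P) [] (closureList A)
  rw [List.append_nil] at hsub
  exact hperm.nodup_iff.1 ((nodup_of_pairwise_lexLT (pairwise_closureList A)).sublist hsub)

end

/-! ### The run of the algorithm -/

/-- The body of the loop of `OptGACensor`. -/
def Prog.censorBody (con : Prog) : Prog :=
  .cons (.cons (.hd (.hd .arg)) (.tl (.hd .arg))) (.cons (.tl (.hd (.tl .arg)))
    (.ite (.call con (.cons (.hd (.hd .arg)) (.cons (.tl (.hd .arg))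
      (.cons (.hd (.hd (.tl .arg))) (.tl (.tl .arg))))))
      (.cons (.hd (.hd (.tl .arg))) (.tl (.tl .arg))) (.tl (.tl .arg))))

theorem run_censorBody {con : Prog} {dT dP a Th r : Data} {k : ℕ}
    (hcon : Run con (.node dT (.node dP (.node a Th))) r k) (l : Data) : ∃ n ≤ k + 50,
      Run (.censorBody con) (.node (.node dT dP) (.node (.node a l) Th))
        (.node (.node dT dP) (.node l (Data.ite r (.node a Th) Th))) n := by
  set s : Data := .node (.node dT dP) (.node (.node a l) Th)
  have hT : Run (.hd (.hd .arg)) s dT 3 := .hd (.hd (.arg _))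
  have hP : Run (.tl (.hd .arg)) s dP 3 := .tl (.hd (.arg _))
  have hl : Run (.tl (.hd (.tl .arg))) s l 4 := .tl (.hd (.tl (.arg _)))
  have hTh : Run (.tl (.tl .arg)) s Th 3 := .tl (.tl (.arg _))
  have hadd : Run (.cons (.hd (.hd (.tl .arg))) (.tl (.tl .arg))) s (.node a Th) (4 + 3 + 1) :=
    .cons (.hd (.hd (.tl (.arg _)))) hTh
  have hcall := Run.call (.cons hT (.cons hP hadd)) hcon
  cases r with
  | nil => exact ⟨_, by lia, .cons (.cons hT hP) (.cons hl (.iteElse hcall hTh))⟩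
  | node => exact ⟨_, by lia, .cons (.cons hT hP) (.cons hl (.iteThen hcall hadd))⟩

section

variable {cl con : Prog} {T : TBox} {P : Policy} {dT dP : Data} {B M : ℕ}
  (hcon : ∀ S : List GroundAtom, (encList GroundAtom.enc S).size ≤ B →
    ∃ (r : Data) (n : ℕ), n ≤ M ∧ Run con (.node dT (.node dP (encList GroundAtom.enc S))) r n ∧
      (r ≠ .nil ↔ Consistent T P {α | α ∈ S}))

include hcon

theorem run_censorLoop (l Th : List GroundAtom)
    (hB : (encList GroundAtom.enc l).size + (encList GroundAtom.enc Th).size ≤ B) :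
    ∃ n ≤ l.length * (M + 60) + 4, Run (.loop (.hd (.tl .arg)) (.censorBody con))
      (.node (.node dT dP) (.node (encList GroundAtom.enc l) (encList GroundAtom.enc Th)))
      (.node (.node dT dP) (.node .nil (encList GroundAtom.enc (greedy T P Th l)))) n := by
  induction l generalizing Th with
  | nil => exact ⟨4, by simp, .loopDone (.hd (.tl (.arg _)))⟩
  | cons α l ih =>
    simp only [encList, Data.size_node] at hB
    obtain ⟨r, k, hk, htest, hr⟩ := hcon (α :: Th) (by simp only [encList, Data.size_node]; lia)
    obtain ⟨m, hm, hbody⟩ := run_censorBody htest (encList GroundAtom.enc l)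
    have hnext : Data.ite r (.node α.enc (encList GroundAtom.enc Th)) (encList GroundAtom.enc Th) =
        encList GroundAtom.enc (addIfConsistent T P Th α) := by
      rw [addIfConsistent]
      cases r with
      | nil => rw [if_neg (mt hr.2 (not_not.2 rfl))]; rfl
      | node => rw [if_pos (hr.1 Data.noConfusion)]; rfl
    rw [hnext] at hbody
    obtain ⟨n, hn, hrest⟩ := ih (addIfConsistent T P Th α) (by
      rw [addIfConsistent]
      split_ifs
      · simp only [encList, Data.size_node]
        lia
      · lia)
    exact ⟨_, by rw [List.length_cons, Nat.succ_mul]; lia,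
      .loopStep (.hd (.tl (.arg _))) hbody hrest⟩

theorem run_optGACensor {dA : Data} {l : List GroundAtom} {k : ℕ}
    (hcl : Run cl (.node dT dA) (encList GroundAtom.enc l) k)
    (hB : (encList GroundAtom.enc l).size ≤ B) :
    ∃ n ≤ k + B * (M + 60) + 50, Run (OptGACensor cl con) (.node dT (.node dP dA))
      (encList GroundAtom.enc (greedy T P [] l)) n := by
  obtain ⟨n, hn, hloop⟩ := run_censorLoop hcon l []
    (by simpa only [encList, Data.size_nil, add_zero] using hB)
  have hlength : l.length ≤ B := by
    simpa only [toList_encList, List.length_map] using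
      (encList GroundAtom.enc l).length_toList_le.trans hB
  set x : Data := .node dT (.node dP dA)
  have hT : Run (.hd .arg) x dT 2 := .hd (.arg _)
  have hP : Run (.hd (.tl .arg)) x dP 3 := .hd (.tl (.arg _))
  have hA : Run (.tl (.tl .arg)) x dA 3 := .tl (.tl (.arg _))
  refine ⟨_, ?_, .call (.call (.cons (.cons hT hP) (.cons (.call (.cons hT hA) hcl) (.nil _)))
    hloop) (.tl (.tl (.arg _)))⟩
  have := Nat.mul_le_mul_right (M + 60) hlength
  lia

end

/-! ### The polynomial bound -/

theorem size_encList {α : Type} (enc : α → Data) (l : List α) :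
    (encList enc l).size = (l.map fun a => (enc a).size + 1).sum := by
  induction l with
  | nil => rfl
  | cons a l ih => simp only [encList, Data.size_node, ih, List.map_cons, List.sum_cons]; lia

theorem Represents.size_eq_sum {α : Type} {enc : α → Data} {d : Data} {s : Finset α}
    (h : Represents enc d (s : Set α)) : d.size = ∑ a ∈ s, ((enc a).size + 1) := by
  classical
  obtain ⟨l, hnodup, hl, rfl⟩ := h
  have hs : l.toFinset = s := by
    ext a
    rw [List.mem_toFinset, hl, Finset.mem_coe]
  rw [size_encList, ← hs, List.sum_toFinset _ hnodup]

theorem size_encName_le (a : Name) : (encName a).size ≤ 2 * a.length := by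
  induction a with
  | nil => rfl
  | cons b a ih =>
    have hbit : (encBool b).size ≤ 1 := by cases b <;> simp [encBool]
    simp only [encName, encList, Data.size_node, List.length_cons] at ih ⊢
    lia

theorem GroundAtom.size_enc_le (α : GroundAtom) : α.enc.size + 1 ≤ 7 * α.size := by
  cases α with
  | concept A a =>
    have hA := size_encName_le A
    have ha := size_encName_le a
    have hkind : (encName [false]).size = 1 := rfl
    simp only [enc, key, size, encList, Data.size_node, Data.size_nil, hkind]
    lia
  | role P a b =>
    have hP := size_encName_le P
    have ha := size_encName_le a
    have hb := size_encName_le b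
    have hkind : (encName [true]).size = 2 := rfl
    simp only [enc, key, size, encList, Data.size_node, Data.size_nil, hkind]
    lia

theorem ABoxFor.size_le_of_represents {T : TBox} {A : ABoxFor T} {dA : Data}
    (hA : Represents GroundAtom.enc dA (A.atoms : Set GroundAtom)) : dA.size ≤ 7 * A.size := by
  rw [hA.size_eq_sum, size, Finset.mul_sum]
  exact Finset.sum_le_sum fun α _ => α.size_enc_le

section

variable {cl con : Prog} {bcl bcon : Data → ℕ}

theorem computesClosureGA (hcl : ∀ x, ∃ n ≤ bcl x, Run cl x (closureD x) n) :
    ComputesClosureGA cl := by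
  intro T A dT dA hT hA
  obtain ⟨n, -, hrun⟩ := hcl (.node dT dA)
  rw [closureD_eq_closureList hT hA] at hrun
  exact ⟨closureList A, n, pairwise_closureList A, fun _ => mem_closureList, hrun⟩

theorem decidesConsistency (hcon : ∀ x, ∃ n ≤ bcon x, Run con x (consistentD x) n) :
    DecidesConsistency con := by
  intro T P S dT dP dS hT hP hS
  obtain ⟨n, -, hrun⟩ := hcon (.node dT (.node dP dS))
  exact ⟨_, n, hrun, consistentD_ne_nil hT hP hS.lists⟩

theorem exists_run_optGACensor_le_pow (hcl : ∀ x, ∃ n ≤ bcl x, Run cl x (closureD x) n)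
    (hbcl : PolyBounded (fun z => z.hd.size) bcl)
    (hcon : ∀ x, ∃ n ≤ bcon x, Run con x (consistentD x) n)
    (hbcon : PolyBounded (fun z => z.hd.size + z.tl.hd.size) bcon) (K : ℕ) :
    ∃ k, ∀ (T : TBox) (P : Policy) (A : ABoxFor T) (dT dP dA : Data),
      Represents Inclusion.enc dT (T : Set Inclusion) →
      Represents Denial.enc dP (P : Set Denial) →
      Represents GroundAtom.enc dA (A.atoms : Set GroundAtom) → dT.size + dP.size ≤ K →
      ∃ n ≤ ((Data.node dT dA).size + 2) ^ k, Run (OptGACensor cl con) (.node dT (.node dP dA))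
        (encList GroundAtom.enc (greedy T P [] (closureList A))) n := by
  have hsize := feasible_closureD.polyBounded_size
  obtain ⟨c, hc⟩ := hbcon K
  obtain ⟨k, hk⟩ := ((hbcl.add (hsize.mul (((hsize.add (.const _ (K + 4))).pow c).add
    (.const _ 60)))).add (.const _ 50)) K
  refine ⟨k, fun T P A dT dP dA hT hP hA hK => ?_⟩
  obtain ⟨m, hm, hclosure⟩ := hcl (.node dT dA)
  have hbound := hk (.node dT dA) ((Nat.le_add_right _ _).trans hK)
  beta_reduce at hbound
  rw [closureD_eq_closureList hT hA] at hclosure hbound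
  have htest (S : List GroundAtom)
      (hS : (encList GroundAtom.enc S).size ≤ (encList GroundAtom.enc (closureList A)).size) :
      ∃ (r : Data) (n : ℕ),
        n ≤ ((encList GroundAtom.enc (closureList A)).size + (K + 4)) ^ c ∧
        Run con (.node dT (.node dP (encList GroundAtom.enc S))) r n ∧
        (r ≠ .nil ↔ Consistent T P {α | α ∈ S}) := by
    obtain ⟨n, hn, hrun⟩ := hcon (.node dT (.node dP (encList GroundAtom.enc S)))
    refine ⟨_, n, hn.trans ((hc (.node dT (.node dP _)) hK).trans (Nat.pow_le_pow_left ?_ c)), hrun,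
      consistentD_ne_nil hT hP (Lists.of_list S)⟩
    simp only [Data.size_node]
    lia
  obtain ⟨n, hn, hrun⟩ := run_optGACensor htest hclosure le_rfl
  exact ⟨n, by lia, hrun⟩

theorem exists_polynomial_run_optGACensor (hcl : ∀ x, ∃ n ≤ bcl x, Run cl x (closureD x) n)
    (hbcl : PolyBounded (fun z => z.hd.size) bcl)
    (hcon : ∀ x, ∃ n ≤ bcon x, Run con x (consistentD x) n)
    (hbcon : PolyBounded (fun z => z.hd.size + z.tl.hd.size) bcon) (T : TBox) (P : Policy) :
    ∃ p : Polynomial ℕ, ∀ (A : ABoxFor T) (dT dP dA : Data),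
      Represents Inclusion.enc dT (T : Set Inclusion) →
      Represents Denial.enc dP (P : Set Denial) →
      Represents GroundAtom.enc dA (A.atoms : Set GroundAtom) →
      ∃ n ≤ p.eval A.size, Run (OptGACensor cl con) (.node dT (.node dP dA))
        (encList GroundAtom.enc (greedy T P [] (closureList A))) n := by
  obtain ⟨k, hk⟩ := exists_run_optGACensor_le_pow hcl hbcl hcon hbcon
    (∑ i ∈ T, (i.enc.size + 1) + ∑ δ ∈ P, (δ.enc.size + 1))
  let q : Polynomial ℕ := 7 * Polynomial.X + ((∑ i ∈ T, (i.enc.size + 1) + 3 : ℕ) : Polynomial ℕ)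
  refine ⟨q ^ k, fun A dT dP dA hT hP hA => ?_⟩
  obtain ⟨n, hn, hrun⟩ := hk T P A dT dP dA hT hP hA
    (by rw [hT.size_eq_sum, hP.size_eq_sum])
  refine ⟨n, hn.trans ?_, hrun⟩
  have hq : q.eval A.size = 7 * A.size + (dT.size + 3) := by
    simp only [q, hT.size_eq_sum, Polynomial.eval_add, Polynomial.eval_mul, Polynomial.eval_ofNat,
      Polynomial.eval_X, Polynomial.eval_natCast, Nat.cast_id]
  rw [Polynomial.eval_pow, hq, Data.size_node]
  have := ABoxFor.size_le_of_represents hA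
  exact Nat.pow_le_pow_left (by lia) k

end

end CQE

theorem mainTheorem6_general :
    ∃ cl con : CQE.Prog, CQE.ComputesClosureGA cl ∧ CQE.DecidesConsistency con ∧
      ∀ (T : CQE.TBox) (P : CQE.Policy), CQE.Consistent T P ∅ →
        ∃ cens : CQE.Censor T, CQE.IsOptimalCPCensorGA T P cens ∧
          ∃ p : Polynomial ℕ, ∀ (A : CQE.ABoxFor T) (dT dP dA : CQE.Data),
            CQE.Represents CQE.Inclusion.enc dT (T : Set CQE.Inclusion) →
            CQE.Represents CQE.Denial.enc dP (P : Set CQE.Denial) →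
            CQE.Represents CQE.GroundAtom.enc dA (A.atoms : Set CQE.GroundAtom) →
            ∃ (out : CQE.Data) (n : ℕ),
              CQE.Run (CQE.OptGACensor cl con) (.node dT (.node dP dA)) out n ∧
                n ≤ p.eval A.size ∧
                CQE.Represents CQE.GroundAtom.enc out (cens A) := by
  obtain ⟨cl, bcl, hcl, hbcl, -⟩ := CQE.feasible_closureD
  obtain ⟨con, bcon, hcon, hbcon, -⟩ := CQE.feasible_consistentD
  refine ⟨cl, con, CQE.computesClosureGA hcl, CQE.decidesConsistency hcon, fun T P hTP =>
    ⟨CQE.greedyCensor T P, CQE.isOptimalCPCensorGA_greedyCensor hTP, ?_⟩⟩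
  obtain ⟨p, hp⟩ := CQE.exists_polynomial_run_optGACensor hcl hbcl hcon hbcon T P
  refine ⟨p, fun A dT dP dA hT hP hA => ?_⟩
  obtain ⟨n, hn, hrun⟩ := hp A dT dP dA hT hP hA
  exact ⟨_, n, hrun, hn, CQE.represents_greedyCensor A⟩

theorem mainTheorem6 :
    ∃ cl con : CQE.Prog, CQE.ComputesClosureGA cl ∧ CQE.DecidesConsistency con ∧
      ∀ (T : CQE.TBox) (P : CQE.Policy), P.IsOver T → CQE.Consistent T P ∅ →
        ∃ cens : CQE.Censor T, CQE.IsOptimalCPCensorGA T P cens ∧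
          ∃ p : Polynomial ℕ, ∀ (A : CQE.ABoxFor T) (dT dP dA : CQE.Data),
            CQE.Represents CQE.Inclusion.enc dT (T : Set CQE.Inclusion) →
            CQE.Represents CQE.Denial.enc dP (P : Set CQE.Denial) →
            CQE.Represents CQE.GroundAtom.enc dA (A.atoms : Set CQE.GroundAtom) →
            ∃ (out : CQE.Data) (n : ℕ),
              CQE.Run (CQE.OptGACensor cl con) (.node dT (.node dP dA)) out n ∧
                n ≤ p.eval A.size ∧
                CQE.Represents CQE.GroundAtom.enc out (cens A) :=
  let ⟨cl, con, hcl, hcon, hcens⟩ := mainTheorem6_general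
  ⟨cl, con, hcl, hcon, fun T P _ => hcens T P⟩
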